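/- **Theorem 5.1 (quantitative concatenation).** *Notation.* For a real number $X$ put $[X]:=[1,X]\cap\mathbb{N}$. For a finite set $S$, $\mathbb{E}_{s\in S}$ denotes the average over $S$ (interpreted as $0$ if $S$ is empty). For $\delta>0$ and $M\ge 0$ define $\mu_{\delta,M}:\mathbb{Z}\to[0,\infty)$ by $$\mu_{\delta,M}(h):=\frac{\#\{(h_1,h_2)\in[\delta M]^2:\ h_1-h_2=h\}}{\delta^2M}$$ (interpreted as $0$ if $M=0$). For $f:\mathbb{Z}\to\mathbb{C}$ and $h\in\mathbb{Z}$ let $\Delta_hf(x):=f(x+h)\overline{f(x)}$, and let $\Delta_{h_1,\dots,h_s}f:=\Delta_{h_1}\cdots\Delta_{h_s}f$. For finitely supported $f$ and $s\ge1$ the $U^s$-norm is the nonnegative real number given by $$\|f\|_{U^s}^{2^s}:=\sum_{x,h_1,\dots,h_s\in\mathbb{Z}}\Delta_{h_1,\dots,h_s}f(x),$$ and for $T\subset\mathbb{Z}$ we put $\|f\|_{U^s(T)}:=\|f1_T\|_{U^s}$. *Statement.* There exist absolute constants $C>0$ and $c>0$ such that the following holds. Let $N\ge 0$ and $q\ge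 1$ be integers, let $f:\mathbb{Z}\to\mathbb{C}$ satisfy $|f(x)|\le 1$ for all $x$ and be supported in $[N]$, and let $0<\delta_1\le 1$ and $\delta_2,\delta_3>0$. Set $M:=(N/q)^{1/2}$, and suppose that $$\mathbb{E}_{a,b\in[\delta_1M]}\ \sum_{x,h_1,h_2,h_3\in\mathbb{Z}}\mu_{\delta_2,M}(h_1)\,\mu_{\delta_2,M}(h_2)\,\mu_{\delta_2,M}(h_3)\,\Delta_{2q(a+b)h_1,\;2qbh_2,\;2qah_3}f(x)\ \ge\ \delta_3NM^3$$ (the left-hand side is a real number). Then, if $\delta_2<C\delta_1^3\delta_3^4$, we have $$\mathbb{E}_{u\in[q]}\|f\|_{U^5(u+q\mathbb{Z})}^{2^5}\ \ge\ c\,(\delta_2\delta_3)^{2^{25}}(N/q)^6.$$ -/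

import Mathlib

open scoped BigOperators ComplexConjugate

noncomputable section

namespace QuantConcat

/-- `[X] = [1, X] ∩ ℕ`, as a finite set of integers, for a real number `X`. -/
def initSeg (X : ℝ) : Finset ℤ := Finset.Icc 1 ⌊X⌋

/-- The weight `μ_{δ,M}(h) = #{(h₁, h₂) ∈ [δM]² : h₁ - h₂ = h} / (δ² M)`. -/
def weight (δ M : ℝ) (h : ℤ) : ℝ :=
  (((initSeg (δ * M) ×ˢ initSeg (δ * M)).filter fun p => p.1 - p.2 = h).card : ℝ) / (δ ^ 2 * M)

/-- The multiplicative difference `Δ_h f (x) = f (x + h) * conj (f x)`. -/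
def mulDiff (h : ℤ) (f : ℤ → ℂ) : ℤ → ℂ := fun x => f (x + h) * conj (f x)

/-- `Δ_{h₁, …, h_s} f = Δ_{h₁} (⋯ (Δ_{h_s} f))`, for a list `[h₁, …, h_s]`. -/
def iterDiff (l : List ℤ) (f : ℤ → ℂ) : ℤ → ℂ := l.foldr mulDiff f

/-- `∑_{x, h₁, …, h_s} Δ_{h₁, …, h_s} f (x)`, a finite sum when `f` has finite support
and `s ≥ 1`. -/
def gowersSum (s : ℕ) (f : ℤ → ℂ) : ℂ :=
  ∑' x : ℤ, ∑' h : Fin s → ℤ, iterDiff (List.ofFn h) f x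

/-- The (unnormalized) `U^s`-norm of a finitely supported function, for `s ≥ 1`: the nonnegative
real number whose `2^s`-th power is `gowersSum s f` (which is then real and nonnegative). -/
def gowersNorm (s : ℕ) (f : ℤ → ℂ) : ℝ := (gowersSum s f).re ^ ((1 : ℝ) / 2 ^ s)

/-- The `U^s`-norm localized to a set `T`, i.e. the `U^s`-norm of `f 1_T`. -/
def gowersNormOn (s : ℕ) (T : Set ℤ) (f : ℤ → ℂ) : ℝ := gowersNorm s (T.indicator f)

/-- The residue class `u + qℤ`. -/
def resClass (u : ℤ) (q : ℕ) : Set ℤ := {x | ∃ k : ℤ, x = u + (q : ℤ) * k}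

/-- `∑_{x, h₁, h₂, h₃} μ_{δ,M}(h₁) μ_{δ,M}(h₂) μ_{δ,M}(h₃) Δ_{c₁h₁, c₂h₂, c₃h₃} f (x)`. -/
def boxSum (δ M : ℝ) (c₁ c₂ c₃ : ℤ) (f : ℤ → ℂ) : ℂ :=
  ∑' (x : ℤ) (h₁ : ℤ) (h₂ : ℤ) (h₃ : ℤ),
    ((weight δ M h₁ * weight δ M h₂ * weight δ M h₃ : ℝ) : ℂ) *
      iterDiff [c₁ * h₁, c₂ * h₂, c₃ * h₃] f x

end QuantConcat

end

noncomputable section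

namespace QuantConcat

/-! ### Box-type Cauchy–Schwarz inequalities -/

section CauchySchwarz

/-! Split `f` into its restrictions to the residue classes mod `q`. In the coordinate `x = u + q z`
the shifts lose their factor `q`, and each restriction becomes a 1-bounded function `g` on `O(N/q)`
points, which can be copied to `ℤ/mℤ` with `m` odd and so large that nothing wraps around (`Rel`).
Write `A = ⌊δ₁ M⌋`, `H = ⌊δ₂ M⌋`, `L = 2N/q`, and `K` of order `δ₂⁻²`. Since `M² = N/q`, the
quantities `A²`, `H²` and `L` agree up to powers of `K`. It suffices that a class with a large box
sum has `‖g‖_{U⁵}³² ≥ K^{-O(1)} L⁶`; such classes are frequent enough to finish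
(`le_sum_of_popular`).

For one class, freeze `b` and the shift `b h₂`, and put `F = Δ_{b h₂} g`. Expanding the other two
differences gives `F(y) F(y+s)` times the conjugates of `F(y+(a+b)k)` and `F(y+ak')`, where `s =
(a+b)k + ak'`. Cauchy–Schwarz over `(y, s)` discards the first two factors and leaves, for each pair
`(a, a')`, a four-point form over the lattice `(a+b)k + ak' = (a'+b)l + a'l'`
(`sum_two_diff_sq_le`). Translating the lattice variable by three further lattice points and
applying Cauchy–Schwarz three times leaves only `F`, differenced in three directions
(`latForm_pow_le`). If the coefficients have small pairwise gcds, each direction takes every value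
boundedly often (`card_lat_fiber_le`), so by positivity the sum over these directions is dominated
by the full `U⁴` sum of `F`.

Hence the `U⁴` powers of `Δ_{b h₂} g` are large on average over `b` and `h₂`. A last Cauchy–Schwarz
replaces the shift by a difference `b h - b' h'` (`sum_gowersPow_gdiff_sq_le`). For nearly coprime
`b, b'` these differences hit each integer with bounded excess (`sum_diff_shift_le`), so the average
is dominated by a sum over all shifts, which is the `U⁵` power of `g`.

The arithmetic input is that a linear equation with small gcd has few solutions in a box
(`card_linear_rep_le`) and that gcds above `D` occur for a proportion `O(1/D)` of pairs
(`card_gcd_gt_le`). Exceptional parameters are bounded trivially; the thresholds for `D` are powers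
of `K` just large enough that they absorb at most half of the main term. -/

theorem norm_sum_mul_sq_le {ι : Type*} (s : Finset ι) (a b : ι → ℂ) :
    ‖∑ i ∈ s, a i * b i‖ ^ 2 ≤ (∑ i ∈ s, ‖a i‖ ^ 2) * ∑ i ∈ s, ‖b i‖ ^ 2 := by
  calc ‖∑ i ∈ s, a i * b i‖ ^ 2 ≤ (∑ i ∈ s, ‖a i‖ * ‖b i‖) ^ 2 := by
        gcongr
        exact (norm_sum_le _ _).trans_eq (by simp)
    _ ≤ _ := Finset.sum_mul_sq_le_sq_mul_sq s _ _

theorem norm_sum_sq_eq {ι : Type*} (s : Finset ι) (z : ι → ℂ) :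
    ((‖∑ i ∈ s, z i‖ ^ 2 : ℝ) : ℂ) = ∑ i ∈ s, ∑ j ∈ s, z i * conj (z j) := by
  rw [← Finset.sum_mul_sum, ← map_sum, Complex.mul_conj, Complex.normSq_eq_norm_sq]

theorem cs_square {I J : Type*} [Fintype I] [Fintype J] (b : I → ℂ) (F : I → J → ℂ) :
    ‖∑ i, (∑ j, F i j) * b i‖ ^ 2 ≤
      (∑ i, ‖b i‖ ^ 2) * ‖∑ i, ∑ j, ∑ j', F i j * conj (F i j')‖ := by
  have h := norm_sum_mul_sq_le Finset.univ b (fun i => ∑ j, F i j)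
  have h2 : (∑ i, ‖∑ j, F i j‖ ^ 2) = ‖∑ i, ∑ j, ∑ j', F i j * conj (F i j')‖ := by
    simp only [← norm_sum_sq_eq]
    rw [← Complex.ofReal_sum, Complex.norm_real, Real.norm_of_nonneg (by positivity)]
  rw [← h2]
  simpa only [mul_comm] using h

theorem box_cs_one {X E : Type*} [Fintype X] [Fintype E] {B : ℝ}
    (F : X → E → ℂ) (b : X → ℂ) (hb : ∑ x, ‖b x‖ ^ 2 ≤ B) :
    ‖∑ x, ∑ e, F x e * b x‖ ^ 2 ≤ B * ‖∑ x, ∑ e, ∑ e', F x e * conj (F x e')‖ := by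
  simp only [← Finset.sum_mul]
  exact (cs_square b F).trans (by gcongr)

/-- Doubling `k` removes `c`, which does not depend on `k`; doubling `e` with `k, k'` frozen then
removes `b`. Only the `ℓ²` mass `B` of the discarded factors enters, never the size of the group in
which `x` varies. -/
theorem box_cs_two {X E : Type*} [Fintype X] [Fintype E] {B : ℝ}
    (F : X → E → E → ℂ) (b c : X → E → ℂ) (hb1 : ∀ x e, ‖b x e‖ ≤ 1)
    (hb : ∀ e, ∑ x, ‖b x e‖ ^ 2 ≤ B) (hc : ∀ e, ∑ x, ‖c x e‖ ^ 2 ≤ B) :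
    ‖∑ x, ∑ e, ∑ k, F x e k * b x k * c x e‖ ^ 4 ≤
      B ^ 3 * (Fintype.card E : ℝ) ^ 4 *
        ‖∑ x, ∑ k, ∑ k', ∑ e, ∑ e', (F x e k * conj (F x e k')) *
          conj (F x e' k * conj (F x e' k'))‖ := by
  have h1 := cs_square (I := X × E) (J := E) (fun i => c i.1 i.2)
    (fun i k => F i.1 i.2 k * b i.1 k)
  have hc' : ∑ i : X × E, ‖c i.1 i.2‖ ^ 2 ≤ B * Fintype.card E := by
    rw [Fintype.sum_prod_type_right]
    exact (Finset.sum_le_sum fun e _ => hc e).trans_eq (by simp [mul_comm])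
  have h2 := box_cs_one (X := X × E × E) (E := E) (B := B * Fintype.card E ^ 2)
    (fun i e => F i.1 e i.2.1 * conj (F i.1 e i.2.2))
    (fun i => b i.1 i.2.1 * conj (b i.1 i.2.2)) (by
      rw [Fintype.sum_prod_type_right]
      calc _ ≤ ∑ _y : E × E, B := by
            refine Finset.sum_le_sum fun y _ => (Finset.sum_le_sum fun x _ => ?_).trans (hb y.1)
            rw [norm_mul, RCLike.norm_conj, mul_pow]
            exact mul_le_of_le_one_right (by positivity) (pow_le_one₀ (norm_nonneg _) (hb1 _ _))
        _ = _ := by simp; ring)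
  simp only [Fintype.sum_prod_type, Finset.sum_mul] at h1 h2
  set S0 := ∑ x, ∑ e, ∑ k, F x e k * b x k * c x e
  set S2 := ∑ x, ∑ k, ∑ k', ∑ e, ∑ e', (F x e k * conj (F x e k')) *
          conj (F x e' k * conj (F x e' k'))
  have e1 : (∑ x, ∑ e, ∑ j, ∑ j', F x e j * b x j * conj (F x e j' * b x j')) =
      ∑ x, ∑ k, ∑ k', ∑ e, F x e k * conj (F x e k') * (b x k * conj (b x k')) := by
    refine Finset.sum_congr rfl fun x _ => ?_
    rw [Finset.sum_comm]
    refine Finset.sum_congr rfl fun k _ => ?_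
    rw [Finset.sum_comm]
    refine Finset.sum_congr rfl fun k' _ => Finset.sum_congr rfl fun e _ => ?_
    simp only [map_mul]; ring
  rw [e1] at h1
  rw [Fintype.sum_prod_type] at hc'
  set S1 := ∑ x, ∑ k, ∑ k', ∑ e, F x e k * conj (F x e k') * (b x k * conj (b x k'))
  simp only [← Finset.sum_mul] at h1
  calc ‖S0‖ ^ 4 = (‖S0‖ ^ 2) ^ 2 := by ring
    _ ≤ (B * Fintype.card E * ‖S1‖) ^ 2 := by
        gcongr
        exact h1.trans (mul_le_mul_of_nonneg_right hc' (norm_nonneg _))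
    _ ≤ (B * Fintype.card E) ^ 2 * (B * Fintype.card E ^ 2 * ‖S2‖) := by
        rw [mul_pow]; gcongr
    _ = _ := by ring

/-- Each of `b, c, d` misses one of the variables `e, k, l`. Doubling `l` removes `d`, and the other
two go by `box_cs_two` with the pair `(l, l')` absorbed into `x`. -/
theorem box_cs_three {X E : Type*} [Fintype X] [Fintype E] {B : ℝ}
    (F : X → E → E → E → ℂ) (b c d : X → E → E → ℂ) (hb1 : ∀ x e k, ‖b x e k‖ ≤ 1)
    (hc1 : ∀ x e k, ‖c x e k‖ ≤ 1)
    (hb : ∀ e k, ∑ x, ‖b x e k‖ ^ 2 ≤ B) (hc : ∀ e k, ∑ x, ‖c x e k‖ ^ 2 ≤ B)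
    (hd : ∀ e k, ∑ x, ‖d x e k‖ ^ 2 ≤ B) :
    ‖∑ x, ∑ e, ∑ k, ∑ l, F x e k l * b x k l * c x e l * d x e k‖ ^ 8 ≤
      B ^ 7 * (Fintype.card E : ℝ) ^ 18 *
        ‖∑ x, ∑ l, ∑ l', ∑ k, ∑ k', ∑ e, ∑ e',
          ((F x e k l * conj (F x e k l')) * conj (F x e k' l * conj (F x e k' l'))) *
          conj ((F x e' k l * conj (F x e' k l')) *
            conj (F x e' k' l * conj (F x e' k' l')))‖ := by
  have h1 := cs_square (I := X × E × E) (J := E) (fun i => d i.1 i.2.1 i.2.2)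
    (fun i l => F i.1 i.2.1 i.2.2 l * b i.1 i.2.2 l * c i.1 i.2.1 l)
  have hd' : ∑ i : X × E × E, ‖d i.1 i.2.1 i.2.2‖ ^ 2 ≤ B * Fintype.card E ^ 2 := by
    rw [Fintype.sum_prod_type_right]
    exact (Finset.sum_le_sum fun e _ => hd e.1 e.2).trans_eq (by simp; ring)
  have aux : ∀ b : X → E → E → ℂ, (∀ x e k, ‖b x e k‖ ≤ 1) →
      (∀ e k, ∑ x, ‖b x e k‖ ^ 2 ≤ B) → ∀ e,
      ∑ i : X × E × E, ‖b i.1 e i.2.1 * conj (b i.1 e i.2.2)‖ ^ 2 ≤ B * Fintype.card E ^ 2 := by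
    intro b hb1 hb e
    rw [Fintype.sum_prod_type_right]
    calc _ ≤ ∑ _y : E × E, B := by
          refine Finset.sum_le_sum fun y _ => (Finset.sum_le_sum fun x _ => ?_).trans (hb e y.1)
          rw [norm_mul, RCLike.norm_conj, mul_pow]
          exact mul_le_of_le_one_right (by positivity) (pow_le_one₀ (norm_nonneg _) (hb1 _ _ _))
      _ = _ := by simp; ring
  have h2 := box_cs_two (X := X × E × E) (E := E) (B := B * Fintype.card E ^ 2)
    (fun i e k => F i.1 e k i.2.1 * conj (F i.1 e k i.2.2))
    (fun i k => b i.1 k i.2.1 * conj (b i.1 k i.2.2))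
    (fun i e => c i.1 e i.2.1 * conj (c i.1 e i.2.2))
    (fun x e => by
      rw [norm_mul, RCLike.norm_conj]
      exact mul_le_one₀ (hb1 _ _ _) (norm_nonneg _) (hb1 _ _ _))
    (aux b hb1 hb) (aux c hc1 hc)
  simp only [Fintype.sum_prod_type, Finset.sum_mul] at h1 h2 hd'
  have e1 : (∑ x, ∑ e, ∑ k, ∑ j, ∑ j', F x e k j * b x k j * c x e j *
        conj (F x e k j' * b x k j' * c x e j')) =
      ∑ x, ∑ l, ∑ l', ∑ e, ∑ k, F x e k l * conj (F x e k l') * (b x k l * conj (b x k l')) *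
        (c x e l * conj (c x e l')) := by
    refine Finset.sum_congr rfl fun x _ => ?_
    have : ∀ Q : E → E → E → E → ℂ, (∑ e, ∑ k, ∑ j, ∑ j', Q e k j j') =
        ∑ j, ∑ j', ∑ e, ∑ k, Q e k j j' := by
      intro Q
      calc _ = ∑ e, ∑ j, ∑ j', ∑ k, Q e k j j' := by
            refine Finset.sum_congr rfl fun e _ => ?_
            rw [Finset.sum_comm]
            exact Finset.sum_congr rfl fun j _ => Finset.sum_comm
        _ = _ := by
            rw [Finset.sum_comm]
            exact Finset.sum_congr rfl fun j _ => Finset.sum_comm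
    rw [this]
    refine Finset.sum_congr rfl fun l _ => Finset.sum_congr rfl fun l' _ =>
      Finset.sum_congr rfl fun e _ => Finset.sum_congr rfl fun k _ => ?_
    simp only [map_mul]; ring
  rw [e1] at h1
  set S0 := ∑ x, ∑ e, ∑ k, ∑ l, F x e k l * b x k l * c x e l * d x e k
  set S1 := ∑ x, ∑ l, ∑ l', ∑ e, ∑ k, F x e k l * conj (F x e k l') *
    (b x k l * conj (b x k l')) * (c x e l * conj (c x e l'))
  set S3 := ∑ x, ∑ l, ∑ l', ∑ k, ∑ k', ∑ e, ∑ e',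
          ((F x e k l * conj (F x e k l')) * conj (F x e k' l * conj (F x e k' l'))) *
          conj ((F x e' k l * conj (F x e' k l')) *
            conj (F x e' k' l * conj (F x e' k' l')))
  simp only [← Finset.sum_mul] at h1
  calc ‖S0‖ ^ 8 = (‖S0‖ ^ 2) ^ 4 := by ring
    _ ≤ (B * Fintype.card E ^ 2 * ‖S1‖) ^ 4 := by
        gcongr
        exact h1.trans (mul_le_mul_of_nonneg_right hd' (norm_nonneg _))
    _ ≤ (B * Fintype.card E ^ 2) ^ 4 *
          ((B * Fintype.card E ^ 2) ^ 3 * Fintype.card E ^ 4 * ‖S3‖) := by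
        rw [mul_pow]; gcongr
    _ = _ := by ring

end CauchySchwarz

/-! ### Multiplicative differences and Gowers norms on a finite abelian group -/

section Group
variable {G : Type*} [AddCommGroup G]

/-- The multiplicative difference on an arbitrary abelian group. -/
def gdiff (h : G) (f : G → ℂ) : G → ℂ := fun x => f (x + h) * conj (f x)

theorem gdiff_comm (h k : G) (f : G → ℂ) : gdiff h (gdiff k f) = gdiff k (gdiff h f) := by
  funext x
  simp only [gdiff, map_mul, Complex.conj_conj]
  rw [add_right_comm x h k]; ring

theorem norm_gdiff_le {f : G → ℂ} (hf : ∀ x, ‖f x‖ ≤ 1) (h x : G) : ‖gdiff h f x‖ ≤ ‖f x‖ := by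
  rw [gdiff, norm_mul, RCLike.norm_conj]
  exact mul_le_of_le_one_left (norm_nonneg _) (hf _)

end Group

section FiniteGroup
variable {G : Type*} [Fintype G]

/-- `L`-bounded functions: bounded by `1` pointwise and by `L` in `ℓ¹`. -/
structure Bdd (L : ℝ) (f : G → ℂ) : Prop where
  norm_le : ∀ x, ‖f x‖ ≤ 1
  sum_le : ∑ x, ‖f x‖ ≤ L

theorem Bdd.nonneg {L : ℝ} {f : G → ℂ} (hf : Bdd L f) : 0 ≤ L :=
  le_trans (by positivity) hf.sum_le

theorem Bdd.norm_sum_le {L : ℝ} {f : G → ℂ} (hf : Bdd L f) : ‖∑ x, f x‖ ≤ L :=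
  (_root_.norm_sum_le _ _).trans hf.sum_le

variable [AddCommGroup G]

theorem Bdd.gdiff {L : ℝ} {f : G → ℂ} (hf : Bdd L f) (h : G) : Bdd L (gdiff h f) :=
  ⟨fun x => (norm_gdiff_le hf.norm_le h x).trans (hf.norm_le x),
    (Finset.sum_le_sum fun x _ => norm_gdiff_le hf.norm_le h x).trans hf.sum_le⟩

theorem Bdd.sum_sq_le {L : ℝ} {f : G → ℂ} (hf : Bdd L f) (c : G) :
    ∑ x, ‖f (x + c)‖ ^ 2 ≤ L := by
  refine (Equiv.sum_comp (Equiv.addRight c) (fun x => ‖f x‖ ^ 2)).trans_le ?_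
  refine le_trans (Finset.sum_le_sum fun x _ => ?_) hf.sum_le
  rw [sq]
  exact mul_le_of_le_one_left (norm_nonneg _) (hf.norm_le _)

theorem sum_gdiff (f : G → ℂ) : ∑ h, ∑ x, gdiff h f x = ((‖∑ x, f x‖ ^ 2 : ℝ) : ℂ) := by
  rw [norm_sum_sq_eq, Finset.sum_comm, Finset.sum_comm (s := Finset.univ) (t := Finset.univ)
    (f := fun i j => f i * conj (f j))]
  refine Finset.sum_congr rfl fun x _ => ?_
  exact Equiv.sum_comp (Equiv.addLeft x) (fun y => f y * conj (f x))

theorem sum_norm_gdiff (f : G → ℂ) : ∑ h, ∑ x, ‖gdiff h f x‖ = (∑ x, ‖f x‖) ^ 2 := by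
  rw [sq, Finset.sum_mul_sum, Finset.sum_comm, Finset.sum_comm (s := Finset.univ)
    (t := Finset.univ) (f := fun i j => ‖f i‖ * ‖f j‖)]
  refine Finset.sum_congr rfl fun x _ => ?_
  simp only [gdiff, norm_mul, RCLike.norm_conj]
  exact Equiv.sum_comp (Equiv.addLeft x) (fun y => ‖f y‖ * ‖f x‖)

/-- `gowersPow s f` is the `2^(s+1)`-th power of the unnormalized `U^(s+1)`-norm on `G`. -/
def gowersPow : ℕ → (G → ℂ) → ℝ
  | 0, f => ‖∑ x, f x‖ ^ 2
  | s + 1, f => ∑ h, gowersPow s (gdiff h f)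

theorem gowersPow_nonneg (s : ℕ) (f : G → ℂ) : 0 ≤ gowersPow s f := by
  induction s generalizing f with
  | zero => simp only [gowersPow]; positivity
  | succ s ih => exact Finset.sum_nonneg fun h _ => ih _

theorem gowersPow_le {L : ℝ} (s : ℕ) {f : G → ℂ} (hf : Bdd L f) :
    gowersPow s f ≤ L ^ (s + 1) * ∑ x, ‖f x‖ := by
  induction s generalizing f with
  | zero =>
    simp only [gowersPow, zero_add, pow_one, sq]
    exact mul_le_mul hf.norm_sum_le (norm_sum_le _ _) (norm_nonneg _) hf.nonneg
  | succ s ih =>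
    have hL := hf.nonneg
    calc gowersPow (s + 1) f ≤ ∑ h, L ^ (s + 1) * ∑ x, ‖gdiff h f x‖ :=
          Finset.sum_le_sum fun h _ => ih (hf.gdiff h)
      _ = L ^ (s + 1) * ((∑ x, ‖f x‖) * ∑ x, ‖f x‖) := by
          rw [← Finset.mul_sum, sum_norm_gdiff, sq]
      _ ≤ L ^ (s + 1) * (L * ∑ x, ‖f x‖) := by gcongr; exact hf.sum_le
      _ = _ := by ring

theorem gowersPow_le_pow {L : ℝ} (s : ℕ) {f : G → ℂ} (hf : Bdd L f) :
    gowersPow s f ≤ L ^ (s + 2) := by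
  refine (gowersPow_le s hf).trans ?_
  have hL := hf.nonneg
  calc _ ≤ L ^ (s + 1) * L := by gcongr; exact hf.sum_le
    _ = _ := by ring

/-- Cauchy–Schwarz for a family of functions, doubling the shift parameter. -/
theorem sum_gdiff_family_sq_le {ι J : Type*} [Fintype ι] (s : Finset J) (τ : J → G)
    (φ : ι → G → ℂ) (Γ : G → ℝ) (hΓ : ∀ j, (Γ j : ℂ) = ∑ i, ∑ x, gdiff j (φ i) x) {B : ℝ}
    (hB : ∑ i, ∑ x, ‖φ i x‖ ^ 2 ≤ B) :
    (∑ j ∈ s, Γ (τ j)) ^ 2 ≤ B * ∑ j ∈ s, ∑ j' ∈ s, Γ (τ j - τ j') := by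
  have h1 : ((∑ j ∈ s, Γ (τ j) : ℝ) : ℂ) =
      ∑ y : ι × G, conj (φ y.1 y.2) * ∑ j ∈ s, φ y.1 (y.2 + τ j) := by
    push_cast
    simp only [hΓ, Fintype.sum_prod_type, Finset.mul_sum]
    rw [Finset.sum_comm]
    refine Finset.sum_congr rfl fun i _ => ?_
    rw [Finset.sum_comm]
    refine Finset.sum_congr rfl fun x _ => Finset.sum_congr rfl fun j _ => ?_
    rw [gdiff, mul_comm]
  have h2 : (∑ y : ι × G, ‖∑ j ∈ s, φ y.1 (y.2 + τ j)‖ ^ 2) =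
      ∑ j ∈ s, ∑ j' ∈ s, Γ (τ j - τ j') := by
    apply Complex.ofReal_injective
    rw [Complex.ofReal_sum]
    simp only [norm_sum_sq_eq]
    push_cast
    rw [Finset.sum_comm]
    refine Finset.sum_congr rfl fun j _ => ?_
    rw [Finset.sum_comm]
    refine Finset.sum_congr rfl fun j' _ => ?_
    rw [hΓ, Fintype.sum_prod_type]
    refine Finset.sum_congr rfl fun i _ => ?_
    rw [← Equiv.sum_comp (Equiv.addRight (τ j')) (fun x => gdiff (τ j - τ j') (φ i) x)]
    refine Finset.sum_congr rfl fun x _ => ?_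
    simp only [gdiff, Equiv.coe_addRight]
    rw [add_assoc, add_sub_cancel]
  have h3 := norm_sum_mul_sq_le Finset.univ (fun y : ι × G => conj (φ y.1 y.2))
    (fun y => ∑ j ∈ s, φ y.1 (y.2 + τ j))
  rw [← h1, h2, Complex.norm_real, Real.norm_eq_abs, sq_abs] at h3
  refine h3.trans ?_
  refine mul_le_mul_of_nonneg_right ?_ (by rw [← h2]; positivity)
  simp only [RCLike.norm_conj, Fintype.sum_prod_type]
  exact hB

/-- Since differences commute, the `U⁴` power of `Δ_j g` is the autocorrelation at `j` of the family
of fourth-order differences of `g`, so `sum_gdiff_family_sq_le` applies. The total mass of that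
family is at most `L⁵`: each new difference, summed over its shift, costs one factor `L`. -/
theorem sum_gowersPow_gdiff_sq_le {J : Type*} (s : Finset J) (τ : J → G) {L : ℝ} {g : G → ℂ}
    (hg : Bdd L g) :
    (∑ j ∈ s, gowersPow 3 (gdiff (τ j) g)) ^ 2 ≤
      L ^ 5 * ∑ j ∈ s, ∑ j' ∈ s, gowersPow 3 (gdiff (τ j - τ j') g) := by
  have hL := hg.nonneg
  refine sum_gdiff_family_sq_le (ι := G × G × G × G) s τ
    (fun n => gdiff n.2.2.2 (gdiff n.2.2.1 (gdiff n.2.1 (gdiff n.1 g))))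
    (fun j => gowersPow 3 (gdiff j g)) ?_ ?_
  · intro j
    simp only [gowersPow, Fintype.sum_prod_type, Complex.ofReal_sum, ← sum_gdiff]
    refine Finset.sum_congr rfl fun a _ => Finset.sum_congr rfl fun b _ =>
      Finset.sum_congr rfl fun c _ => Finset.sum_congr rfl fun d _ => ?_
    rw [gdiff_comm a j, gdiff_comm b j, gdiff_comm c j, gdiff_comm d j]
  · simp only [Fintype.sum_prod_type]
    have key : ∀ {f : G → ℂ} (_ : Bdd L f), ∑ h, ∑ x, ‖gdiff h f x‖ ≤ L * ∑ x, ‖f x‖ := by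
      intro f hf
      rw [sum_norm_gdiff, sq]
      gcongr
      exact hf.sum_le
    calc _ ≤ ∑ a, ∑ b, ∑ c, ∑ d, ∑ x, ‖gdiff d (gdiff c (gdiff b (gdiff a g))) x‖ := by
          gcongr with a _ b _ c _ d _ x _
          rw [sq]
          exact mul_le_of_le_one_left (norm_nonneg _)
            (((((hg.gdiff a).gdiff b).gdiff c).gdiff d).norm_le x)
      _ ≤ ∑ a, ∑ b, ∑ c, L * ∑ x, ‖gdiff c (gdiff b (gdiff a g)) x‖ := by
          gcongr with a _ b _ c _
          exact key (((hg.gdiff a).gdiff b).gdiff c)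
      _ ≤ ∑ a, ∑ b, L * (L * ∑ x, ‖gdiff b (gdiff a g) x‖) := by
          gcongr with a _ b _
          rw [← Finset.mul_sum]
          gcongr
          exact key ((hg.gdiff a).gdiff b)
      _ ≤ ∑ a, L * (L * (L * ∑ x, ‖gdiff a g x‖)) := by
          gcongr with a _
          rw [← Finset.mul_sum, ← Finset.mul_sum]
          gcongr
          exact key (hg.gdiff a)
      _ ≤ L * (L * (L * (L * L))) := by
          rw [← Finset.mul_sum, ← Finset.mul_sum, ← Finset.mul_sum]
          gcongr
          exact (key hg).trans (by gcongr; exact hg.sum_le)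
      _ = _ := by ring

end FiniteGroup

/-! ### Counting solutions of linear equations and pairs with large gcd -/

section Counting

/-- Along solutions the first coordinate is fixed modulo `w = v / gcd(u, v)`, and `w ≥ H / D²`. An
interval of length `8H` therefore carries `O(D²)` of them, and the second coordinate is determined
by the first. -/
theorem card_linear_rep_le {u v c : ℤ} {H D : ℕ} (hv : 0 < v) (hD : u.gcd v ≤ D)
    (hH : (H : ℤ) ≤ v * D) (S : Finset (ℤ × ℤ))
    (hS : ∀ p ∈ S, |p.1| ≤ 4 * H ∧ u * p.1 + v * p.2 = c) : S.card ≤ 17 * D ^ 2 := by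
  rcases S.eq_empty_or_nonempty with rfl | ⟨p₀, hp₀⟩
  · simp
  have hg : 0 < u.gcd v := Int.gcd_pos_of_ne_zero_right _ hv.ne'
  have hD1 : 1 ≤ D := by omega
  set g : ℤ := (u.gcd v : ℤ) with hgdef
  obtain ⟨w, hw⟩ : g ∣ v := Int.gcd_dvd_right ..
  obtain ⟨z, hz⟩ : g ∣ u := Int.gcd_dvd_left ..
  have hgpos : 0 < g := Int.natCast_pos.mpr hg
  have hwpos : 0 < w := by
    rw [hw] at hv
    exact pos_of_mul_pos_right hv hgpos.le
  have hcop : IsCoprime w z := by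
    have h1 : Int.gcd z w = 1 := by
      have h2 : u.gcd v = (u.gcd v) * z.gcd w := by
        conv_lhs => rw [hz, hw]
        rw [Int.gcd_mul_left, hgdef, Int.natAbs_natCast]
      nlinarith [Nat.eq_of_mul_eq_mul_left hg (by rw [← h2, mul_one] : u.gcd v * z.gcd w = u.gcd v * 1)]
    exact (Int.isCoprime_iff_gcd_eq_one.mpr h1).symm
  have hdvd : ∀ p ∈ S, w ∣ p.1 - p₀.1 := by
    intro p hp
    have h1 := (hS p hp).2
    have h2 := (hS p₀ hp₀).2
    have h3 : g * (z * (p.1 - p₀.1)) = g * (w * (p₀.2 - p.2)) := by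
      rw [← mul_assoc, ← mul_assoc, ← hz, ← hw]; linarith
    have h4 := mul_left_cancel₀ hgpos.ne' h3
    exact hcop.dvd_of_dvd_mul_left ⟨_, h4⟩
  have hinj : Set.InjOn (fun p : ℤ × ℤ => (p.1 - p₀.1) / w) S := by
    intro p hp p' hp' h
    have e1 : p.1 = p'.1 := by
      have h1 := Int.mul_ediv_cancel' (hdvd p hp)
      have h2 := Int.mul_ediv_cancel' (hdvd p' hp')
      simp only at h
      rw [h] at h1
      linarith
    have e2 : v * p.2 = v * p'.2 := by
      have h1 := (hS p hp).2
      have h2 := (hS p' hp').2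
      rw [e1] at h1; linarith
    exact Prod.ext e1 (mul_left_cancel₀ hv.ne' e2)
  have hmaps : Set.MapsTo (fun p : ℤ × ℤ => (p.1 - p₀.1) / w) S
      (Finset.Icc (-(8 * (D : ℤ) ^ 2)) (8 * (D : ℤ) ^ 2)) := by
    intro p hp
    obtain ⟨t, ht⟩ := hdvd p hp
    have h1 := (hS p hp).1
    have h2 := (hS p₀ hp₀).1
    have h3 : |w * t| ≤ 8 * H := by
      rw [← ht]
      calc |p.1 - p₀.1| ≤ |p.1| + |p₀.1| := abs_sub _ _
        _ ≤ _ := by linarith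
    have h4 : w * |t| ≤ w * (8 * D ^ 2) := by
      calc w * |t| = |w * t| := by rw [abs_mul, abs_of_pos hwpos]
        _ ≤ 8 * H := h3
        _ ≤ 8 * (g * w * D) := by rw [← hw]; linarith
        _ ≤ 8 * (D * w * D) := by
            have : g ≤ D := by rw [hgdef]; exact_mod_cast hD
            gcongr
        _ = _ := by ring
    have h5 := le_of_mul_le_mul_left h4 hwpos
    simp only [ht, Int.mul_ediv_cancel_left _ hwpos.ne', Finset.coe_Icc, Set.mem_Icc]
    exact abs_le.mp h5
  have h := Finset.card_le_card_of_injOn _ hmaps hinj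
  rw [Int.card_Icc] at h
  have h6 : (8 * (D : ℤ) ^ 2 + 1 - -(8 * (D : ℤ) ^ 2)).toNat = 16 * D ^ 2 + 1 := by
    zify
    rw [Int.toNat_of_nonneg (by nlinarith [sq_nonneg (D : ℤ)])]
    ring
  nlinarith

/-- An interval of `A` integers meets a class mod `d` at most `A/d + 1` times, and `1 ≤ 2A/d` turns
this into a clean multiple of `A/d`. -/
theorem card_filter_dvd_add_le {A d : ℕ} {c : ℤ} (hd : 0 < d) (hdA : d ≤ 2 * A) :
    (((Finset.Icc (1 : ℤ) A).filter fun a => (d : ℤ) ∣ a + c).card : ℝ) ≤ 3 * A / d := by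
  have h1 : (((Finset.Icc (1 : ℤ) A).filter fun a => (d : ℤ) ∣ a + c).card : ℤ) ≤ A / d + 1 := by
    have e : ((Finset.Icc (1 : ℤ) A).filter fun a => (d : ℤ) ∣ a + c) =
        (Finset.Ioc (0 : ℤ) A).filter fun a => a ≡ -c [ZMOD d] := by
      ext a
      simp only [Finset.mem_filter, Finset.mem_Icc, Finset.mem_Ioc]
      refine and_congr (by omega) ?_
      rw [Int.modEq_comm, Int.modEq_iff_dvd, sub_neg_eq_add]
    rw [e, Int.Ioc_filter_modEq_card _ _ (by exact_mod_cast hd)]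
    refine max_le ?_ (by positivity)
    have h2 : (⌊((A : ℤ) - -c : ℚ) / d⌋ : ℚ) ≤ ((A : ℤ) - -c : ℚ) / d := Int.floor_le _
    have h3 := Int.lt_floor_add_one (((0 : ℤ) - -c : ℚ) / d)
    have h4 : (A : ℚ) / d < ((A / d : ℕ) : ℚ) + 1 := by
      rw [div_lt_iff₀ (by positivity)]
      have := Nat.lt_div_mul_add (a := A) hd
      have h5 : A < (A / d + 1) * d := by rw [add_mul, one_mul]; exact this
      exact_mod_cast h5
    have h5 : ((⌊((A : ℤ) - -c : ℚ) / d⌋ - ⌊((0 : ℤ) - -c : ℚ) / d⌋ : ℤ) : ℚ) <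
        ((A / d + 2 : ℤ) : ℚ) := by
      push_cast at h2 h3 h4 ⊢
      have : ((A : ℚ) - -c) / d - (0 - -c) / d = A / d := by ring
      have h6 : (((A : ℤ) / (d : ℤ) : ℤ) : ℚ) = ((A / d : ℕ) : ℚ) := by norm_cast
      linarith
    have h6 : ⌊((A : ℤ) - -c : ℚ) / d⌋ - ⌊((0 : ℤ) - -c : ℚ) / d⌋ < (A / d + 2 : ℤ) := by
      exact_mod_cast h5
    simp only [Int.cast_natCast, Int.cast_zero, Int.cast_neg] at h6 ⊢
    omega
  have h2 : (((Finset.Icc (1 : ℤ) A).filter fun a => (d : ℤ) ∣ a + c).card : ℝ) ≤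
      ((A / d : ℕ) : ℝ) + 1 := by exact_mod_cast h1
  have hd' : (0 : ℝ) < d := by exact_mod_cast hd
  have h3 : (1 : ℝ) ≤ 2 * A / d := by
    rw [le_div_iff₀ hd', one_mul]; exact_mod_cast hdA
  have h4 : ((A / d : ℕ) : ℝ) ≤ A / d := Nat.cast_div_le
  have h5 : 3 * (A : ℝ) / d = A / d + 2 * A / d := by ring
  linarith

/-- Union bound over the value `d` of the gcd: each `d` accounts for at most `(3A/d)²` pairs, and
the tail of `∑ 1/d²` beyond `D` is at most `1/D`. The sign and size conditions on `c` force `d ≤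
2A`. -/
theorem card_gcd_gt_le {A D : ℕ} {c c' : ℤ} (hD : 0 < D) (hc : 0 ≤ c) (hcA : c ≤ A) :
    (((Finset.Icc (1 : ℤ) A ×ˢ Finset.Icc (1 : ℤ) A).filter fun p =>
      D < (p.1 + c).gcd (p.2 + c')).card : ℝ) ≤ 9 * A ^ 2 / D := by
  classical
  have hsub : ((Finset.Icc (1 : ℤ) A ×ˢ Finset.Icc (1 : ℤ) A).filter fun p =>
      D < (p.1 + c).gcd (p.2 + c')) ⊆ (Finset.Ioc D (2 * A)).biUnion fun d =>
      ((Finset.Icc (1 : ℤ) A).filter fun a => (d : ℤ) ∣ a + c) ×ˢ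
      ((Finset.Icc (1 : ℤ) A).filter fun a => (d : ℤ) ∣ a + c') := by
    intro p hp
    simp only [Finset.mem_filter, Finset.mem_product, Finset.mem_Icc] at hp
    simp only [Finset.mem_biUnion, Finset.mem_Ioc, Finset.mem_product, Finset.mem_filter,
      Finset.mem_Icc]
    refine ⟨(p.1 + c).gcd (p.2 + c'), ⟨hp.2, ?_⟩, ⟨hp.1.1, Int.gcd_dvd_left ..⟩,
      hp.1.2, Int.gcd_dvd_right ..⟩
    have h1 : ((p.1 + c).gcd (p.2 + c') : ℤ) ≤ p.1 + c :=
      Int.le_of_dvd (by omega) (Int.gcd_dvd_left ..)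
    omega
  calc _ ≤ (((Finset.Ioc D (2 * A)).biUnion fun d =>
      ((Finset.Icc (1 : ℤ) A).filter fun a => (d : ℤ) ∣ a + c) ×ˢ
      ((Finset.Icc (1 : ℤ) A).filter fun a => (d : ℤ) ∣ a + c')).card : ℝ) := by
        exact_mod_cast Finset.card_le_card hsub
    _ ≤ ∑ d ∈ Finset.Ioc D (2 * A),
      ((((Finset.Icc (1 : ℤ) A).filter fun a => (d : ℤ) ∣ a + c).card : ℝ) *
      (((Finset.Icc (1 : ℤ) A).filter fun a => (d : ℤ) ∣ a + c').card : ℝ)) := by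
        have := Finset.card_biUnion_le (s := Finset.Ioc D (2 * A)) (t := fun d : ℕ =>
          ((Finset.Icc (1 : ℤ) A).filter fun a => (d : ℤ) ∣ a + c) ×ˢ
          ((Finset.Icc (1 : ℤ) A).filter fun a => (d : ℤ) ∣ a + c'))
        simp only [Finset.card_product] at this
        exact_mod_cast this
    _ ≤ ∑ d ∈ Finset.Ioc D (2 * A), (3 * A / d : ℝ) * (3 * A / d) := by
        refine Finset.sum_le_sum fun d hd => ?_
        rw [Finset.mem_Ioc] at hd
        have h0 : 0 < d := by omega
        exact mul_le_mul (card_filter_dvd_add_le h0 hd.2) (card_filter_dvd_add_le h0 hd.2)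
          (by positivity) (by positivity)
    _ = 9 * A ^ 2 * ∑ d ∈ Finset.Ioc D (2 * A), ((d : ℝ) ^ 2)⁻¹ := by
        rw [Finset.mul_sum]
        refine Finset.sum_congr rfl fun d _ => ?_
        ring
    _ ≤ 9 * A ^ 2 * (1 / D) := by
        gcongr
        rcases le_total D (2 * A) with h | h
        · refine (sum_Ioc_inv_sq_le_sub (α := ℝ) hD.ne' h).trans ?_
          rw [one_div]
          exact sub_le_self _ (by positivity)
        · rw [Finset.Ioc_eq_empty_of_le h]
          simp
    _ = _ := by ring

end Counting

/-! ### Size of the four-variable lattice -/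

section Lattice

/-- Integers of absolute value at most `B`. -/
def symIcc (B : ℕ) : Finset ℤ := Finset.Icc (-(B : ℤ)) B

theorem mem_symIcc {B : ℕ} {x : ℤ} : x ∈ symIcc B ↔ |x| ≤ B := by
  rw [symIcc, Finset.mem_Icc, abs_le]

theorem card_symIcc (B : ℕ) : (symIcc B).card = 2 * B + 1 := by
  rw [symIcc, Int.card_Icc]; omega

/-- The lattice points `u₁ k₁ + u₂ k₂ = u₃ k₃ + u₄ k₄` with coordinates bounded by `B`. -/
def lat (u₁ u₂ u₃ u₄ : ℤ) (B : ℕ) : Finset ((ℤ × ℤ) × (ℤ × ℤ)) :=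
  ((symIcc B ×ˢ symIcc B) ×ˢ (symIcc B ×ˢ symIcc B)).filter fun e =>
    u₁ * e.1.1 + u₂ * e.1.2 = u₃ * e.2.1 + u₄ * e.2.2

theorem mem_lat {u₁ u₂ u₃ u₄ : ℤ} {B : ℕ} {e : (ℤ × ℤ) × (ℤ × ℤ)} :
    e ∈ lat u₁ u₂ u₃ u₄ B ↔ (|e.1.1| ≤ B ∧ |e.1.2| ≤ B ∧ |e.2.1| ≤ B ∧ |e.2.2| ≤ B) ∧
      u₁ * e.1.1 + u₂ * e.1.2 = u₃ * e.2.1 + u₄ * e.2.2 := by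
  simp only [lat, Finset.mem_filter, Finset.mem_product, mem_symIcc, and_assoc]

/-- Pigeonhole: the linear form takes at most `8AH + 1 ≤ 9AH` values on the `H⁴` points of `[1,
H]⁴`, and subtracting a base point embeds each fibre in the lattice. -/
theorem card_lat_ge {u₁ u₂ u₃ u₄ : ℤ} {A H : ℕ} (hA : 0 < A) (hH : 0 < H)
    (h₁ : 0 ≤ u₁) (h₂ : 0 ≤ u₂) (h₃ : 0 ≤ u₃) (h₄ : 0 ≤ u₄)
    (h₁' : u₁ ≤ 2 * A) (h₂' : u₂ ≤ 2 * A) (h₃' : u₃ ≤ 2 * A) (h₄' : u₄ ≤ 2 * A) :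
    H ^ 3 ≤ 9 * A * (lat u₁ u₂ u₃ u₄ H).card := by
  classical
  set I := Finset.Icc (1 : ℤ) H
  set Q := (I ×ˢ I) ×ˢ (I ×ˢ I)
  set ψ : (ℤ × ℤ) × (ℤ × ℤ) → ℤ := fun e => u₁ * e.1.1 + u₂ * e.1.2 - u₃ * e.2.1 - u₄ * e.2.2
  set J := symIcc (4 * A * H)
  have hmul : ∀ u x : ℤ, 0 ≤ u → u ≤ 2 * A → 1 ≤ x → x ≤ H → 0 ≤ u * x ∧ u * x ≤ 2 * A * H := by
    intro u x h1 h2 h3 h4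
    exact ⟨by positivity, by gcongr⟩
  have hmaps : ∀ e ∈ Q, ψ e ∈ J := by
    intro e he
    simp only [Q, I, Finset.mem_product, Finset.mem_Icc] at he
    rw [mem_symIcc, abs_le]
    have m1 := hmul u₁ e.1.1 h₁ h₁' he.1.1.1 he.1.1.2
    have m2 := hmul u₂ e.1.2 h₂ h₂' he.1.2.1 he.1.2.2
    have m3 := hmul u₃ e.2.1 h₃ h₃' he.2.1.1 he.2.1.2
    have m4 := hmul u₄ e.2.2 h₄ h₄' he.2.2.1 he.2.2.2
    simp only [ψ]
    push_cast
    constructor <;> linarith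
  have hQ : Q.card = H ^ 4 := by
    simp only [Q, I, Finset.card_product, Int.card_Icc, add_sub_cancel_right, Int.toNat_natCast]
    ring
  have hfib : ∀ c ∈ J, (Q.filter fun e => ψ e = c).card ≤ (lat u₁ u₂ u₃ u₄ H).card := by
    intro c _
    rcases (Q.filter fun e => ψ e = c).eq_empty_or_nonempty with h | ⟨e₀, he₀⟩
    · simp [h]
    · refine Finset.card_le_card_of_injOn (fun e => e - e₀) ?_ ?_
      · intro e he
        simp only [Q, I, ψ, Finset.coe_filter, Set.mem_ofPred_eq, Finset.mem_filter,
          Finset.mem_product, Finset.mem_Icc] at he he₀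
        simp only [Finset.mem_coe, mem_lat, Prod.fst_sub, Prod.snd_sub, abs_le]
        refine ⟨⟨⟨?_, ?_⟩, ⟨?_, ?_⟩, ⟨?_, ?_⟩, ⟨?_, ?_⟩⟩, ?_⟩ <;> linarith
      · intro x _ y _ h
        exact sub_left_injective h
  have h1 : Q.card ≤ J.card * (lat u₁ u₂ u₃ u₄ H).card := by
    rw [Finset.card_eq_sum_card_fiberwise hmaps]
    exact (Finset.sum_le_sum hfib).trans_eq (by simp)
  rw [hQ, card_symIcc] at h1
  have h2 : H * H ^ 3 ≤ H * (9 * A * (lat u₁ u₂ u₃ u₄ H).card) := by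
    have : 1 ≤ A * H := Nat.mul_pos hA hH
    calc H * H ^ 3 = H ^ 4 := by ring
      _ ≤ _ := h1
      _ ≤ (9 * (A * H)) * (lat u₁ u₂ u₃ u₄ H).card := by gcongr; linarith
      _ = _ := by ring
  exact Nat.le_of_mul_le_mul_left h2 hH

theorem card_lat_le {u₁ u₂ u₃ u₄ : ℤ} {B H D : ℕ} (hB : B ≤ 4 * H) (h₄ : 0 < u₄)
    (hD : u₃.gcd u₄ ≤ D) (hH : (H : ℤ) ≤ u₄ * D) :
    (lat u₁ u₂ u₃ u₄ B).card ≤ (2 * B + 1) ^ 2 * (17 * D ^ 2) := by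
  classical
  have hmaps : ∀ e ∈ lat u₁ u₂ u₃ u₄ B, e.1 ∈ symIcc B ×ˢ symIcc B := by
    intro e he
    rw [mem_lat] at he
    simp only [Finset.mem_product, mem_symIcc]
    exact ⟨he.1.1, he.1.2.1⟩
  have h := Finset.card_le_mul_card_image_of_maps_to hmaps (17 * D ^ 2) ?_
  · simpa [Finset.card_product, card_symIcc, sq, mul_comm, mul_assoc, mul_left_comm] using h
  · intro k _
    refine (Finset.card_le_card_of_injOn (t := ((lat u₁ u₂ u₃ u₄ B).filter
      fun e => e.1 = k).image Prod.snd) Prod.snd (fun e he => Finset.mem_image_of_mem _ he) ?_).trans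
      (card_linear_rep_le (u := u₃) (v := u₄) (c := u₁ * k.1 + u₂ * k.2) (H := H) h₄ hD hH _ ?_)
    · intro e he e' he' h
      simp only [Finset.coe_filter, Set.mem_ofPred_eq] at he he'
      exact Prod.ext (he.2.trans he'.2.symm) h
    · intro p hp
      simp only [Finset.mem_image, Finset.mem_filter] at hp
      obtain ⟨e, ⟨he, rfl⟩, rfl⟩ := hp
      rw [mem_lat] at he
      refine ⟨he.1.2.2.1.trans (by exact_mod_cast hB), he.2.symm⟩

end Lattice

/-! ### Sums along maps with bounded fibres -/

section Fibers

theorem sum_comp_le_of_card_fiber_le {α G : Type*} [Fintype G] [DecidableEq G] (E : Finset α)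
    (ξ : α → G) (Ψ : G → ℝ) (hΨ : ∀ n, 0 ≤ Ψ n) (R : ℕ)
    (hR : ∀ n, (E.filter fun e => ξ e = n).card ≤ R) :
    ∑ e ∈ E, Ψ (ξ e) ≤ R * ∑ n, Ψ n := by
  rw [← Finset.sum_fiberwise E ξ, Finset.mul_sum]
  refine Finset.sum_le_sum fun n _ => ?_
  calc ∑ e ∈ E with ξ e = n, Ψ (ξ e) = ∑ e ∈ E with ξ e = n, Ψ n :=
        Finset.sum_congr rfl fun e he => by rw [(Finset.mem_filter.mp he).2]
    _ = (E.filter fun e => ξ e = n).card * Ψ n := by simp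
    _ ≤ R * Ψ n := mul_le_mul_of_nonneg_right (by exact_mod_cast hR n) (hΨ n)

theorem sum_sub_le_of_card_fiber_le {E G : Type*} [Fintype E] [AddCommGroup G] [Fintype G]
    [DecidableEq G] (ξ : E → G) (Ψ : G → ℝ) (hΨ : ∀ n, 0 ≤ Ψ n) (R : ℕ)
    (hR : ∀ n, (Finset.univ.filter fun e => ξ e = n).card ≤ R) :
    ∑ e, ∑ e', Ψ (ξ e - ξ e') ≤ Fintype.card E * R * ∑ n, Ψ n := by
  rw [Finset.sum_comm]
  calc _ ≤ ∑ _e' : E, R * ∑ n, Ψ n := by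
        refine Finset.sum_le_sum fun e' _ => ?_
        refine (sum_comp_le_of_card_fiber_le Finset.univ (fun e => ξ e - ξ e') Ψ hΨ R ?_)
        intro n
        simp only [sub_eq_iff_eq_add]
        exact hR _
    _ = _ := by simp; ring

theorem sum_comm_six {Y E M : Type*} [Fintype Y] [Fintype E] [AddCommMonoid M]
    (Q : Y → E → E → E → E → E → E → M) :
    ∑ y, ∑ l, ∑ l', ∑ k, ∑ k', ∑ e, ∑ e', Q y l l' k k' e e' =
      ∑ l, ∑ l', ∑ k, ∑ k', ∑ e, ∑ e', ∑ y, Q y l l' k k' e e' := by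
  rw [Finset.sum_comm]; refine Finset.sum_congr rfl fun _ _ => ?_
  rw [Finset.sum_comm]; refine Finset.sum_congr rfl fun _ _ => ?_
  rw [Finset.sum_comm]; refine Finset.sum_congr rfl fun _ _ => ?_
  rw [Finset.sum_comm]; refine Finset.sum_congr rfl fun _ _ => ?_
  rw [Finset.sum_comm]; refine Finset.sum_congr rfl fun _ _ => ?_
  rw [Finset.sum_comm]

end Fibers

/-! ### From box norms with bounded fibres to the `U⁴` norm -/

section BoxEstimate
variable {G : Type*} [AddCommGroup G] [Fintype G] [DecidableEq G]

/-- The `U⁴` power is the sum over all triples of shifts of the squared correlation. After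
Cauchy–Schwarz the terms are nonnegative, so each pair `(ξ e, ξ e')` may be exchanged for a free
shift at cost `|E| R`, once per direction. -/
theorem sum_norm_gdiff_three_sq_le {E : Type*} [Fintype E] (ξ₂ ξ₃ ξ₄ : E → G) (R : ℕ)
    (h₂ : ∀ n, (Finset.univ.filter fun e => ξ₂ e = n).card ≤ R)
    (h₃ : ∀ n, (Finset.univ.filter fun e => ξ₃ e = n).card ≤ R)
    (h₄ : ∀ n, (Finset.univ.filter fun e => ξ₄ e = n).card ≤ R) (f : G → ℂ) :
    (∑ l, ∑ l', ∑ k, ∑ k', ∑ e, ∑ e',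
      ‖∑ y, gdiff (ξ₄ l - ξ₄ l') (gdiff (ξ₃ k - ξ₃ k') (gdiff (ξ₂ e - ξ₂ e') f)) y‖) ^ 2 ≤
      (Fintype.card E : ℝ) ^ 9 * R ^ 3 * gowersPow 3 f := by
  set γ : G → G → G → ℝ := fun a b c => ‖∑ y, gdiff a (gdiff b (gdiff c f)) y‖ ^ 2 with hγ
  have hγ0 : ∀ a b c, 0 ≤ γ a b c := fun a b c => by positivity
  have hG : gowersPow 3 f = ∑ c, ∑ b, ∑ a, γ a b c := rfl
  set N : ℝ := (Fintype.card E : ℝ)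
  have cs := sq_sum_le_card_mul_sum_sq (s := (Finset.univ : Finset (E × E × E × E × E × E)))
    (f := fun p => ‖∑ y, gdiff (ξ₄ p.1 - ξ₄ p.2.1) (gdiff (ξ₃ p.2.2.1 - ξ₃ p.2.2.2.1)
      (gdiff (ξ₂ p.2.2.2.2.1 - ξ₂ p.2.2.2.2.2) f)) y‖)
  simp only [Fintype.sum_prod_type, Finset.card_univ, Fintype.card_prod, Nat.cast_mul] at cs
  have key : ∑ l, ∑ l', ∑ k, ∑ k', ∑ e, ∑ e', γ (ξ₄ l - ξ₄ l') (ξ₃ k - ξ₃ k') (ξ₂ e - ξ₂ e') ≤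
      (N * R) * ((N * R) * ((N * R) * gowersPow 3 f)) := by
    calc _ ≤ ∑ l, ∑ l', ∑ k, ∑ k', (N * R) * ∑ c, γ (ξ₄ l - ξ₄ l') (ξ₃ k - ξ₃ k') c := by
          gcongr with l _ l' _ k _ k' _
          exact sum_sub_le_of_card_fiber_le ξ₂ (fun c => γ (ξ₄ l - ξ₄ l') (ξ₃ k - ξ₃ k') c)
            (fun _ => hγ0 _ _ _) R h₂
      _ ≤ ∑ l, ∑ l', (N * R) * ((N * R) * ∑ b, ∑ c, γ (ξ₄ l - ξ₄ l') b c) := by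
          gcongr with l _ l' _
          simp only [← Finset.mul_sum]
          gcongr
          exact sum_sub_le_of_card_fiber_le ξ₃ (fun b => ∑ c, γ (ξ₄ l - ξ₄ l') b c)
            (fun _ => Finset.sum_nonneg fun _ _ => hγ0 _ _ _) R h₃
      _ ≤ (N * R) * ((N * R) * ((N * R) * ∑ a, ∑ b, ∑ c, γ a b c)) := by
          simp only [← Finset.mul_sum]
          gcongr
          exact sum_sub_le_of_card_fiber_le ξ₄ (fun a => ∑ b, ∑ c, γ a b c)
            (fun _ => Finset.sum_nonneg fun _ _ => Finset.sum_nonneg fun _ _ => hγ0 _ _ _) R h₄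
      _ = _ := by
          rw [hG]
          congr 3
          calc _ = ∑ a, ∑ c, ∑ b, γ a b c := Finset.sum_congr rfl fun a _ => Finset.sum_comm
            _ = ∑ c, ∑ a, ∑ b, γ a b c := Finset.sum_comm
            _ = _ := Finset.sum_congr rfl fun a _ => Finset.sum_comm
  refine (cs.trans (mul_le_mul_of_nonneg_left key (by positivity))).trans_eq ?_
  ring

/-- The arguments of `f₂, f₃, f₄` miss `e, k, l` respectively, so `box_cs_three` eliminates them.
The surviving eight copies of `f₁` form a triple difference, to which `sum_norm_gdiff_three_sq_le`
applies; that second squaring makes the exponent 16. -/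
theorem box_estimate {Λ E : Type*} [Fintype Λ] [Fintype E] {L : ℝ} {f₁ f₂ f₃ f₄ : G → ℂ}
    (hf₁ : Bdd L f₁) (hf₂ : Bdd L f₂) (hf₃ : Bdd L f₃) (hf₄ : Bdd L f₄)
    (ω : Λ → E → E → E → ℝ) (hω0 : ∀ x e k l, 0 ≤ ω x e k l) (hω1 : ∀ x e k l, ω x e k l ≤ 1)
    (π : Λ → G) (ξ₂ ξ₃ ξ₄ : E → G) (β₂ β₃ β₄ : Λ → E → E → G) (R : ℕ)
    (h₂ : ∀ n, (Finset.univ.filter fun e => ξ₂ e = n).card ≤ R)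
    (h₃ : ∀ n, (Finset.univ.filter fun e => ξ₃ e = n).card ≤ R)
    (h₄ : ∀ n, (Finset.univ.filter fun e => ξ₄ e = n).card ≤ R) :
    ‖∑ x, ∑ y, ∑ e, ∑ k, ∑ l, (ω x e k l : ℂ) * f₁ (y + (π x + ξ₂ e + ξ₃ k + ξ₄ l)) *
      f₂ (y + β₂ x k l) * f₃ (y + β₃ x e l) * f₄ (y + β₄ x e k)‖ ^ 16 ≤
      L ^ 14 * (Fintype.card Λ : ℝ) ^ 16 * (Fintype.card E : ℝ) ^ 45 * R ^ 3 *
        gowersPow 3 f₁ := by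
  have hL := hf₁.nonneg
  set N : ℝ := (Fintype.card E : ℝ)
  set W : ℝ := (Fintype.card Λ : ℝ)
  have hb : ∀ (f : G → ℂ) (_ : Bdd L f) (β : Λ → E → E → G) (e k : E),
      ∑ x : Λ × G, ‖f (x.2 + β x.1 e k)‖ ^ 2 ≤ L * W := by
    intro f hf β e k
    rw [Fintype.sum_prod_type]
    calc ∑ x : Λ, ∑ y, ‖f (y + β x e k)‖ ^ 2 ≤ ∑ _x : Λ, L :=
          Finset.sum_le_sum fun x _ => hf.sum_sq_le (β x e k)
      _ = L * W := by rw [Finset.sum_const, nsmul_eq_mul, Finset.card_univ, mul_comm]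
  let F : Λ × G → E → E → E → ℂ := fun x e k l =>
    (ω x.1 e k l : ℂ) * f₁ (x.2 + (π x.1 + ξ₂ e + ξ₃ k + ξ₄ l))
  let b : Λ × G → E → E → ℂ := fun x k l => f₂ (x.2 + β₂ x.1 k l)
  let c : Λ × G → E → E → ℂ := fun x e l => f₃ (x.2 + β₃ x.1 e l)
  let d : Λ × G → E → E → ℂ := fun x e k => f₄ (x.2 + β₄ x.1 e k)
  have h := box_cs_three F b c d (fun _ _ _ => hf₂.norm_le _) (fun _ _ _ => hf₃.norm_le _)
    (hb f₂ hf₂ β₂) (hb f₃ hf₃ β₃) (hb f₄ hf₄ β₄)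
  simp only [Fintype.sum_prod_type] at h
  set S := ‖∑ x, ∑ y, ∑ e, ∑ k, ∑ l, (ω x e k l : ℂ) * f₁ (y + (π x + ξ₂ e + ξ₃ k + ξ₄ l)) *
      f₂ (y + β₂ x k l) * f₃ (y + β₃ x e l) * f₄ (y + β₄ x e k)‖
  have hbd := sum_norm_gdiff_three_sq_le ξ₂ ξ₃ ξ₄ R h₂ h₃ h₄ f₁
  set σ₁ := ∑ l, ∑ l', ∑ k, ∑ k', ∑ e, ∑ e',
      ‖∑ y, gdiff (ξ₄ l - ξ₄ l') (gdiff (ξ₃ k - ξ₃ k') (gdiff (ξ₂ e - ξ₂ e') f₁)) y‖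
  have h' : S ^ 8 ≤ (L * W) ^ 7 * N ^ 18 * (W * σ₁) := by
    refine h.trans ?_
    gcongr
    calc _ ≤ ∑ _x : Λ, σ₁ := by
          refine (norm_sum_le _ _).trans (Finset.sum_le_sum fun x _ => ?_)
          rw [sum_comm_six]
          refine (norm_sum_le _ _).trans (Finset.sum_le_sum fun l _ => ?_)
          refine (norm_sum_le _ _).trans (Finset.sum_le_sum fun l' _ => ?_)
          refine (norm_sum_le _ _).trans (Finset.sum_le_sum fun k _ => ?_)
          refine (norm_sum_le _ _).trans (Finset.sum_le_sum fun k' _ => ?_)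
          refine (norm_sum_le _ _).trans (Finset.sum_le_sum fun e _ => ?_)
          refine (norm_sum_le _ _).trans (Finset.sum_le_sum fun e' _ => ?_)
          -- The eight weights do not involve `y`, so they leave the inner sum as one factor in `[0,
          -- 1]`.
          set Ω : ℝ := ((ω x e k l * ω x e k l') * (ω x e k' l * ω x e k' l')) *
            ((ω x e' k l * ω x e' k l') * (ω x e' k' l * ω x e' k' l')) with hΩ
          have hΩ0 : 0 ≤ Ω := by
            have m : ∀ {a b : ℝ}, 0 ≤ a → 0 ≤ b → 0 ≤ a * b := mul_nonneg
            exact m (m (m (hω0 ..) (hω0 ..)) (m (hω0 ..) (hω0 ..)))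
              (m (m (hω0 ..) (hω0 ..)) (m (hω0 ..) (hω0 ..)))
          have hΩ1 : Ω ≤ 1 := by
            have m : ∀ {a b : ℝ}, 0 ≤ a ∧ a ≤ 1 → 0 ≤ b ∧ b ≤ 1 → 0 ≤ a * b ∧ a * b ≤ 1 :=
              fun ha hb => ⟨mul_nonneg ha.1 hb.1, mul_le_one₀ ha.2 hb.1 hb.2⟩
            have o : ∀ e k l, 0 ≤ ω x e k l ∧ ω x e k l ≤ 1 :=
              fun e k l => ⟨hω0 x e k l, hω1 x e k l⟩
            exact (m (m (m (o _ _ _) (o _ _ _)) (m (o _ _ _) (o _ _ _)))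
              (m (m (o _ _ _) (o _ _ _)) (m (o _ _ _) (o _ _ _)))).2
          have e1 : ∀ y, (((ω x e k l : ℂ) * f₁ (y + (π x + ξ₂ e + ξ₃ k + ξ₄ l)) *
              conj ((ω x e k l' : ℂ) * f₁ (y + (π x + ξ₂ e + ξ₃ k + ξ₄ l')))) *
              conj ((ω x e k' l : ℂ) * f₁ (y + (π x + ξ₂ e + ξ₃ k' + ξ₄ l)) *
              conj ((ω x e k' l' : ℂ) * f₁ (y + (π x + ξ₂ e + ξ₃ k' + ξ₄ l'))))) *
              conj (((ω x e' k l : ℂ) * f₁ (y + (π x + ξ₂ e' + ξ₃ k + ξ₄ l)) *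
              conj ((ω x e' k l' : ℂ) * f₁ (y + (π x + ξ₂ e' + ξ₃ k + ξ₄ l')))) *
              conj ((ω x e' k' l : ℂ) * f₁ (y + (π x + ξ₂ e' + ξ₃ k' + ξ₄ l)) *
              conj ((ω x e' k' l' : ℂ) * f₁ (y + (π x + ξ₂ e' + ξ₃ k' + ξ₄ l'))))) =
              (Ω : ℂ) * gdiff (ξ₄ l - ξ₄ l') (gdiff (ξ₃ k - ξ₃ k') (gdiff (ξ₂ e - ξ₂ e') f₁))
                (y + (π x + ξ₂ e' + ξ₃ k' + ξ₄ l')) := by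
            intro y
            have q1 : y + (π x + ξ₂ e' + ξ₃ k' + ξ₄ l') + (ξ₄ l - ξ₄ l') =
              y + (π x + ξ₂ e' + ξ₃ k' + ξ₄ l) := by abel
            have q2 : ∀ z, y + (π x + ξ₂ e' + ξ₃ k' + z) + (ξ₃ k - ξ₃ k') =
              y + (π x + ξ₂ e' + ξ₃ k + z) := fun z => by abel
            have q3 : ∀ w z, y + (π x + ξ₂ e' + w + z) + (ξ₂ e - ξ₂ e') =
              y + (π x + ξ₂ e + w + z) := fun w z => by abel
            simp only [gdiff, q1, q2, q3, hΩ, map_mul, Complex.conj_conj, Complex.conj_ofReal]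
            push_cast
            ring
          refine (congrArg norm (Finset.sum_congr rfl fun y _ => e1 y)).trans_le ?_
          rw [← Finset.mul_sum, norm_mul, Complex.norm_real, Real.norm_of_nonneg hΩ0]
          have e2 := Equiv.sum_comp (Equiv.addRight (π x + ξ₂ e' + ξ₃ k' + ξ₄ l'))
            (gdiff (ξ₄ l - ξ₄ l') (gdiff (ξ₃ k - ξ₃ k') (gdiff (ξ₂ e - ξ₂ e') f₁)))
          simp only [Equiv.coe_addRight] at e2
          rw [e2]
          exact mul_le_of_le_one_left (norm_nonneg _) hΩ1
      _ = W * σ₁ := by simp [W]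
  calc S ^ 16 = (S ^ 8) ^ 2 := by ring
    _ ≤ ((L * W) ^ 7 * N ^ 18 * (W * σ₁)) ^ 2 := by gcongr
    _ = ((L * W) ^ 7 * N ^ 18 * W) ^ 2 * σ₁ ^ 2 := by ring
    _ ≤ ((L * W) ^ 7 * N ^ 18 * W) ^ 2 * (N ^ 9 * R ^ 3 * gowersPow 3 f₁) := by gcongr
    _ = _ := by ring

end BoxEstimate

/-! ### The four-point form over the lattice -/

section LatticeEstimate
variable {G : Type*} [AddCommGroup G] [Fintype G]

/-- The four-point form along the lattice `u₁ k₁ + u₂ k₂ = u₃ k₃ + u₄ k₄`, with weight `ω`. -/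
def latForm (φ : ℤ →+ G) (u₁ u₂ u₃ u₄ : ℤ) (H : ℕ) (ω : (ℤ × ℤ) × (ℤ × ℤ) → ℝ)
    (f₁ f₂ f₃ f₄ : G → ℂ) : ℂ :=
  ∑ e ∈ lat u₁ u₂ u₃ u₄ H, (ω e : ℂ) * ∑ y, f₁ (y + φ (u₁ * e.1.1)) * f₂ (y + φ (u₂ * e.1.2)) *
    f₃ (y + φ (u₃ * e.2.1)) * f₄ (y + φ (u₄ * e.2.2))

/-- Placing the cutoff in `Ψ` rather than in the range makes the sum translation invariant; a window
of radius `4H` contains every translate by a point of radius `3H`. -/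
theorem sum_lat_shift {u₁ u₂ u₃ u₄ : ℤ} {H : ℕ} (Ψ : (ℤ × ℤ) × (ℤ × ℤ) → ℂ)
    (hΨ : ∀ e, e ∉ lat u₁ u₂ u₃ u₄ H → Ψ e = 0) {s : (ℤ × ℤ) × (ℤ × ℤ)}
    (hs : s ∈ lat u₁ u₂ u₃ u₄ (3 * H)) :
    ∑ e ∈ lat u₁ u₂ u₃ u₄ (4 * H), Ψ (e + s) = ∑ e ∈ lat u₁ u₂ u₃ u₄ H, Ψ e := by
  classical
  have h1 : ∑ e ∈ lat u₁ u₂ u₃ u₄ (4 * H), Ψ (e + s) =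
      ∑ e ∈ (lat u₁ u₂ u₃ u₄ (4 * H)).map (addRightEmbedding s), Ψ e := by
    rw [Finset.sum_map]; rfl
  rw [h1]
  symm
  refine Finset.sum_subset ?_ fun e _ he => hΨ e he
  intro e he
  rw [Finset.mem_map]
  refine ⟨e - s, ?_, sub_add_cancel e s⟩
  rw [mem_lat] at he hs ⊢
  obtain ⟨⟨a1, a2, a3, a4⟩, a5⟩ := he
  obtain ⟨⟨b1, b2, b3, b4⟩, b5⟩ := hs
  push_cast at b1 b2 b3 b4 ⊢
  simp only [Prod.fst_sub, Prod.snd_sub]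
  refine ⟨⟨?_, ?_, ?_, ?_⟩, by linarith⟩ <;>
  · refine (abs_sub _ _).trans ?_
    linarith

/-- Averaging the form over translations by three lattice points `e, k, l`, and substituting in `y`,
puts it in the shape required by `box_estimate`. The lattice relation itself is only needed to know
that translations preserve the lattice. -/
theorem latForm_pow_le [DecidableEq G] (φ : ℤ →+ G) {u₁ u₂ u₃ u₄ : ℤ} {H : ℕ}
    {ω : (ℤ × ℤ) × (ℤ × ℤ) → ℝ}
    (hω0 : ∀ e, 0 ≤ ω e) (hω1 : ∀ e, ω e ≤ 1) {L : ℝ} {f₁ f₂ f₃ f₄ : G → ℂ}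
    (hf₁ : Bdd L f₁) (hf₂ : Bdd L f₂) (hf₃ : Bdd L f₃) (hf₄ : Bdd L f₄) (R : ℕ)
    (h₂ : ∀ n, ((lat u₁ u₂ u₃ u₄ H).filter
      fun e => φ (u₁ * e.1.1 - u₂ * e.1.2) = n).card ≤ R)
    (h₃ : ∀ n, ((lat u₁ u₂ u₃ u₄ H).filter
      fun e => φ (u₁ * e.1.1 - u₃ * e.2.1) = n).card ≤ R)
    (h₄ : ∀ n, ((lat u₁ u₂ u₃ u₄ H).filter
      fun e => φ (u₁ * e.1.1 - u₄ * e.2.2) = n).card ≤ R) :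
    ((lat u₁ u₂ u₃ u₄ H).card : ℝ) ^ 3 * ‖latForm φ u₁ u₂ u₃ u₄ H ω f₁ f₂ f₃ f₄‖ ^ 16 ≤
      L ^ 14 * ((lat u₁ u₂ u₃ u₄ (4 * H)).card : ℝ) ^ 16 * R ^ 3 * gowersPow 3 f₁ := by
  set E := lat u₁ u₂ u₃ u₄ H with hE
  set Λ := lat u₁ u₂ u₃ u₄ (4 * H) with hΛ
  set T := latForm φ u₁ u₂ u₃ u₄ H ω f₁ f₂ f₃ f₄ with hT
  let p₁ : (ℤ × ℤ) × (ℤ × ℤ) → G := fun e => φ (u₁ * e.1.1)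
  let p₂ : (ℤ × ℤ) × (ℤ × ℤ) → G := fun e => φ (u₂ * e.1.2)
  let p₃ : (ℤ × ℤ) × (ℤ × ℤ) → G := fun e => φ (u₃ * e.2.1)
  let p₄ : (ℤ × ℤ) × (ℤ × ℤ) → G := fun e => φ (u₄ * e.2.2)
  have a₁ : ∀ x y, p₁ (x + y) = p₁ x + p₁ y := fun x y => by
    simp only [p₁, Prod.fst_add, mul_add, map_add]
  have a₂ : ∀ x y, p₂ (x + y) = p₂ x + p₂ y := fun x y => by
    simp only [p₂, Prod.fst_add, Prod.snd_add, mul_add, map_add]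
  have a₃ : ∀ x y, p₃ (x + y) = p₃ x + p₃ y := fun x y => by
    simp only [p₃, Prod.fst_add, Prod.snd_add, mul_add, map_add]
  have a₄ : ∀ x y, p₄ (x + y) = p₄ x + p₄ y := fun x y => by
    simp only [p₄, Prod.snd_add, mul_add, map_add]
  -- Extending the weight by zero encodes the restriction to radius `H`; depending on `x + e + k +
  -- l`, it is a harmless weight in `box_estimate`.
  let ω' : (ℤ × ℤ) × (ℤ × ℤ) → ℝ := fun e => if e ∈ E then ω e else 0
  have hω'0 : ∀ e, 0 ≤ ω' e := fun e => by
    simp only [ω']; split_ifs; exacts [hω0 e, le_rfl]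
  have hω'1 : ∀ e, ω' e ≤ 1 := fun e => by
    simp only [ω']; split_ifs; exacts [hω1 e, zero_le_one]
  let Ψ : (ℤ × ℤ) × (ℤ × ℤ) → ℂ := fun e => (ω' e : ℂ) *
    ∑ y, f₁ (y + p₁ e) * f₂ (y + p₂ e) * f₃ (y + p₃ e) * f₄ (y + p₄ e)
  have hTΨ : T = ∑ e ∈ E, Ψ e := by
    refine Finset.sum_congr rfl fun e he => ?_
    simp only [Ψ, ω', if_pos he, p₁, p₂, p₃, p₄]
  have key : ∀ e ∈ E, ∀ k ∈ E, ∀ l ∈ E, T = ∑ x ∈ Λ, ∑ y, (ω' (x + e + k + l) : ℂ) *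
      f₁ (y + (p₁ x + (p₁ e - p₂ e) + (p₁ k - p₃ k) + (p₁ l - p₄ l))) *
      f₂ (y + (p₂ x + (p₂ k - p₃ k) + (p₂ l - p₄ l))) *
      f₃ (y + (p₃ x + (p₃ e - p₂ e) + (p₃ l - p₄ l))) *
      f₄ (y + (p₄ x + (p₄ e - p₂ e) + (p₄ k - p₃ k))) := by
    intro e he k hk l hl
    have hs : e + k + l ∈ lat u₁ u₂ u₃ u₄ (3 * H) := by
      rw [hE, mem_lat] at he hk hl
      rw [mem_lat]
      obtain ⟨⟨a1, a2, a3, a4⟩, a5⟩ := he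
      obtain ⟨⟨b1, b2, b3, b4⟩, b5⟩ := hk
      obtain ⟨⟨c1, c2, c3, c4⟩, c5⟩ := hl
      push_cast
      simp only [Prod.fst_add, Prod.snd_add]
      refine ⟨⟨?_, ?_, ?_, ?_⟩, by linarith⟩ <;>
      · refine (abs_add_le _ _).trans ((add_le_add (abs_add_le _ _) le_rfl).trans ?_)
        linarith
    rw [hTΨ, ← sum_lat_shift Ψ (fun e he => by simp [Ψ, ω', hE, he]) hs]
    refine Finset.sum_congr rfl fun x _ => ?_
    simp only [Ψ]
    -- This substitution cancels `p₂ e` in the argument of `f₂`, `p₃ k` in that of `f₃` and `p₄ l`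
    -- in that of `f₄`; the argument of `f₁` keeps all three variables.
    rw [Finset.mul_sum, ← Equiv.sum_comp (Equiv.subRight (p₂ e + p₃ k + p₄ l))]
    refine Finset.sum_congr rfl fun y _ => ?_
    simp only [Equiv.subRight_apply, a₁, a₂, a₃, a₄, ← add_assoc]
    rw [show y - (p₂ e + p₃ k + p₄ l) + p₁ x + p₁ e + p₁ k + p₁ l =
        y + p₁ x + (p₁ e - p₂ e) + (p₁ k - p₃ k) + (p₁ l - p₄ l) by abel,
      show y - (p₂ e + p₃ k + p₄ l) + p₂ x + p₂ e + p₂ k + p₂ l =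
        y + p₂ x + (p₂ k - p₃ k) + (p₂ l - p₄ l) by abel,
      show y - (p₂ e + p₃ k + p₄ l) + p₃ x + p₃ e + p₃ k + p₃ l =
        y + p₃ x + (p₃ e - p₂ e) + (p₃ l - p₄ l) by abel,
      show y - (p₂ e + p₃ k + p₄ l) + p₄ x + p₄ e + p₄ k + p₄ l =
        y + p₄ x + (p₄ e - p₂ e) + (p₄ k - p₃ k) by abel]
    ring
  have hfib : ∀ (ξ : (ℤ × ℤ) × (ℤ × ℤ) → G), (∀ n, (E.filter fun e => ξ e = n).card ≤ R) →
      ∀ n, (Finset.univ.filter fun e : E => ξ e = n).card ≤ R := by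
    intro ξ h n
    refine (Finset.card_le_card_of_injOn (t := E.filter fun e => ξ e = n)
      (fun e : E => (e : (ℤ × ℤ) × (ℤ × ℤ))) ?_ ?_).trans (h n)
    · intro e he
      simpa using he
    · intro x _ y _ h
      exact Subtype.ext h
  have hbox := box_estimate (Λ := Λ) (E := E) hf₁ hf₂ hf₃ hf₄
    (fun x e k l => ω' (x + e + k + l)) (fun _ _ _ _ => hω'0 _) (fun _ _ _ _ => hω'1 _)
    (fun x => p₁ x) (fun e => p₁ e - p₂ e) (fun e => p₁ e - p₃ e) (fun e => p₁ e - p₄ e)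
    (fun x k l => p₂ x + (p₂ k - p₃ k) + (p₂ l - p₄ l))
    (fun x e l => p₃ x + (p₃ e - p₂ e) + (p₃ l - p₄ l))
    (fun x e k => p₄ x + (p₄ e - p₂ e) + (p₄ k - p₃ k)) R
    (hfib (fun e => p₁ e - p₂ e) (by simpa only [p₁, p₂, map_sub] using h₂))
    (hfib (fun e => p₁ e - p₃ e) (by simpa only [p₁, p₃, map_sub] using h₃))
    (hfib (fun e => p₁ e - p₄ e) (by simpa only [p₁, p₄, map_sub] using h₄))
  have hS : (∑ x : Λ, ∑ y, ∑ e : E, ∑ k : E, ∑ l : E, (ω' (x + e + k + l) : ℂ) *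
      f₁ (y + (p₁ x + (p₁ e - p₂ e) + (p₁ k - p₃ k) + (p₁ l - p₄ l))) *
      f₂ (y + (p₂ x + (p₂ k - p₃ k) + (p₂ l - p₄ l))) *
      f₃ (y + (p₃ x + (p₃ e - p₂ e) + (p₃ l - p₄ l))) *
      f₄ (y + (p₄ x + (p₄ e - p₂ e) + (p₄ k - p₃ k)))) = (E.card : ℂ) ^ 3 * T := by
    calc _ = ∑ e : E, ∑ k : E, ∑ l : E, ∑ x : Λ, ∑ y, (ω' (x + e + k + l) : ℂ) *
          f₁ (y + (p₁ x + (p₁ e - p₂ e) + (p₁ k - p₃ k) + (p₁ l - p₄ l))) *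
          f₂ (y + (p₂ x + (p₂ k - p₃ k) + (p₂ l - p₄ l))) *
          f₃ (y + (p₃ x + (p₃ e - p₂ e) + (p₃ l - p₄ l))) *
          f₄ (y + (p₄ x + (p₄ e - p₂ e) + (p₄ k - p₃ k))) := by
          have sw : ∀ Q : Λ → G → E → E → E → ℂ, ∑ x, ∑ y, ∑ e, ∑ k, ∑ l, Q x y e k l =
              ∑ e, ∑ k, ∑ l, ∑ x, ∑ y, Q x y e k l := by
            intro Q
            have := Finset.sum_comm (s := (Finset.univ : Finset (Λ × G)))
              (t := (Finset.univ : Finset (E × E × E)))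
              (f := fun p q => Q p.1 p.2 q.1 q.2.1 q.2.2)
            simpa only [Fintype.sum_prod_type] using this
          exact sw _
      _ = ∑ _e : E, ∑ _k : E, ∑ _l : E, T := by
          refine Finset.sum_congr rfl fun e _ => Finset.sum_congr rfl fun k _ =>
            Finset.sum_congr rfl fun l _ => ?_
          rw [key e e.2 k k.2 l l.2]
          exact Finset.sum_coe_sort Λ (fun x => ∑ y, (ω' (x + e + k + l) : ℂ) *
            f₁ (y + (p₁ x + (p₁ e - p₂ e) + (p₁ k - p₃ k) + (p₁ l - p₄ l))) *
            f₂ (y + (p₂ x + (p₂ k - p₃ k) + (p₂ l - p₄ l))) *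
            f₃ (y + (p₃ x + (p₃ e - p₂ e) + (p₃ l - p₄ l))) *
            f₄ (y + (p₄ x + (p₄ e - p₂ e) + (p₄ k - p₃ k))))
      _ = _ := by
          simp only [Finset.sum_const, Finset.card_univ, Fintype.card_coe, nsmul_eq_mul]
          ring
  rw [hS, norm_mul, norm_pow, Complex.norm_natCast, Fintype.card_coe, Fintype.card_coe] at hbox
  have hE0 : 0 < (E.card : ℝ) := by
    have : (0 : (ℤ × ℤ) × (ℤ × ℤ)) ∈ E := by rw [hE, mem_lat]; simp
    exact_mod_cast Finset.card_pos.mpr ⟨_, this⟩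
  -- Averaging gave `|E|⁴⁸` on the left against `|E|⁴⁵` on the right, so `|E|³` survives.
  refine le_of_mul_le_mul_left ?_ (pow_pos hE0 45)
  calc _ = ((E.card : ℝ) ^ 3 * ‖T‖) ^ 16 := by ring
    _ ≤ _ := hbox
    _ = _ := by ring

end LatticeEstimate

/-! ### Fibre bounds for coefficients with small gcds -/

section PairEstimate

theorem card_le_of_two_linear_reps {α : Type*} {S : Finset α} {H D : ℕ} {u v u' v' c : ℤ}
    (P Q : α → ℤ × ℤ) (c' : ℤ × ℤ → ℤ)
    (hinj : ∀ x ∈ S, ∀ y ∈ S, P x = P y → Q x = Q y → x = y)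
    (hv : 0 < v) (hv' : 0 < v') (hD : u.gcd v ≤ D) (hD' : u'.gcd v' ≤ D)
    (hH : (H : ℤ) ≤ v * D) (hH' : (H : ℤ) ≤ v' * D)
    (hP : ∀ x ∈ S, |(P x).1| ≤ H ∧ u * (P x).1 + v * (P x).2 = c)
    (hQ : ∀ x ∈ S, |(Q x).1| ≤ H ∧ u' * (Q x).1 + v' * (Q x).2 = c' (P x)) :
    S.card ≤ (17 * D ^ 2) ^ 2 := by
  classical
  have h := Finset.card_le_mul_card_image (f := P) S (17 * D ^ 2) ?_
  · refine h.trans ((Nat.mul_le_mul_left _ ?_).trans_eq (sq _).symm)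
    refine card_linear_rep_le (u := u) (v := v) (c := c) hv hD hH _ fun p hp => ?_
    obtain ⟨x, hx, rfl⟩ := Finset.mem_image.mp hp
    exact ⟨(hP x hx).1.trans (by linarith), (hP x hx).2⟩
  · intro p _
    refine (Finset.card_le_card_of_injOn (t := (S.filter fun x => P x = p).image Q) Q
      (fun x hx => Finset.mem_image_of_mem _ hx) ?_).trans
      (card_linear_rep_le (u := u') (v := v') (c := c' p) (H := H) hv' hD' hH' _ ?_)
    · intro x hx y hy hxy
      simp only [Finset.coe_filter, Set.mem_ofPred_eq] at hx hy
      exact hinj x hx.1 y hy.1 (hx.2.trans hy.2.symm) hxy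
    · intro q hq
      simp only [Finset.mem_image, Finset.mem_filter] at hq
      obtain ⟨x, ⟨hx, rfl⟩, rfl⟩ := hq
      exact ⟨(hQ x hx).1.trans (by linarith), (hQ x hx).2⟩

variable {G : Type*} [AddCommGroup G]

/-- `φ` separates integers of absolute value at most `X`. -/
def InjUpTo (φ : ℤ →+ G) (X : ℤ) : Prop :=
  ∀ k k' : ℤ, |k| ≤ X → |k'| ≤ X → φ k = φ k' → k = k'

/-- Positive, at most `2A`, and not much smaller than `H`. -/
structure Admissible (A H D : ℕ) (u : ℤ) : Prop where
  pos : 0 < u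
  le : u ≤ 2 * A
  ge : (H : ℤ) ≤ u * D

theorem abs_sub_mul_le {A H D : ℕ} {u v x y : ℤ} (hu : Admissible A H D u)
    (hv : Admissible A H D v) (hx : |x| ≤ H) (hy : |y| ≤ H) : |u * x - v * y| ≤ 4 * A * H := by
  have h : ∀ {u x : ℤ}, Admissible A H D u → |x| ≤ H → |u * x| ≤ 2 * A * H := by
    intro u x hu hx
    rw [abs_mul, abs_of_pos hu.pos]
    have := hu.pos
    exact mul_le_mul hu.le hx (abs_nonneg _) (by positivity)
  refine (abs_sub _ _).trans ?_
  linarith [h hu hx, h hv hy]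

variable [DecidableEq G]

/-- No wraparound occurs, so `n` fixes an integer linear combination of two coordinates, leaving
`17D²` choices for them. The lattice equation is then a linear equation for the other two, with
again `17D²` choices. The three splittings of four indices into pairs use all six gcds; minus signs
are absorbed into a coordinate. -/
theorem card_lat_fiber_le (φ : ℤ →+ G) {A H D : ℕ} (hφ : InjUpTo φ (4 * A * H))
    {u₁ u₂ u₃ u₄ : ℤ} (h₁ : Admissible A H D u₁) (h₂ : Admissible A H D u₂)
    (h₃ : Admissible A H D u₃) (h₄ : Admissible A H D u₄)
    (g₁₂ : u₁.gcd u₂ ≤ D) (g₁₃ : u₁.gcd u₃ ≤ D) (g₁₄ : u₁.gcd u₄ ≤ D)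
    (g₂₃ : u₂.gcd u₃ ≤ D) (g₂₄ : u₂.gcd u₄ ≤ D) (g₃₄ : u₃.gcd u₄ ≤ D) (n : G) :
    ((lat u₁ u₂ u₃ u₄ H).filter fun e => φ (u₁ * e.1.1 - u₂ * e.1.2) = n).card ≤
        (17 * D ^ 2) ^ 2 ∧
    ((lat u₁ u₂ u₃ u₄ H).filter fun e => φ (u₁ * e.1.1 - u₃ * e.2.1) = n).card ≤
        (17 * D ^ 2) ^ 2 ∧
    ((lat u₁ u₂ u₃ u₄ H).filter fun e => φ (u₁ * e.1.1 - u₄ * e.2.2) = n).card ≤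
        (17 * D ^ 2) ^ 2 := by
  refine ⟨?_, ?_, ?_⟩
  · rcases ((lat u₁ u₂ u₃ u₄ H).filter
      fun e => φ (u₁ * e.1.1 - u₂ * e.1.2) = n).eq_empty_or_nonempty with h | ⟨e₀, h0⟩
    · rw [h, Finset.card_empty]; exact Nat.zero_le _
    rw [Finset.mem_filter, mem_lat] at h0
    refine card_le_of_two_linear_reps (u := u₁) (v := u₂) (u' := u₃) (v' := u₄) (H := H)
      (c := u₁ * e₀.1.1 - u₂ * e₀.1.2)
      (fun e => (e.1.1, -e.1.2)) (fun e => e.2) (fun p => u₁ * p.1 - u₂ * p.2) ?_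
      h₂.pos h₄.pos g₁₂ g₃₄ h₂.ge h₄.ge ?_ ?_
    · intro x _ y _ h h'
      simp only [Prod.mk.injEq, neg_inj] at h
      exact Prod.ext (Prod.ext h.1 h.2) h'
    · intro x hx
      rw [Finset.mem_filter, mem_lat] at hx
      have := hφ _ _ (abs_sub_mul_le h₁ h₂ hx.1.1.1 hx.1.1.2.1)
        (abs_sub_mul_le h₁ h₂ h0.1.1.1 h0.1.1.2.1) (hx.2.trans h0.2.symm)
      exact ⟨hx.1.1.1, by simp only; linarith⟩
    · intro x hx
      rw [Finset.mem_filter, mem_lat] at hx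
      exact ⟨hx.1.1.2.2.1, by simp only; linarith [hx.1.2]⟩
  · rcases ((lat u₁ u₂ u₃ u₄ H).filter
      fun e => φ (u₁ * e.1.1 - u₃ * e.2.1) = n).eq_empty_or_nonempty with h | ⟨e₀, h0⟩
    · rw [h, Finset.card_empty]; exact Nat.zero_le _
    rw [Finset.mem_filter, mem_lat] at h0
    refine card_le_of_two_linear_reps (u := u₁) (v := u₃) (u' := u₂) (v' := u₄) (H := H)
      (c := u₁ * e₀.1.1 - u₃ * e₀.2.1)
      (fun e => (e.1.1, -e.2.1)) (fun e => (e.1.2, -e.2.2))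
      (fun p => -(u₁ * p.1) - u₃ * p.2) ?_
      h₃.pos h₄.pos g₁₃ g₂₄ h₃.ge h₄.ge ?_ ?_
    · intro x _ y _ h h'
      simp only [Prod.mk.injEq, neg_inj] at h h'
      exact Prod.ext (Prod.ext h.1 h'.1) (Prod.ext h.2 h'.2)
    · intro x hx
      rw [Finset.mem_filter, mem_lat] at hx
      have := hφ _ _ (abs_sub_mul_le h₁ h₃ hx.1.1.1 hx.1.1.2.2.1)
        (abs_sub_mul_le h₁ h₃ h0.1.1.1 h0.1.1.2.2.1) (hx.2.trans h0.2.symm)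
      exact ⟨hx.1.1.1, by simp only; linarith⟩
    · intro x hx
      rw [Finset.mem_filter, mem_lat] at hx
      exact ⟨hx.1.1.2.1, by simp only; linarith [hx.1.2]⟩
  · rcases ((lat u₁ u₂ u₃ u₄ H).filter
      fun e => φ (u₁ * e.1.1 - u₄ * e.2.2) = n).eq_empty_or_nonempty with h | ⟨e₀, h0⟩
    · rw [h, Finset.card_empty]; exact Nat.zero_le _
    rw [Finset.mem_filter, mem_lat] at h0
    refine card_le_of_two_linear_reps (u := u₁) (v := u₄) (u' := u₂) (v' := u₃) (H := H)
      (c := u₁ * e₀.1.1 - u₄ * e₀.2.2)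
      (fun e => (e.1.1, -e.2.2)) (fun e => (e.1.2, -e.2.1))
      (fun p => -(u₁ * p.1) - u₄ * p.2) ?_
      h₄.pos h₃.pos g₁₄ g₂₃ h₄.ge h₃.ge ?_ ?_
    · intro x _ y _ h h'
      simp only [Prod.mk.injEq, neg_inj] at h h'
      exact Prod.ext (Prod.ext h.1 h'.1) (Prod.ext h'.2 h.2)
    · intro x hx
      rw [Finset.mem_filter, mem_lat] at hx
      have := hφ _ _ (abs_sub_mul_le h₁ h₄ hx.1.1.1 hx.1.1.2.2.2)
        (abs_sub_mul_le h₁ h₄ h0.1.1.1 h0.1.1.2.2.2) (hx.2.trans h0.2.symm)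
      exact ⟨hx.1.1.1, by simp only; linarith⟩
    · intro x hx
      rw [Finset.mem_filter, mem_lat] at hx
      exact ⟨hx.1.1.2.1, by simp only; linarith [hx.1.2]⟩

/-- The lower bound `H³/(9A)` for the lattice cancels the factor `|E|³` of `latForm_pow_le`, the
upper bound handles the radius `4H`, and the fibre bound is `R = (17D²)²`. -/
theorem latForm_estimate [Fintype G] (φ : ℤ →+ G) {A H D K : ℕ} (hA : 0 < A) (hH : 0 < H)
    (hφ : InjUpTo φ (4 * A * H)) (hK : 2000 ≤ K)
    {u₁ u₂ u₃ u₄ : ℤ} (h₁ : Admissible A H D u₁) (h₂ : Admissible A H D u₂)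
    (h₃ : Admissible A H D u₃) (h₄ : Admissible A H D u₄)
    (g₁₂ : u₁.gcd u₂ ≤ D) (g₁₃ : u₁.gcd u₃ ≤ D) (g₁₄ : u₁.gcd u₄ ≤ D)
    (g₂₃ : u₂.gcd u₃ ≤ D) (g₂₄ : u₂.gcd u₄ ≤ D) (g₃₄ : u₃.gcd u₄ ≤ D)
    {ω : (ℤ × ℤ) × (ℤ × ℤ) → ℝ} (hω0 : ∀ e, 0 ≤ ω e) (hω1 : ∀ e, ω e ≤ 1)
    {L : ℝ} {f₁ f₂ f₃ f₄ : G → ℂ}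
    (hf₁ : Bdd L f₁) (hf₂ : Bdd L f₂) (hf₃ : Bdd L f₃) (hf₄ : Bdd L f₄) :
    ‖latForm φ u₁ u₂ u₃ u₄ H ω f₁ f₂ f₃ f₄‖ ^ 16 ≤
      (K : ℝ) ^ 25 * D ^ 44 * A ^ 3 * H ^ 23 * L ^ 14 * gowersPow 3 f₁ := by
  have hfib := card_lat_fiber_le φ hφ h₁ h₂ h₃ h₄ g₁₂ g₁₃ g₁₄ g₂₃ g₂₄ g₃₄
  have main := latForm_pow_le φ hω0 hω1 hf₁ hf₂ hf₃ hf₄ ((17 * D ^ 2) ^ 2)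
    (fun n => (hfib n).1) (fun n => (hfib n).2.1) (fun n => (hfib n).2.2)
  have hE := card_lat_ge hA hH h₁.pos.le h₂.pos.le h₃.pos.le h₄.pos.le h₁.le h₂.le h₃.le h₄.le
  have hΛ := card_lat_le (u₁ := u₁) (u₂ := u₂) (B := 4 * H) (H := H) le_rfl h₄.pos g₃₄ h₄.ge
  have hL := hf₁.nonneg
  have hU := gowersPow_nonneg 3 f₁
  set T := ‖latForm φ u₁ u₂ u₃ u₄ H ω f₁ f₂ f₃ f₄‖
  set U := gowersPow 3 f₁
  have hE' : (H : ℝ) ^ 3 ≤ 9 * A * (lat u₁ u₂ u₃ u₄ H).card := by exact_mod_cast hE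
  have hΛ' : ((lat u₁ u₂ u₃ u₄ (4 * H)).card : ℝ) ≤ 1377 * H ^ 2 * D ^ 2 := by
    have h1 : (lat u₁ u₂ u₃ u₄ (4 * H)).card ≤ (9 * H) ^ 2 * (17 * D ^ 2) := by
      refine hΛ.trans ?_
      gcongr
      omega
    have h2 : ((lat u₁ u₂ u₃ u₄ (4 * H)).card : ℝ) ≤ (9 * H) ^ 2 * (17 * D ^ 2) := by
      exact_mod_cast h1
    linarith
  have hH9 : (0 : ℝ) < (H : ℝ) ^ 9 := by positivity
  refine le_of_mul_le_mul_left ?_ hH9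
  have hK' : (2000 : ℝ) ≤ K := by exact_mod_cast hK
  push_cast at main
  calc (H : ℝ) ^ 9 * T ^ 16 = ((H : ℝ) ^ 3) ^ 3 * T ^ 16 := by ring
    _ ≤ (9 * A * (lat u₁ u₂ u₃ u₄ H).card) ^ 3 * T ^ 16 := by gcongr
    _ = (9 * A) ^ 3 * (((lat u₁ u₂ u₃ u₄ H).card : ℝ) ^ 3 * T ^ 16) := by ring
    _ ≤ (9 * A) ^ 3 * (L ^ 14 * ((lat u₁ u₂ u₃ u₄ (4 * H)).card : ℝ) ^ 16 *
          ((17 * D ^ 2) ^ 2) ^ 3 * U) := by gcongr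
    _ ≤ (9 * A) ^ 3 * (L ^ 14 * (1377 * H ^ 2 * D ^ 2) ^ 16 * ((17 * D ^ 2) ^ 2) ^ 3 * U) := by
        gcongr
    -- Absolute constants are absorbed into `K ≥ 2000`; the largest is 1377 = 81 · 17.
    _ ≤ (K * A) ^ 3 * (L ^ 14 * (K * H ^ 2 * D ^ 2) ^ 16 * ((K * D ^ 2) ^ 2) ^ 3 * U) := by
        gcongr <;> linarith
    _ = _ := by ring

end PairEstimate

/-! ### Triangular weights of differences -/

section Triangle

/-- The number of representations of `k` as a difference of two elements of `[H]`. -/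
def tri (H : ℕ) (k : ℤ) : ℕ :=
  ((Finset.Icc (1 : ℤ) H ×ˢ Finset.Icc (1 : ℤ) H).filter fun p => p.1 - p.2 = k).card

theorem tri_le (H : ℕ) (k : ℤ) : tri H k ≤ H := by
  have h : tri H k ≤ (Finset.Icc (1 : ℤ) H).card := by
    refine Finset.card_le_card_of_injOn Prod.snd ?_ ?_
    · intro p hp
      simp only [Finset.coe_filter, Finset.mem_product, Set.mem_ofPred_eq] at hp
      exact hp.1.2
    · intro p hp q hq h
      simp only [Finset.coe_filter, Set.mem_ofPred_eq] at hp hq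
      exact Prod.ext (by have := hp.2; have := hq.2; linarith) h
  simpa using h

theorem sum_sub_eq_sum_tri (H : ℕ) (Ψ : ℤ → ℂ) :
    ∑ p ∈ Finset.Icc (1 : ℤ) H ×ˢ Finset.Icc (1 : ℤ) H, Ψ (p.1 - p.2) =
      ∑ k ∈ symIcc H, (tri H k : ℂ) * Ψ k := by
  have hmaps : ∀ p ∈ Finset.Icc (1 : ℤ) H ×ˢ Finset.Icc (1 : ℤ) H, p.1 - p.2 ∈ symIcc H := by
    intro p hp
    simp only [Finset.mem_product, Finset.mem_Icc] at hp
    rw [mem_symIcc, abs_le]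
    constructor <;> linarith [hp.1.1, hp.1.2, hp.2.1, hp.2.2]
  rw [← Finset.sum_fiberwise_of_maps_to hmaps]
  refine Finset.sum_congr rfl fun k _ => ?_
  rw [Finset.sum_congr rfl fun p hp => by rw [(Finset.mem_filter.mp hp).2], Finset.sum_const,
    nsmul_eq_mul]
  rfl

end Triangle

/-! ### The first Cauchy–Schwarz, producing the four-point form -/

section FirstCauchySchwarz
variable {G : Type*} [Fintype G]

theorem Bdd.conj {L : ℝ} {f : G → ℂ} (hf : Bdd L f) : Bdd L (fun x => conj (f x)) :=
  ⟨fun x => by rw [RCLike.norm_conj]; exact hf.norm_le x,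
    by simpa only [RCLike.norm_conj] using hf.sum_le⟩

variable [AddCommGroup G]

theorem sum_norm_fiber_sq {J S : Type*} [DecidableEq S] (𝒥 : Finset J) (s : J → S) (T : Finset S)
    (hs : ∀ j ∈ 𝒥, s j ∈ T) (z : J → ℂ) :
    ((∑ σ ∈ T, ‖∑ j ∈ 𝒥 with s j = σ, z j‖ ^ 2 : ℝ) : ℂ) =
      ∑ j ∈ 𝒥, ∑ j' ∈ 𝒥, if s j = s j' then z j * conj (z j') else 0 := by
  rw [Complex.ofReal_sum]
  simp only [norm_sum_sq_eq]
  rw [← Finset.sum_fiberwise_of_maps_to hs (fun j => ∑ j' ∈ 𝒥, _)]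
  refine Finset.sum_congr rfl fun σ _ => Finset.sum_congr rfl fun j hj => ?_
  rw [Finset.sum_filter]
  refine Finset.sum_congr rfl fun j' _ => ?_
  rw [(Finset.mem_filter.mp hj).2]
  simp only [eq_comm]

/-- The normalised product of four triangular weights. -/
def triWeight (H : ℕ) (e : (ℤ × ℤ) × (ℤ × ℤ)) : ℝ :=
  (tri H e.1.1 * tri H e.1.2) * (tri H e.2.1 * tri H e.2.2) / (H : ℝ) ^ 4

theorem triWeight_nonneg (H : ℕ) (e : (ℤ × ℤ) × (ℤ × ℤ)) : 0 ≤ triWeight H e := by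
  unfold triWeight; positivity

theorem triWeight_le_one (H : ℕ) (e : (ℤ × ℤ) × (ℤ × ℤ)) : triWeight H e ≤ 1 := by
  unfold triWeight
  refine div_le_one_of_le₀ ?_ (by positivity)
  calc _ ≤ ((H : ℝ) * H) * (H * H) := by
        gcongr <;> exact tri_le ..
    _ = _ := by ring

/-- Of the four factors in the double difference, two depend only on `y` and `s = (a + b)k + ak'`.
Grouping the triples `(a, k, k')` by `s` and applying Cauchy–Schwarz over `(y, s)` pairs triples
with equal `s`, which is the lattice equation. The prefactor counts the `6AH + 1 ≤ 7AH` values of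
`s`, times `L` for the sum over `y` and `H⁴` for normalising the weights. -/
theorem sum_two_diff_sq_le (φ : ℤ →+ G) {A H : ℕ} (hA : 0 < A) (hH : 0 < H) {L : ℝ} {f : G → ℂ}
    (hf : Bdd L f) {b : ℤ} (hb0 : 0 ≤ b) (hb : b ≤ A) (𝒜 : Finset ℤ)
    (h𝒜 : 𝒜 ⊆ Finset.Icc (1 : ℤ) A) :
    ‖∑ a ∈ 𝒜, ∑ p ∈ Finset.Icc (1 : ℤ) H ×ˢ Finset.Icc (1 : ℤ) H,
      ∑ r ∈ Finset.Icc (1 : ℤ) H ×ˢ Finset.Icc (1 : ℤ) H,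
      ∑ y, gdiff (φ ((a + b) * (p.1 - p.2))) (gdiff (φ (a * (r.1 - r.2))) f) y‖ ^ 2 ≤
      7 * A * H ^ 5 * L * ∑ a ∈ 𝒜, ∑ a' ∈ 𝒜,
        ‖latForm φ (a + b) a (a' + b) a' H (triWeight H) f f
          (fun x => conj (f x)) (fun x => conj (f x))‖ := by
  classical
  set I := symIcc H
  let 𝒥 := 𝒜 ×ˢ (I ×ˢ I)
  let s : ℤ × (ℤ × ℤ) → ℤ := fun j => (j.1 + b) * j.2.1 + j.1 * j.2.2
  let T := symIcc (3 * A * H)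
  let z : G → ℤ × (ℤ × ℤ) → ℂ := fun y j => ((tri H j.2.1 : ℂ) * tri H j.2.2) *
    (f (y + φ ((j.1 + b) * j.2.1)) * f (y + φ (j.1 * j.2.2)))
  have hs : ∀ j ∈ 𝒥, s j ∈ T := by
    intro j hj
    simp only [𝒥, I, Finset.mem_product, mem_symIcc] at hj
    have ha := Finset.mem_Icc.mp (h𝒜 hj.1)
    simp only [s, T, mem_symIcc]
    refine (abs_add_le _ _).trans ?_
    rw [abs_mul, abs_mul, abs_of_nonneg (by linarith : 0 ≤ j.1 + b),
      abs_of_nonneg (by linarith : 0 ≤ j.1)]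
    push_cast
    have h1 : (j.1 + b) * |j.2.1| ≤ (2 * A) * H :=
      mul_le_mul (by linarith) hj.2.1 (abs_nonneg _) (by positivity)
    have h2 : j.1 * |j.2.2| ≤ A * H :=
      mul_le_mul (by linarith) hj.2.2 (abs_nonneg _) (by positivity)
    linarith
  have hsum : (∑ a ∈ 𝒜, ∑ p ∈ Finset.Icc (1 : ℤ) H ×ˢ Finset.Icc (1 : ℤ) H,
      ∑ r ∈ Finset.Icc (1 : ℤ) H ×ˢ Finset.Icc (1 : ℤ) H,
      ∑ y, gdiff (φ ((a + b) * (p.1 - p.2))) (gdiff (φ (a * (r.1 - r.2))) f) y) =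
      ∑ v ∈ (Finset.univ : Finset G) ×ˢ T,
        (f v.1 * f (v.1 + φ v.2)) * conj (∑ j ∈ 𝒥 with s j = v.2, z v.1 j) := by
    have h1 : ∀ a, (∑ p ∈ Finset.Icc (1 : ℤ) H ×ˢ Finset.Icc (1 : ℤ) H,
      ∑ r ∈ Finset.Icc (1 : ℤ) H ×ˢ Finset.Icc (1 : ℤ) H,
      ∑ y, gdiff (φ ((a + b) * (p.1 - p.2))) (gdiff (φ (a * (r.1 - r.2))) f) y) =
      ∑ k ∈ I, ∑ k' ∈ I, ∑ y, (tri H k : ℂ) * (tri H k') *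
        gdiff (φ ((a + b) * k)) (gdiff (φ (a * k')) f) y := by
      intro a
      rw [sum_sub_eq_sum_tri H (fun k => ∑ r ∈ Finset.Icc (1 : ℤ) H ×ˢ Finset.Icc (1 : ℤ) H,
        ∑ y, gdiff (φ ((a + b) * k)) (gdiff (φ (a * (r.1 - r.2))) f) y)]
      refine Finset.sum_congr rfl fun k _ => ?_
      rw [sum_sub_eq_sum_tri H (fun k' =>
        ∑ y, gdiff (φ ((a + b) * k)) (gdiff (φ (a * k')) f) y), Finset.mul_sum]
      refine Finset.sum_congr rfl fun k' _ => ?_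
      rw [Finset.mul_sum, Finset.mul_sum]
      exact Finset.sum_congr rfl fun y _ => by ring
    simp only [h1]
    have h2 : (∑ a ∈ 𝒜, ∑ k ∈ I, ∑ k' ∈ I, ∑ y, (tri H k : ℂ) * (tri H k') *
        gdiff (φ ((a + b) * k)) (gdiff (φ (a * k')) f) y) =
        ∑ y, ∑ j ∈ 𝒥, f y * f (y + φ (s j)) * conj (z y j) := by
      rw [Finset.sum_comm (s := Finset.univ) (t := 𝒥)]
      simp only [𝒥, Finset.sum_product]
      refine Finset.sum_congr rfl fun a _ => Finset.sum_congr rfl fun k _ =>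
        Finset.sum_congr rfl fun k' _ => Finset.sum_congr rfl fun y _ => ?_
      simp only [gdiff, z, s, map_mul, map_natCast, map_add, Complex.conj_conj]
      rw [add_assoc y]
      ring
    rw [h2, Finset.sum_product]
    refine Finset.sum_congr rfl fun y _ => ?_
    rw [← Finset.sum_fiberwise_of_maps_to hs]
    refine Finset.sum_congr rfl fun σ _ => ?_
    rw [map_sum, Finset.mul_sum]
    exact Finset.sum_congr rfl fun j hj => by rw [(Finset.mem_filter.mp hj).2]
  rw [hsum]
  have cs := norm_sum_mul_sq_le ((Finset.univ : Finset G) ×ˢ T)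
    (fun v => f v.1 * f (v.1 + φ v.2)) (fun v => conj (∑ j ∈ 𝒥 with s j = v.2, z v.1 j))
  refine cs.trans ?_
  have hL := hf.nonneg
  have hfirst : ∑ v ∈ (Finset.univ : Finset G) ×ˢ T, ‖f v.1 * f (v.1 + φ v.2)‖ ^ 2 ≤
      7 * A * H * L := by
    rw [Finset.sum_product_right]
    calc _ ≤ ∑ _σ ∈ T, L := by
          refine Finset.sum_le_sum fun σ _ => ?_
          refine le_trans (Finset.sum_le_sum fun x _ => ?_) (hf.sum_sq_le 0)
          rw [norm_mul, mul_pow, add_zero]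
          exact mul_le_of_le_one_right (by positivity) (pow_le_one₀ (norm_nonneg _) (hf.norm_le _))
      _ = ((2 * (3 * A * H) + 1 : ℕ) : ℝ) * L := by
          rw [Finset.sum_const, card_symIcc, nsmul_eq_mul]
      _ ≤ _ := by
          have : 2 * (3 * A * H) + 1 ≤ 7 * A * H := by nlinarith [Nat.mul_pos hA hH]
          gcongr
          exact_mod_cast this
  have hH' : (0 : ℝ) < H := by exact_mod_cast hH
  have hsecond : ∑ v ∈ (Finset.univ : Finset G) ×ˢ T,
      ‖conj (∑ j ∈ 𝒥 with s j = v.2, z v.1 j)‖ ^ 2 ≤ H ^ 4 * ∑ a ∈ 𝒜, ∑ a' ∈ 𝒜,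
        ‖latForm φ (a + b) a (a' + b) a' H (triWeight H) f f
          (fun x => conj (f x)) (fun x => conj (f x))‖ := by
    set Z : ℝ := ∑ v ∈ (Finset.univ : Finset G) ×ˢ T,
      ‖conj (∑ j ∈ 𝒥 with s j = v.2, z v.1 j)‖ ^ 2 with hZ
    have hZ0 : 0 ≤ Z := by positivity
    have hZeq : (Z : ℂ) = (H : ℂ) ^ 4 * ∑ a ∈ 𝒜, ∑ a' ∈ 𝒜,
        latForm φ (a + b) a (a' + b) a' H (triWeight H) f f
          (fun x => conj (f x)) (fun x => conj (f x)) := by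
      rw [hZ]
      simp only [RCLike.norm_conj]
      rw [Finset.sum_product, Complex.ofReal_sum]
      simp only [sum_norm_fiber_sq 𝒥 s T hs]
      simp only [Finset.mul_sum, latForm, lat, Finset.sum_filter]
      simp only [𝒥, Finset.sum_product]
      have sw : ∀ Q : G → ℤ → ℤ → ℤ → ℤ → ℤ → ℤ → ℂ,
          ∑ y, ∑ a ∈ 𝒜, ∑ k ∈ I, ∑ l ∈ I, ∑ a' ∈ 𝒜, ∑ k' ∈ I, ∑ l' ∈ I, Q y a k l a' k' l' =
          ∑ a ∈ 𝒜, ∑ a' ∈ 𝒜, ∑ k ∈ I, ∑ l ∈ I, ∑ k' ∈ I, ∑ l' ∈ I, ∑ y, Q y a k l a' k' l' := by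
        intro Q
        have e1 := Finset.sum_comm (s := (Finset.univ : Finset G))
          (t := 𝒜 ×ˢ I ×ˢ I ×ˢ 𝒜 ×ˢ I ×ˢ I)
          (f := fun y j => Q y j.1 j.2.1 j.2.2.1 j.2.2.2.1 j.2.2.2.2.1 j.2.2.2.2.2)
        simp only [Finset.sum_product] at e1
        rw [e1]
        refine Finset.sum_congr rfl fun a _ => ?_
        have e2 := Finset.sum_comm (s := I ×ˢ I) (t := 𝒜)
          (f := fun j a' => ∑ k' ∈ I, ∑ l' ∈ I, ∑ y, Q y a j.1 j.2 a' k' l')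
        simpa only [Finset.sum_product] using e2
      rw [sw]
      refine Finset.sum_congr rfl fun a _ => Finset.sum_congr rfl fun a' _ =>
        Finset.sum_congr rfl fun k _ => Finset.sum_congr rfl fun l _ =>
        Finset.sum_congr rfl fun k' _ => Finset.sum_congr rfl fun l' _ => ?_
      simp only [s]
      split_ifs with h
      · rw [Finset.mul_sum]
        refine Finset.sum_congr rfl fun y _ => ?_
        simp only [z, triWeight, map_mul, map_natCast]
        push_cast
        have : (H : ℂ) ≠ 0 := by exact_mod_cast hH.ne'
        field_simp
      · simp
    have : Z = ‖(Z : ℂ)‖ := by rw [Complex.norm_real, Real.norm_of_nonneg hZ0]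
    rw [this, hZeq, norm_mul, norm_pow, Complex.norm_natCast]
    gcongr
    exact (norm_sum_le _ _).trans (Finset.sum_le_sum fun a _ => norm_sum_le _ _)
  calc _ ≤ (7 * A * H * L) * (H ^ 4 * ∑ a ∈ 𝒜, ∑ a' ∈ 𝒜,
        ‖latForm φ (a + b) a (a' + b) a' H (triWeight H) f f
          (fun x => conj (f x)) (fun x => conj (f x))‖) := by gcongr
    _ = _ := by ring

theorem norm_latForm_le (φ : ℤ →+ G) {u₁ u₂ u₃ u₄ : ℤ} {H : ℕ}
    {ω : (ℤ × ℤ) × (ℤ × ℤ) → ℝ}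
    (hω0 : ∀ e, 0 ≤ ω e) (hω1 : ∀ e, ω e ≤ 1) {L : ℝ} {f₁ f₂ f₃ f₄ : G → ℂ}
    (hf₁ : Bdd L f₁) (hf₂ : Bdd L f₂) (hf₃ : Bdd L f₃) (hf₄ : Bdd L f₄) :
    ‖latForm φ u₁ u₂ u₃ u₄ H ω f₁ f₂ f₃ f₄‖ ≤ (lat u₁ u₂ u₃ u₄ H).card * L := by
  have hL := hf₁.nonneg
  calc _ ≤ ∑ _e ∈ lat u₁ u₂ u₃ u₄ H, L := by
        refine (norm_sum_le _ _).trans (Finset.sum_le_sum fun e _ => ?_)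
        rw [norm_mul, Complex.norm_real, Real.norm_of_nonneg (hω0 e)]
        refine (mul_le_of_le_one_left (norm_nonneg _) (hω1 e)).trans ?_
        refine (norm_sum_le _ _).trans ?_
        refine le_trans ?_ ((Equiv.sum_comp (Equiv.addRight (φ (u₁ * e.1.1)))
          (fun y => ‖f₁ y‖)).trans_le hf₁.sum_le)
        refine Finset.sum_le_sum fun y _ => ?_
        simp only [norm_mul, mul_assoc]
        refine mul_le_of_le_one_right (norm_nonneg _) ?_
        exact mul_le_one₀ (hf₂.norm_le _) (by positivity)
          (mul_le_one₀ (hf₃.norm_le _) (norm_nonneg _) (hf₄.norm_le _))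
    _ = _ := by rw [Finset.sum_const, nsmul_eq_mul]

end FirstCauchySchwarz

/-! ### Scarcity of parameters with large gcd -/

section BadPairs

/-- Integers in `[A]` that are coprime to `b` up to a factor `D` and not much smaller than `H`. -/
def goodSet (A H D : ℕ) (b : ℤ) : Finset ℤ :=
  (Finset.Icc (1 : ℤ) A).filter fun a => a.gcd b ≤ D ∧ (H : ℤ) ≤ a * D

theorem card_small_le {A H D : ℕ} (hHA : H ≤ A) (hD : 0 < D) :
    (((Finset.Icc (1 : ℤ) A).filter fun a : ℤ => a * D < H).card : ℝ) ≤ A / D := by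
  have h1 : ((Finset.Icc (1 : ℤ) A).filter fun a : ℤ => a * D < H) ⊆ Finset.Icc 1 ((A / D : ℕ) : ℤ) := by
    intro a ha
    simp only [Finset.mem_filter, Finset.mem_Icc] at ha ⊢
    refine ⟨ha.1.1, ?_⟩
    push_cast
    rw [Int.le_ediv_iff_mul_le (by exact_mod_cast hD)]
    have : (H : ℤ) ≤ A := by exact_mod_cast hHA
    linarith [ha.2]
  have h2 := Finset.card_le_card h1
  rw [Int.card_Icc, add_sub_cancel_right, Int.toNat_natCast] at h2
  calc _ ≤ ((A / D : ℕ) : ℝ) := by exact_mod_cast h2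
    _ ≤ _ := Nat.cast_div_le

theorem sum_card_bad_le {A H D : ℕ} (hHA : H ≤ A) (hD : 0 < D) :
    ∑ b ∈ Finset.Icc (1 : ℤ) A,
      ((((Finset.Icc (1 : ℤ) A).filter fun a => a ∉ goodSet A H D b).card : ℕ) : ℝ) ≤
      10 * A ^ 2 / D := by
  classical
  have h1 := card_gcd_gt_le (A := A) (c := 0) (c' := 0) hD le_rfl (by positivity)
  simp only [add_zero] at h1
  have h2 : ∑ b ∈ Finset.Icc (1 : ℤ) A,
      ((Finset.Icc (1 : ℤ) A).filter fun a => D < a.gcd b).card =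
      ((Finset.Icc (1 : ℤ) A ×ˢ Finset.Icc (1 : ℤ) A).filter fun p => D < p.1.gcd p.2).card := by
    simp only [Finset.card_filter, Finset.sum_product_right]
  calc _ ≤ ∑ b ∈ Finset.Icc (1 : ℤ) A,
        ((((Finset.Icc (1 : ℤ) A).filter fun a => D < a.gcd b).card : ℝ) + A / D) := by
        refine Finset.sum_le_sum fun b _ => ?_
        refine le_trans ?_ (add_le_add le_rfl (card_small_le hHA hD))
        have : ((Finset.Icc (1 : ℤ) A).filter fun a => a ∉ goodSet A H D b) ⊆
            ((Finset.Icc (1 : ℤ) A).filter fun a => D < a.gcd b) ∪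
            ((Finset.Icc (1 : ℤ) A).filter fun a : ℤ => a * D < H) := by
          intro a ha
          simp only [goodSet, Finset.mem_filter, Finset.mem_union, not_and, not_le] at ha ⊢
          by_cases h : a.gcd b ≤ D
          · exact Or.inr ⟨ha.1, ha.2 ha.1 h⟩
          · exact Or.inl ⟨ha.1, not_le.mp h⟩
        exact_mod_cast (Finset.card_le_card this).trans (Finset.card_union_le _ _)
    _ ≤ 9 * A ^ 2 / D + A * (A / D) := by
        rw [Finset.sum_add_distrib]
        refine add_le_add ?_ ?_
        · rw [← h2] at h1
          push_cast at h1
          exact h1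
        · simp
    _ = _ := by ring

/-- All cross gcds of `{a + b, a}` and `{a' + b, a'}` are at most `D`. -/
def GoodPair (D : ℕ) (b : ℤ) (p : ℤ × ℤ) : Prop :=
  (p.1 + b).gcd (p.2 + b) ≤ D ∧ (p.1 + b).gcd p.2 ≤ D ∧ p.1.gcd (p.2 + b) ≤ D ∧ p.1.gcd p.2 ≤ D

theorem card_not_goodPair_le {A D : ℕ} (hD : 0 < D) {b : ℤ} (hb0 : 0 ≤ b) (hb : b ≤ A) :
    open Classical in
    (((Finset.Icc (1 : ℤ) A ×ˢ Finset.Icc (1 : ℤ) A).filter fun p => ¬ GoodPair D b p).card : ℝ) ≤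
      36 * A ^ 2 / D := by
  classical
  have h1 := card_gcd_gt_le (A := A) (c := b) (c' := b) hD hb0 hb
  have h2 := card_gcd_gt_le (A := A) (c := b) (c' := 0) hD hb0 hb
  have h3 := card_gcd_gt_le (A := A) (c := 0) (c' := b) hD le_rfl (by positivity)
  have h4 := card_gcd_gt_le (A := A) (c := 0) (c' := 0) hD le_rfl (by positivity)
  set Q := Finset.Icc (1 : ℤ) A ×ˢ Finset.Icc (1 : ℤ) A
  have hsub : (Q.filter fun p => ¬ GoodPair D b p) ⊆
      ((Q.filter fun p => D < (p.1 + b).gcd (p.2 + b)) ∪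
      (Q.filter fun p => D < (p.1 + b).gcd (p.2 + 0))) ∪
      ((Q.filter fun p => D < (p.1 + 0).gcd (p.2 + b)) ∪
      (Q.filter fun p => D < (p.1 + 0).gcd (p.2 + 0))) := by
    intro p hp
    rw [Finset.mem_filter] at hp
    simp only [Finset.mem_filter, Finset.mem_union, add_zero]
    by_contra hcon
    simp only [not_or, not_and, not_lt] at hcon
    exact hp.2 ⟨hcon.1.1 hp.1, hcon.1.2 hp.1, hcon.2.1 hp.1, hcon.2.2 hp.1⟩
  have h5 := (Finset.card_le_card hsub).trans ((Finset.card_union_le _ _).trans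
    (add_le_add (Finset.card_union_le _ _) (Finset.card_union_le _ _)))
  have h6 : ((Q.filter fun p => ¬ GoodPair D b p).card : ℝ) ≤
      ((Q.filter fun p => D < (p.1 + b).gcd (p.2 + b)).card +
      (Q.filter fun p => D < (p.1 + b).gcd (p.2 + 0)).card) +
      ((Q.filter fun p => D < (p.1 + 0).gcd (p.2 + b)).card +
      (Q.filter fun p => D < (p.1 + 0).gcd (p.2 + 0)).card) := by exact_mod_cast h5
  have e : 36 * (A : ℝ) ^ 2 / D = 9 * A ^ 2 / D + 9 * A ^ 2 / D + (9 * A ^ 2 / D + 9 * A ^ 2 / D) := by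
    ring
  rw [e]
  refine h6.trans ?_
  gcongr

end BadPairs

/-! ### Lower bound for the average `U⁴` norm of the differences -/

section Core
variable {G : Type*} [AddCommGroup G] [Fintype G]

theorem admissible_of_mem_goodSet {A H D D' : ℕ} {a b : ℤ} (ha : a ∈ goodSet A H D b)
    (hD : D ≤ D') (hb0 : 0 ≤ b) (hb : b ≤ A) :
    Admissible A H D' a ∧ Admissible A H D' (a + b) := by
  simp only [goodSet, Finset.mem_filter, Finset.mem_Icc] at ha
  obtain ⟨⟨h1, h2⟩, -, h3⟩ := ha
  have hD' : (D : ℤ) ≤ D' := by exact_mod_cast hD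
  have h4 : a * D ≤ a * D' := mul_le_mul_of_nonneg_left hD' (by linarith)
  refine ⟨⟨by linarith, by linarith, by linarith⟩, ⟨by linarith, by linarith, ?_⟩⟩
  have : 0 ≤ b * D' := by positivity
  linarith

theorem gcd_add_self_le_of_mem_goodSet {A H D : ℕ} {a b : ℤ} (ha : a ∈ goodSet A H D b) :
    (a + b).gcd a ≤ D := by
  simp only [goodSet, Finset.mem_filter] at ha
  have : (a + b).gcd a = a.gcd b := by
    rw [Int.gcd_comm, add_comm]
    simp
  rw [this]; exact ha.2.1

/-- The four-point form attached to a pair `(a, a')`. -/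
def pairForm (φ : ℤ →+ G) (H : ℕ) (b a a' : ℤ) (f : G → ℂ) : ℝ :=
  ‖latForm φ (a + b) a (a' + b) a' H (triWeight H) f f
    (fun x => conj (f x)) (fun x => conj (f x))‖

/-- The trivial bound, used for pairs outside `GoodPair`. It needs only that the two coefficients
belonging to `a'` have small gcd, which is why `a` and `a'` are restricted to `goodSet` beforehand.
-/
theorem pairForm_le (φ : ℤ →+ G) {A H D : ℕ} (hH : 0 < H) {L : ℝ} {f : G → ℂ} (hf : Bdd L f)
    {a a' b : ℤ} (hb0 : 0 ≤ b) (hb : b ≤ A) (ha' : a' ∈ goodSet A H D b) :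
    pairForm φ H b a a' f ≤ 153 * H ^ 2 * D ^ 2 * L := by
  have h := card_lat_le (u₁ := a + b) (u₂ := a) (B := H) (H := H) (by omega)
    (admissible_of_mem_goodSet ha' le_rfl hb0 hb).1.pos (gcd_add_self_le_of_mem_goodSet ha')
    (admissible_of_mem_goodSet ha' le_rfl hb0 hb).1.ge
  have h2 : (lat (a + b) a (a' + b) a' H).card ≤ (3 * H) ^ 2 * (17 * D ^ 2) := by
    refine h.trans ?_
    gcongr
    omega
  have h3 : ((lat (a + b) a (a' + b) a' H).card : ℝ) ≤ (3 * H) ^ 2 * (17 * D ^ 2) := by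
    exact_mod_cast h2
  have hL := hf.nonneg
  calc _ ≤ ((lat (a + b) a (a' + b) a' H).card : ℝ) * L :=
        norm_latForm_le φ (triWeight_nonneg H) (triWeight_le_one H) hf hf hf.conj hf.conj
    _ ≤ ((3 * H) ^ 2 * (17 * D ^ 2)) * L := by gcongr
    _ = _ := by ring

/-- All six gcds are controlled: two by membership in `goodSet`, since `gcd(a + b, a) = gcd(a, b)`,
and four by `GoodPair`. The exponent is `421 = 25 + 9 · 44`. -/
theorem pairForm_pow_le [DecidableEq G] (φ : ℤ →+ G) {A H K : ℕ} (hA : 0 < A) (hH : 0 < H)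
    (hφ : InjUpTo φ (4 * A * H)) (hK : 2000 ≤ K) {L : ℝ} {f : G → ℂ} (hf : Bdd L f)
    {a a' b : ℤ} (hb0 : 0 ≤ b) (hb : b ≤ A) (ha : a ∈ goodSet A H (K ^ 2) b)
    (ha' : a' ∈ goodSet A H (K ^ 2) b) (hp : GoodPair (K ^ 9) b (a, a')) :
    pairForm φ H b a a' f ^ 16 ≤ (K : ℝ) ^ 421 * A ^ 3 * H ^ 23 * L ^ 14 * gowersPow 3 f := by
  have hD : K ^ 2 ≤ K ^ 9 := Nat.pow_le_pow_right (by omega) (by omega)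
  have m := admissible_of_mem_goodSet ha hD hb0 hb
  have m' := admissible_of_mem_goodSet ha' hD hb0 hb
  obtain ⟨p1, p2, p3, p4⟩ := hp
  have h := latForm_estimate φ hA hH hφ hK m.2 m.1 m'.2 m'.1
    ((gcd_add_self_le_of_mem_goodSet ha).trans hD) p1 p2 p3 p4
    ((gcd_add_self_le_of_mem_goodSet ha').trans hD) (triWeight_nonneg H) (triWeight_le_one H)
    hf hf hf.conj hf.conj
  refine h.trans_eq ?_
  push_cast
  ring

end Core

section Core

theorem pow_sum_le_card_pow_mul {ι : Type*} (s : Finset ι) (t : ι → ℝ) (ht : ∀ i ∈ s, 0 ≤ t i)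
    {N : ℝ} (hN : (s.card : ℝ) ≤ N) (n : ℕ) :
    (∑ i ∈ s, t i) ^ (n + 1) ≤ N ^ n * ∑ i ∈ s, t i ^ (n + 1) := by
  have h := pow_sum_div_card_le_sum_pow (s := s) (f := t) ht n
  have h0 : 0 ≤ ∑ i ∈ s, t i ^ (n + 1) :=
    Finset.sum_nonneg fun i hi => pow_nonneg (ht i hi) _
  rcases s.eq_empty_or_nonempty with rfl | hs
  · simp
  · have hc : (0 : ℝ) < s.card := by exact_mod_cast hs.card_pos
    rw [div_le_iff₀ (by positivity)] at h
    calc _ ≤ (∑ i ∈ s, t i ^ (n + 1)) * (s.card : ℝ) ^ n := h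
      _ ≤ (∑ i ∈ s, t i ^ (n + 1)) * N ^ n := by gcongr
      _ = _ := mul_comm _ _

theorem pos_bound_of_cauchy {A H K L Y W : ℝ} (hA : 0 < A) (hH : 0 < H) (hL : 0 < L)
    (h1 : A ^ 2 * H ^ 6 * L ≤ 2 * K * Y) (h2 : Y ^ 2 ≤ A * H ^ 2 * (7 * A * H ^ 5 * L * W)) :
    A ^ 2 * H ^ 5 * L ≤ 28 * K ^ 2 * W := by
  have hpos : 0 < A ^ 2 * H ^ 7 * L := by positivity
  refine le_of_mul_le_mul_left ?_ hpos
  have h3 : (A ^ 2 * H ^ 6 * L) ^ 2 ≤ (2 * K * Y) ^ 2 := by gcongr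
  calc A ^ 2 * H ^ 7 * L * (A ^ 2 * H ^ 5 * L) = (A ^ 2 * H ^ 6 * L) ^ 2 := by ring
    _ ≤ (2 * K * Y) ^ 2 := h3
    _ = 4 * K ^ 2 * Y ^ 2 := by ring
    _ ≤ 4 * K ^ 2 * (A * H ^ 2 * (7 * A * H ^ 5 * L * W)) := by gcongr
    _ = _ := by ring

/-- The bad pairs contribute `154224 K⁻³ A` against `H`; with `A ≤ KH` a loss of `K⁻²` remains,
small enough because `K ≥ 2000`. This is what dictates the threshold `K⁹`. -/
theorem remove_bad_pairs {A H K L W V : ℝ} (hA : 0 < A) (hH : 0 < H) (hK : 2000 ≤ K) (hL : 0 ≤ L)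
    (hAK : A ≤ K * H) (h1 : A ^ 2 * H ^ 5 * L ≤ 28 * K ^ 2 * W)
    (h2 : W ≤ V + A * H ^ 2 * (36 * A ^ 2 / K ^ 9 * (153 * H ^ 2 * K ^ 4 * L))) :
    A ^ 2 * H ^ 5 * L ≤ 56 * K ^ 2 * V := by
  have hK0 : 0 < K := by linarith
  have h3 : 28 * K ^ 2 * (A * H ^ 2 * (36 * A ^ 2 / K ^ 9 * (153 * H ^ 2 * K ^ 4 * L))) ≤
      (A ^ 2 * H ^ 5 * L) / 2 := by
    have e : 28 * K ^ 2 * (A * H ^ 2 * (36 * A ^ 2 / K ^ 9 * (153 * H ^ 2 * K ^ 4 * L))) =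
        154224 * (A ^ 2 * H ^ 4 * L) * A / K ^ 3 := by
      field_simp; ring
    rw [e, div_le_iff₀ (by positivity)]
    calc 154224 * (A ^ 2 * H ^ 4 * L) * A ≤ 154224 * (A ^ 2 * H ^ 4 * L) * (K * H) := by gcongr
      _ = 154224 * (A ^ 2 * H ^ 5 * L * K) := by ring
      _ ≤ (K ^ 2 / 2) * (A ^ 2 * H ^ 5 * L * K) := by
          gcongr
          nlinarith
      _ = _ := by ring
  have h4 : 28 * K ^ 2 * W ≤ 28 * K ^ 2 *
      (V + A * H ^ 2 * (36 * A ^ 2 / K ^ 9 * (153 * H ^ 2 * K ^ 4 * L))) := by gcongr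
  rw [mul_add] at h4
  linarith

/-- Excess powers of `A` and `L` are traded for powers of `H` at one factor `K` each: `491 = 16 · 3
+ 421 + 19 + 3`. -/
theorem sum_lower_of_pow {A H K L U V : ℝ} (hA : 0 < A) (hH : 0 < H) (hK : 2000 ≤ K) (hL : 0 < L)
    (hAK : A ≤ K * H) (hLK : L ≤ K * H ^ 2)
    (h1 : A ^ 2 * H ^ 5 * L ≤ 56 * K ^ 2 * V)
    (h2 : V ^ 16 ≤ (A ^ 3 * H ^ 2) ^ 15 * (K ^ 421 * A ^ 5 * H ^ 23 * L ^ 14 * U)) :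
    A * H ^ 2 * L ^ 5 ≤ K ^ 491 * U := by
  have hK0 : 0 < K := by linarith
  have h3 : (A ^ 2 * H ^ 5 * L) ^ 16 ≤
      (K * K ^ 2) ^ 16 * ((A ^ 3 * H ^ 2) ^ 15 * (K ^ 421 * A ^ 5 * H ^ 23 * L ^ 14 * U)) := by
    calc (A ^ 2 * H ^ 5 * L) ^ 16 ≤ (56 * K ^ 2 * V) ^ 16 := by gcongr
      _ = (56 * K ^ 2) ^ 16 * V ^ 16 := by ring
      _ ≤ (K * K ^ 2) ^ 16 * V ^ 16 := by
          gcongr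
          linarith
      _ ≤ _ := by gcongr
  have h4 : H ^ 27 * L ^ 2 ≤ K ^ 469 * A ^ 18 * U := by
    have hpos : 0 < A ^ 32 * H ^ 53 * L ^ 14 := by positivity
    refine le_of_mul_le_mul_left ?_ hpos
    calc _ = (A ^ 2 * H ^ 5 * L) ^ 16 := by ring
      _ ≤ _ := h3
      _ = _ := by ring
  have hpos : 0 < A ^ 18 := by positivity
  refine le_of_mul_le_mul_left ?_ hpos
  calc A ^ 18 * (A * H ^ 2 * L ^ 5) = A ^ 19 * L ^ 3 * (H ^ 2 * L ^ 2) := by ring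
    _ ≤ (K * H) ^ 19 * (K * H ^ 2) ^ 3 * (H ^ 2 * L ^ 2) := by gcongr
    _ = K ^ 22 * (H ^ 27 * L ^ 2) := by ring
    _ ≤ K ^ 22 * (K ^ 469 * A ^ 18 * U) := by gcongr
    _ = _ := by ring

/-- The exponent `983 = 2 · 491 + 1` leaves a factor `10/K` on the exceptional term, which the left
side absorbs. The total is then `2950 = 982 + 2 · 983 + 2`. -/
theorem final_bound {A H K L U V : ℝ} (hA : 0 < A) (hH : 0 < H) (hK : 2000 ≤ K) (hL : 0 < L)
    (hLK : L ≤ K * H ^ 2) (hU : 0 ≤ U) (h1 : A * H ^ 2 * L ^ 5 ≤ K ^ 491 * V)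
    (h2 : V ^ 2 ≤ L ^ 5 * (10 * A ^ 2 / K ^ 983 * (H ^ 4 * L ^ 5) +
      A ^ 2 * (H ^ 2 * (17 * (K ^ 983) ^ 2 * U)))) :
    L ^ 6 ≤ K ^ 2950 * U := by
  have hK0 : 0 < K := by linarith
  have h3 : (A * H ^ 2 * L ^ 5) ^ 2 ≤ K ^ 982 * V ^ 2 := by
    calc _ ≤ (K ^ 491 * V) ^ 2 := by gcongr
      _ = _ := by ring
  have h4 : K ^ 982 * V ^ 2 ≤ 10 / K * (A * H ^ 2 * L ^ 5) ^ 2 +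
      17 * K ^ 2948 * A ^ 2 * H ^ 2 * L ^ 5 * U := by
    calc _ ≤ K ^ 982 * (L ^ 5 * (10 * A ^ 2 / K ^ 983 * (H ^ 4 * L ^ 5) +
          A ^ 2 * (H ^ 2 * (17 * (K ^ 983) ^ 2 * U)))) := by gcongr
      _ = _ := by
          rw [pow_succ K 982]
          field_simp
  have h5 : 10 / K ≤ 1 / 2 := by
    rw [div_le_iff₀ hK0]; linarith
  have h6 : 10 / K * (A * H ^ 2 * L ^ 5) ^ 2 ≤ 1 / 2 * (A * H ^ 2 * L ^ 5) ^ 2 := by gcongr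
  have h7 : (A * H ^ 2 * L ^ 5) ^ 2 ≤ 34 * K ^ 2948 * A ^ 2 * H ^ 2 * L ^ 5 * U := by linarith
  have hpos : 0 < A ^ 2 * H ^ 2 * L ^ 5 := by positivity
  have h8 : H ^ 2 * L ^ 5 ≤ 34 * K ^ 2948 * U := by
    refine le_of_mul_le_mul_left ?_ hpos
    calc _ = (A * H ^ 2 * L ^ 5) ^ 2 := by ring
      _ ≤ _ := h7
      _ = _ := by ring
  calc L ^ 6 = L * L ^ 5 := by ring
    _ ≤ K * H ^ 2 * L ^ 5 := by gcongr
    _ = K * (H ^ 2 * L ^ 5) := by ring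
    _ ≤ K * (34 * K ^ 2948 * U) := by gcongr
    _ ≤ K * (K * K ^ 2948 * U) := by
        gcongr
        linarith
    _ = _ := by ring

variable {G : Type*} [AddCommGroup G] [Fintype G] [DecidableEq G]

/-- For fixed `i = (b, q)`, pass to good `a`, apply `sum_two_diff_sq_le`, pass to good pairs `(a,
a')`, and insert `pairForm_pow_le`. Hölder's inequality recombines everything into a sum of `U⁴`
powers. -/
theorem sum_gowersPow_gdiff_ge (φ : ℤ →+ G) {A H K : ℕ} (hH : 0 < H) (hHA : H ≤ A)
    (hAK : A ≤ K * H) (hφ : InjUpTo φ (4 * A * H)) (hK : 2000 ≤ K) {L : ℝ} (hL : 0 < L)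
    (hLK : L ≤ K * (H : ℝ) ^ 2) {g : G → ℂ} (hg : Bdd L g)
    (hyp : (A : ℝ) ^ 2 * H ^ 6 * L ≤ K * ‖∑ b ∈ Finset.Icc (1 : ℤ) A,
      ∑ q ∈ Finset.Icc (1 : ℤ) H ×ˢ Finset.Icc (1 : ℤ) H, ∑ a ∈ Finset.Icc (1 : ℤ) A,
      ∑ p ∈ Finset.Icc (1 : ℤ) H ×ˢ Finset.Icc (1 : ℤ) H,
      ∑ r ∈ Finset.Icc (1 : ℤ) H ×ˢ Finset.Icc (1 : ℤ) H,
      ∑ y, gdiff (φ ((a + b) * (p.1 - p.2))) (gdiff (φ (a * (r.1 - r.2)))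
        (gdiff (φ (b * (q.1 - q.2))) g)) y‖) :
    (A : ℝ) * H ^ 2 * L ^ 5 ≤ (K : ℝ) ^ 491 * ∑ i ∈ Finset.Icc (1 : ℤ) A ×ˢ
      (Finset.Icc (1 : ℤ) H ×ˢ Finset.Icc (1 : ℤ) H),
      gowersPow 3 (gdiff (φ (i.1 * (i.2.1 - i.2.2))) g) := by
  classical
  have hA : 0 < A := by omega
  have hA' : (0 : ℝ) < A := by exact_mod_cast hA
  have hH' : (0 : ℝ) < H := by exact_mod_cast hH
  have hK' : (2000 : ℝ) ≤ K := by exact_mod_cast hK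
  have hAK' : (A : ℝ) ≤ K * H := by exact_mod_cast hAK
  set IA := Finset.Icc (1 : ℤ) A with hIA
  set sq := Finset.Icc (1 : ℤ) H ×ˢ Finset.Icc (1 : ℤ) H with hsq
  have hcA : IA.card = A := by simp [IA]
  have hcsq : sq.card = H ^ 2 := by simp [sq, pow_two]
  let F : ℤ × (ℤ × ℤ) → G → ℂ := fun i => gdiff (φ (i.1 * (i.2.1 - i.2.2))) g
  have hF : ∀ i, Bdd L (F i) := fun i => hg.gdiff _
  let Z : ℤ × (ℤ × ℤ) → ℤ → ℂ := fun i a => ∑ p ∈ sq, ∑ r ∈ sq,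
    ∑ y, gdiff (φ ((a + i.1) * (p.1 - p.2))) (gdiff (φ (a * (r.1 - r.2))) (F i)) y
  have hZ : ∀ i a, ‖Z i a‖ ≤ H ^ 4 * L := by
    intro i a
    calc _ ≤ ∑ _p ∈ sq, ∑ _r ∈ sq, L := by
          refine (norm_sum_le _ _).trans (Finset.sum_le_sum fun p _ => ?_)
          refine (norm_sum_le _ _).trans (Finset.sum_le_sum fun r _ => ?_)
          exact (((hF i).gdiff _).gdiff _).norm_sum_le
      _ = _ := by
          simp only [Finset.sum_const, hcsq, nsmul_eq_mul]
          push_cast; ring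
  -- With threshold `K²` the discarded `a` cost a factor `10/K²`, which beats the loss `K` in `hyp`.
  let gd : ℤ → Finset ℤ := goodSet A H (K ^ 2)
  have hgd : ∀ b, gd b ⊆ IA := fun b => Finset.filter_subset _ _
  let Y : ℤ × (ℤ × ℤ) → ℝ := fun i => ‖∑ a ∈ gd i.1, Z i a‖
  let 𝓑 := IA ×ˢ sq
  have hc𝓑 : (𝓑.card : ℝ) = A * H ^ 2 := by
    simp only [𝓑, Finset.card_product, hcA, hcsq]; push_cast; rfl
  have hb : ∀ i ∈ 𝓑, 0 ≤ i.1 ∧ i.1 ≤ A := by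
    intro i hi
    have := Finset.mem_Icc.mp (Finset.mem_product.mp hi).1
    exact ⟨by linarith, this.2⟩
  have step1 : (A : ℝ) ^ 2 * H ^ 6 * L ≤ 2 * K * ∑ i ∈ 𝓑, Y i := by
    have htot : ‖∑ b ∈ IA, ∑ q ∈ sq, ∑ a ∈ IA, ∑ p ∈ sq, ∑ r ∈ sq,
        ∑ y, gdiff (φ ((a + b) * (p.1 - p.2))) (gdiff (φ (a * (r.1 - r.2)))
        (gdiff (φ (b * (q.1 - q.2))) g)) y‖ ≤
        ∑ i ∈ 𝓑, Y i + 10 * A ^ 2 / (K : ℝ) ^ 2 * (H ^ 6 * L) := by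
      have e1 : (∑ b ∈ IA, ∑ q ∈ sq, ∑ a ∈ IA, ∑ p ∈ sq, ∑ r ∈ sq,
        ∑ y, gdiff (φ ((a + b) * (p.1 - p.2))) (gdiff (φ (a * (r.1 - r.2)))
        (gdiff (φ (b * (q.1 - q.2))) g)) y) = ∑ i ∈ 𝓑, ∑ a ∈ IA, Z i a := by
        simp only [𝓑, Finset.sum_product]; rfl
      rw [e1]
      calc _ ≤ ∑ i ∈ 𝓑, (Y i + (IA.filter fun a => a ∉ gd i.1).card * (H ^ 4 * L)) := by
            refine (norm_sum_le _ _).trans (Finset.sum_le_sum fun i _ => ?_)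
            have e2 : ∑ a ∈ IA, Z i a =
                ∑ a ∈ gd i.1, Z i a + ∑ a ∈ IA with a ∉ gd i.1, Z i a := by
              rw [← Finset.sum_filter_add_sum_filter_not IA (fun a => a ∈ gd i.1)]
              congr 1
              refine Finset.sum_congr ?_ fun _ _ => rfl
              ext a
              simp only [Finset.mem_filter]
              exact ⟨fun h => h.2, fun h => ⟨hgd _ h, h⟩⟩
            rw [e2]
            refine (norm_add_le _ _).trans (add_le_add le_rfl ?_)
            refine (norm_sum_le _ _).trans ((Finset.sum_le_sum fun a _ => hZ i a).trans_eq ?_)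
            rw [Finset.sum_const, nsmul_eq_mul]
        _ = ∑ i ∈ 𝓑, Y i + (∑ b ∈ IA, ((IA.filter fun a => a ∉ gd b).card : ℝ)) *
              (H ^ 6 * L) := by
            rw [Finset.sum_add_distrib]
            congr 1
            simp only [𝓑, Finset.sum_product, Finset.sum_const, hcsq, nsmul_eq_mul,
              Finset.sum_mul]
            refine Finset.sum_congr rfl fun b _ => ?_
            push_cast; ring
        _ ≤ _ := by
            gcongr
            have := sum_card_bad_le (A := A) (H := H) (D := K ^ 2) hHA (by positivity)
            push_cast at this
            exact this
    have h2 : (K : ℝ) * (10 * A ^ 2 / (K : ℝ) ^ 2 * (H ^ 6 * L)) ≤ (A : ℝ) ^ 2 * H ^ 6 * L / 2 := by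
      have : (K : ℝ) * (10 * A ^ 2 / (K : ℝ) ^ 2 * (H ^ 6 * L)) = 10 * (A ^ 2 * H ^ 6 * L) / K := by
        field_simp
      rw [this, div_le_iff₀ (by linarith)]
      have h0 : (0 : ℝ) ≤ A ^ 2 * H ^ 6 * L := by positivity
      nlinarith
    have h3 := hyp.trans (mul_le_mul_of_nonneg_left htot (by linarith))
    rw [mul_add] at h3
    linarith
  let P : ℤ × (ℤ × ℤ) → ℤ × ℤ → ℝ := fun i p => pairForm φ H i.1 p.1 p.2 (F i)
  have hP0 : ∀ i p, 0 ≤ P i p := fun i p => norm_nonneg _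
  let W : ℝ := ∑ i ∈ 𝓑, ∑ p ∈ gd i.1 ×ˢ gd i.1, P i p
  have step2 : (∑ i ∈ 𝓑, Y i) ^ 2 ≤ A * H ^ 2 * (7 * A * H ^ 5 * L * W) := by
    refine (pow_sum_le_card_pow_mul 𝓑 Y (fun _ _ => norm_nonneg _) hc𝓑.le 1).trans ?_
    rw [pow_one, one_add_one_eq_two]
    gcongr
    simp only [W, Finset.mul_sum (s := 𝓑)]
    refine Finset.sum_le_sum fun i hi => ?_
    rw [Finset.sum_product]
    exact sum_two_diff_sq_le φ hA hH (hF i) (hb i hi).1 (hb i hi).2 (gd i.1) (hgd _)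
  have step3 := pos_bound_of_cauchy hA' hH' hL step1 step2
  let 𝓟 : ℤ → Finset (ℤ × ℤ) := fun b => (gd b ×ˢ gd b).filter fun p => GoodPair (K ^ 9) b p
  let V : ℝ := ∑ i ∈ 𝓑, ∑ p ∈ 𝓟 i.1, P i p
  have step4 : W ≤ V + A * H ^ 2 * (36 * A ^ 2 / (K : ℝ) ^ 9 * (153 * H ^ 2 * (K : ℝ) ^ 4 * L)) := by
    rw [← hc𝓑, ← nsmul_eq_mul, ← Finset.sum_const, ← Finset.sum_add_distrib]
    refine Finset.sum_le_sum fun i hi => ?_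
    rw [← Finset.sum_filter_add_sum_filter_not (gd i.1 ×ˢ gd i.1) (fun p => GoodPair (K ^ 9) i.1 p)]
    refine add_le_add le_rfl ?_
    calc _ ≤ ∑ _p ∈ (gd i.1 ×ˢ gd i.1) with ¬ GoodPair (K ^ 9) i.1 _p,
          (153 * H ^ 2 * (K : ℝ) ^ 4 * L) := by
          refine Finset.sum_le_sum fun p hp => ?_
          have hp' := (Finset.mem_product.mp (Finset.mem_filter.mp hp).1).2
          refine (pairForm_le φ hH (hF i) (hb i hi).1 (hb i hi).2 hp').trans_eq ?_
          push_cast; ring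
      _ = (((gd i.1 ×ˢ gd i.1).filter fun p => ¬ GoodPair (K ^ 9) i.1 p).card : ℝ) *
          (153 * H ^ 2 * (K : ℝ) ^ 4 * L) := by rw [Finset.sum_const, nsmul_eq_mul]
      _ ≤ _ := by
          gcongr
          have h := card_not_goodPair_le (A := A) (D := K ^ 9) (by positivity)
            (hb i hi).1 (hb i hi).2
          push_cast at h
          refine le_trans ?_ h
          have : ((gd i.1 ×ˢ gd i.1).filter fun p => ¬ GoodPair (K ^ 9) i.1 p) ⊆
              ((IA ×ˢ IA).filter fun p => ¬ GoodPair (K ^ 9) i.1 p) :=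
            Finset.filter_subset_filter _ (Finset.product_subset_product (hgd _) (hgd _))
          exact_mod_cast Finset.card_le_card this
  have step5 := remove_bad_pairs hA' hH' hK' hL.le hAK' step3 step4
  have hUn : ∀ i, 0 ≤ gowersPow 3 (F i) := fun i => gowersPow_nonneg _ _
  refine sum_lower_of_pow hA' hH' hK' hL hAK' hLK step5 ?_
  have hc𝓟 : ∀ b, ((𝓟 b).card : ℝ) ≤ A ^ 2 := by
    intro b
    have h1 : (𝓟 b).card ≤ (IA ×ˢ IA).card := Finset.card_le_card
      ((Finset.filter_subset _ _).trans (Finset.product_subset_product (hgd _) (hgd _)))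
    rw [Finset.card_product, hcA, ← pow_two] at h1
    exact_mod_cast h1
  -- Flattening to one index set allows a single use of Hölder with exponent 16 over at most `A³H²`
  -- terms.
  have hsig : V = ∑ x ∈ 𝓑.sigma (fun i => 𝓟 i.1), P x.1 x.2 := by
    rw [Finset.sum_sigma]
  have hcsig : ((𝓑.sigma (fun i => 𝓟 i.1)).card : ℝ) ≤ A ^ 3 * H ^ 2 := by
    rw [Finset.card_sigma]
    push_cast
    calc _ ≤ ∑ _i ∈ 𝓑, (A : ℝ) ^ 2 := Finset.sum_le_sum fun i _ => hc𝓟 _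
      _ = _ := by rw [Finset.sum_const, nsmul_eq_mul, hc𝓑]; ring
  rw [hsig]
  refine (pow_sum_le_card_pow_mul _ (fun x : (_ : ℤ × ℤ × ℤ) × ℤ × ℤ => P x.1 x.2)
    (fun _ _ => hP0 _ _) hcsig 15).trans ?_
  refine mul_le_mul_of_nonneg_left ?_ (by positivity)
  rw [Finset.sum_sigma, Finset.mul_sum]
  refine Finset.sum_le_sum fun i hi => ?_
  calc _ ≤ ∑ _p ∈ 𝓟 i.1, (K : ℝ) ^ 421 * A ^ 3 * H ^ 23 * L ^ 14 * gowersPow 3 (F i) := by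
        refine Finset.sum_le_sum fun p hp => ?_
        have h1 := Finset.mem_filter.mp hp
        have h2 := Finset.mem_product.mp h1.1
        exact pairForm_pow_le φ hA hH hφ hK (hF i) (hb i hi).1 (hb i hi).2 h2.1 h2.2 h1.2
    _ = (𝓟 i.1).card * ((K : ℝ) ^ 421 * A ^ 3 * H ^ 23 * L ^ 14 * gowersPow 3 (F i)) := by
        rw [Finset.sum_const, nsmul_eq_mul]
    _ ≤ A ^ 2 * ((K : ℝ) ^ 421 * A ^ 3 * H ^ 23 * L ^ 14 * gowersPow 3 (F i)) := by
        have := hUn i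
        gcongr
        exact hc𝓟 _
    _ = (K : ℝ) ^ 421 * A ^ 5 * H ^ 23 * L ^ 14 * gowersPow 3 (F i) := by ring

end Core

/-! ### Passing from `U⁴` norms of differences to the `U⁵` norm -/

section Core
variable {G : Type*} [AddCommGroup G] [Fintype G] [DecidableEq G]

/-- Freeze the second components `k, k'`, which gives the factor `H²`. The map from the first
components to `b(r₁ - k) - b'(r₂ - k')` then has fibres of size at most `17D²` by
`card_linear_rep_le`. -/
theorem sum_diff_shift_le (φ : ℤ →+ G) {A H D : ℕ} (hφ : InjUpTo φ (4 * A * H)) {b b' : ℤ}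
    (hb1 : 1 ≤ b) (hbA : b ≤ A) (hb'A : b' ≤ A) (hb' : b' ∈ goodSet A H D b) (Γ : G → ℝ)
    (hΓ : ∀ n, 0 ≤ Γ n) :
    ∑ q ∈ Finset.Icc (1 : ℤ) H ×ˢ Finset.Icc (1 : ℤ) H,
      ∑ q' ∈ Finset.Icc (1 : ℤ) H ×ˢ Finset.Icc (1 : ℤ) H,
      Γ (φ (b * (q.1 - q.2)) - φ (b' * (q'.1 - q'.2))) ≤ H ^ 2 * (17 * D ^ 2 * ∑ n, Γ n) := by
  set I := Finset.Icc (1 : ℤ) H with hI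
  have hcI : I.card = H := by simp [I]
  have hadm := admissible_of_mem_goodSet hb' le_rfl (by linarith) hbA
  have hgcd : b.gcd b' ≤ D := by
    rw [Int.gcd_comm]
    exact (Finset.mem_filter.mp hb').2.1
  have key : ∀ k ∈ I, ∀ k' ∈ I,
      ∑ r ∈ I ×ˢ I, Γ (φ (b * (r.1 - k) - b' * (r.2 - k'))) ≤ 17 * D ^ 2 * ∑ n, Γ n := by
    intro k hk k' hk'
    have h := sum_comp_le_of_card_fiber_le (I ×ˢ I)
      (fun r => φ (b * (r.1 - k) - b' * (r.2 - k'))) Γ hΓ (17 * D ^ 2) ?_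
    · push_cast at h; exact h
    · intro n
      rcases ((I ×ˢ I).filter
        fun r => φ (b * (r.1 - k) - b' * (r.2 - k')) = n).eq_empty_or_nonempty with h | ⟨r₀, h0⟩
      · rw [h, Finset.card_empty]; exact Nat.zero_le _
      have hbd : ∀ r ∈ I ×ˢ I, |b * (r.1 - k) - b' * (r.2 - k')| ≤ 4 * A * H := by
        intro r hr
        rw [hI, Finset.mem_Icc] at hk hk'
        simp only [I, Finset.mem_product, Finset.mem_Icc] at hr
        have m1 : |b * (r.1 - k)| ≤ A * H := by
          rw [abs_mul, abs_of_pos (by linarith : 0 < b)]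
          refine mul_le_mul hbA (abs_le.mpr ⟨?_, ?_⟩) (abs_nonneg _) (by positivity) <;> linarith
        have m2 : |b' * (r.2 - k')| ≤ A * H := by
          rw [abs_mul, abs_of_pos hadm.1.pos]
          refine mul_le_mul hb'A (abs_le.mpr ⟨?_, ?_⟩) (abs_nonneg _) (by positivity) <;> linarith
        refine (abs_sub _ _).trans ?_
        have : (0 : ℤ) ≤ A * H := by positivity
        linarith
      rw [Finset.mem_filter] at h0
      have hinj : Function.Injective (fun r : ℤ × ℤ => (r.1, -r.2)) := by
        intro x y h
        simp only [Prod.mk.injEq, neg_inj] at h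
        exact Prod.ext h.1 h.2
      rw [← Finset.card_image_of_injective _ hinj]
      refine card_linear_rep_le (u := b) (v := b') (c := b * r₀.1 - b' * r₀.2) (H := H)
        hadm.1.pos hgcd hadm.1.ge _ ?_
      intro p hp
      obtain ⟨r, hr, rfl⟩ := Finset.mem_image.mp hp
      rw [Finset.mem_filter] at hr
      have e := hφ _ _ (hbd r hr.1) (hbd r₀ h0.1) (hr.2.trans h0.2.symm)
      have hr1 := Finset.mem_Icc.mp (Finset.mem_product.mp hr.1).1
      refine ⟨?_, by simp only; linarith⟩
      simp only
      rw [abs_of_pos (by linarith)]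
      linarith
  have e1 : (∑ q ∈ I ×ˢ I, ∑ q' ∈ I ×ˢ I, Γ (φ (b * (q.1 - q.2)) - φ (b' * (q'.1 - q'.2)))) =
      ∑ k ∈ I, ∑ k' ∈ I, ∑ r ∈ I ×ˢ I, Γ (φ (b * (r.1 - k) - b' * (r.2 - k'))) := by
    simp only [map_sub, Finset.sum_product]
    rw [Finset.sum_comm]
    refine Finset.sum_congr rfl fun k _ => ?_
    have e2 := Finset.sum_comm (s := I ×ˢ I) (t := I) (f := fun x k' =>
      Γ (φ (b * (x.1 - k)) - φ (b' * (x.2 - k'))))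
    simpa only [Finset.sum_product] using e2
  rw [e1]
  calc _ ≤ ∑ _k ∈ I, ∑ _k' ∈ I, 17 * (D : ℝ) ^ 2 * ∑ n, Γ n :=
        Finset.sum_le_sum fun k hk => Finset.sum_le_sum fun k' hk' => key k hk k' hk'
    _ = _ := by
        simp only [Finset.sum_const, hcI, nsmul_eq_mul]
        ring

/-- Doubling the shift turns the `U⁴` average into a sum over pairs `(b, b')`. Nearly coprime pairs
are bounded by the sum over all shifts, which is the `U⁵` power; the remaining pairs are few and
take the trivial bound `L⁵`. -/
theorem gowersPow_four_ge (φ : ℤ →+ G) {A H K : ℕ} (hH : 0 < H) (hHA : H ≤ A)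
    (hAK : A ≤ K * H) (hφ : InjUpTo φ (4 * A * H)) (hK : 2000 ≤ K) {L : ℝ} (hL : 0 < L)
    (hLK : L ≤ K * (H : ℝ) ^ 2) {g : G → ℂ} (hg : Bdd L g)
    (hyp : (A : ℝ) ^ 2 * H ^ 6 * L ≤ K * ‖∑ b ∈ Finset.Icc (1 : ℤ) A,
      ∑ q ∈ Finset.Icc (1 : ℤ) H ×ˢ Finset.Icc (1 : ℤ) H, ∑ a ∈ Finset.Icc (1 : ℤ) A,
      ∑ p ∈ Finset.Icc (1 : ℤ) H ×ˢ Finset.Icc (1 : ℤ) H,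
      ∑ r ∈ Finset.Icc (1 : ℤ) H ×ˢ Finset.Icc (1 : ℤ) H,
      ∑ y, gdiff (φ ((a + b) * (p.1 - p.2))) (gdiff (φ (a * (r.1 - r.2)))
        (gdiff (φ (b * (q.1 - q.2))) g)) y‖) :
    L ^ 6 ≤ (K : ℝ) ^ 2950 * gowersPow 4 g := by
  classical
  have hA : 0 < A := by omega
  have hA' : (0 : ℝ) < A := by exact_mod_cast hA
  have hH' : (0 : ℝ) < H := by exact_mod_cast hH
  have hK' : (2000 : ℝ) ≤ K := by exact_mod_cast hK
  have h1 := sum_gowersPow_gdiff_ge φ hH hHA hAK hφ hK hL hLK hg hyp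
  refine final_bound hA' hH' hK' hL hLK (gowersPow_nonneg _ _) h1 ?_
  refine (sum_gowersPow_gdiff_sq_le _ (fun i : ℤ × ℤ × ℤ => φ (i.1 * (i.2.1 - i.2.2))) hg).trans ?_
  refine mul_le_mul_of_nonneg_left ?_ (by positivity)
  set IA := Finset.Icc (1 : ℤ) A with hIA
  set sq := Finset.Icc (1 : ℤ) H ×ˢ Finset.Icc (1 : ℤ) H with hsq
  have hcA : IA.card = A := by simp [IA]
  have hcsq : sq.card = H ^ 2 := by simp [sq, pow_two]
  set Γ : G → ℝ := fun n => gowersPow 3 (gdiff n g) with hΓ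
  have hΓ0 : ∀ n, 0 ≤ Γ n := fun n => gowersPow_nonneg _ _
  have hΓL : ∀ n, Γ n ≤ L ^ 5 := fun n => gowersPow_le_pow 3 (hg.gdiff n)
  let S : ℤ → ℤ → ℝ := fun b b' => ∑ q ∈ sq, ∑ q' ∈ sq,
    Γ (φ (b * (q.1 - q.2)) - φ (b' * (q'.1 - q'.2)))
  have hS : ∀ b b', S b b' ≤ H ^ 4 * L ^ 5 := by
    intro b b'
    calc _ ≤ ∑ _q ∈ sq, ∑ _q' ∈ sq, L ^ 5 :=
          Finset.sum_le_sum fun q _ => Finset.sum_le_sum fun q' _ => hΓL _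
      _ = _ := by
          simp only [Finset.sum_const, hcsq, nsmul_eq_mul]
          push_cast; ring
  have hU0 : 0 ≤ gowersPow 4 g := gowersPow_nonneg _ _
  set gd : ℤ → Finset ℤ := goodSet A H (K ^ 983)
  have e1 : (∑ j ∈ IA ×ˢ sq, ∑ j' ∈ IA ×ˢ sq, Γ (φ (j.1 * (j.2.1 - j.2.2)) -
      φ (j'.1 * (j'.2.1 - j'.2.2)))) = ∑ b ∈ IA, ∑ b' ∈ IA, S b b' := by
    rw [Finset.sum_product]
    refine Finset.sum_congr rfl fun b _ => ?_
    simp only [S, Finset.sum_product (s := IA)]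
    exact Finset.sum_comm
  have h2 : ∀ b ∈ IA, ∑ b' ∈ IA, S b b' ≤
      ((IA.filter fun a => a ∉ gd b).card : ℝ) * (H ^ 4 * L ^ 5) +
      A * (H ^ 2 * (17 * ((K : ℝ) ^ 983) ^ 2 * gowersPow 4 g)) := by
    intro b hb
    rw [← Finset.sum_filter_add_sum_filter_not IA (fun a => a ∉ gd b)]
    refine add_le_add ?_ ?_
    · refine (Finset.sum_le_sum fun b' _ => hS b b').trans_eq ?_
      rw [Finset.sum_const, nsmul_eq_mul]
    · calc _ ≤ ∑ _b' ∈ IA with ¬ _b' ∉ gd b,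
            (H : ℝ) ^ 2 * (17 * ((K : ℝ) ^ 983) ^ 2 * gowersPow 4 g) := by
            refine Finset.sum_le_sum fun b' hb' => ?_
            rw [Finset.mem_filter, not_not] at hb'
            rw [hIA, Finset.mem_Icc] at hb hb'
            have := sum_diff_shift_le φ hφ hb.1 hb.2 hb'.1.2 hb'.2 Γ hΓ0
            rw [Nat.cast_pow] at this
            exact this
        _ ≤ _ := by
            rw [Finset.sum_const, nsmul_eq_mul]
            gcongr
            rw [← hcA]
            exact Finset.card_filter_le _ _
  rw [e1]
  refine (Finset.sum_le_sum h2).trans ?_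
  rw [Finset.sum_add_distrib, ← Finset.sum_mul, Finset.sum_const, hcA, nsmul_eq_mul]
  refine add_le_add ?_ (le_of_eq (by ring))
  gcongr
  have := sum_card_bad_le (A := A) (H := H) (D := K ^ 983) hHA (by positivity)
  rw [Nat.cast_pow] at this
  exact this

end Core

/-! ### Unfolding the recursive Gowers norm -/

section GowersExpansion
variable {G : Type*} [AddCommGroup G]

theorem foldr_gdiff_comm (h : G) (l : List G) (f : G → ℂ) :
    gdiff h (l.foldr gdiff f) = l.foldr gdiff (gdiff h f) := by
  induction l with
  | nil => rfl
  | cons k l ih => simp only [List.foldr_cons, gdiff_comm h k, ih]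

theorem sum_foldr_gdiff_succ [Fintype G] (s : ℕ) (f : G → ℂ) :
    ∑ h : Fin (s + 1) → G, ∑ x, (List.ofFn h).foldr gdiff f x =
      ∑ k, ∑ h : Fin s → G, ∑ x, (List.ofFn h).foldr gdiff (gdiff k f) x := by
  rw [← (Fin.consEquiv fun _ : Fin (s + 1) => G).sum_comp, Fintype.sum_prod_type]
  refine Finset.sum_congr rfl fun k _ => Finset.sum_congr rfl fun h _ => ?_
  simp only [Fin.consEquiv, Equiv.coe_fn_mk, List.ofFn_cons, List.foldr_cons, foldr_gdiff_comm]

theorem gowersPow_eq_sum [Fintype G] (s : ℕ) (f : G → ℂ) :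
    (gowersPow s f : ℂ) = ∑ h : Fin (s + 1) → G, ∑ x, (List.ofFn h).foldr gdiff f x := by
  induction s generalizing f with
  | zero =>
    rw [sum_foldr_gdiff_succ]
    simp only [gowersPow]
    rw [← sum_gdiff]
    simp
  | succ s ih =>
    rw [sum_foldr_gdiff_succ, gowersPow, Complex.ofReal_sum]
    exact Finset.sum_congr rfl fun k _ => ih _

end GowersExpansion

/-! ### Transfer from a residue class of `ℤ` to `ℤ/mℤ` -/

section Transfer

/-- `D` lives on the points `u + q z`, `0 ≤ z ≤ N`, and `F` is its copy on `ℤ/mℤ`. -/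
structure Rel (m N q : ℕ) (u : ℤ) (D : ℤ → ℂ) (F : ZMod m → ℂ) : Prop where
  supp : ∀ x, D x ≠ 0 → ∃ z : ℤ, 0 ≤ z ∧ z ≤ N ∧ x = u + q * z
  eq : ∀ z : ℤ, 2 * |z| < m → F z = D (u + q * z)

variable {m N q : ℕ} {u : ℤ} {D : ℤ → ℂ} {F : ZMod m → ℂ}

theorem two_abs_valMinAbs_lt (hm : Odd m) (x : ZMod m) : 2 * |x.valMinAbs| < m := by
  have : NeZero m := ⟨hm.pos.ne'⟩
  have h := ZMod.natAbs_valMinAbs_le x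
  obtain ⟨k, hk⟩ := hm
  rw [Int.abs_eq_natAbs]
  omega

theorem valMinAbs_intCast (hm : 0 < m) {z : ℤ} (hz : 2 * |z| < m) :
    ((z : ZMod m)).valMinAbs = z := by
  have : NeZero m := ⟨hm.ne'⟩
  rw [ZMod.valMinAbs_spec]
  refine ⟨rfl, ?_⟩
  have := abs_lt.mp (show |z * 2| < m by rw [abs_mul, abs_two]; linarith)
  exact ⟨this.1, this.2.le⟩

theorem Rel.range (h : Rel m N q u D F) (hq : 0 < q) {z : ℤ} (hz : D (u + q * z) ≠ 0) :
    0 ≤ z ∧ z ≤ N := by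
  obtain ⟨w, h0, h1, h2⟩ := h.supp _ hz
  have hq' : (q : ℤ) ≠ 0 := by exact_mod_cast hq.ne'
  have : z = w := mul_left_cancel₀ hq' (add_left_cancel h2)
  subst this
  exact ⟨h0, h1⟩

/-- Only base points with `0 ≤ z ≤ N < m/2` matter. If `z + n` leaves the range of minimal
representatives, it wraps to a negative one, where the function vanishes on both sides. -/
theorem Rel.diff (h : Rel m N q u D F) (hq : 0 < q) (hm : 2 * N < m) (hodd : Odd m) {n : ℤ}
    (hn : 2 * |n| < m) : Rel m N q u (mulDiff (q * n) D) (gdiff (n : ZMod m) F) := by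
  have hm' : 2 * (N : ℤ) < m := by exact_mod_cast hm
  refine ⟨fun x hx => h.supp x fun h0 => hx (by simp [mulDiff, h0]), fun z hz => ?_⟩
  simp only [gdiff, mulDiff]
  rw [h.eq z hz]
  by_cases h0 : D (u + q * z) = 0
  · simp [h0]
  · congr 1
    obtain ⟨z0, z1⟩ := h.range hq h0
    have e : u + q * z + q * n = u + q * (z + n) := by ring
    rw [e]
    by_cases hs : 2 * |z + n| < m
    · rw [← h.eq _ hs]
      push_cast; rfl
    · have hz1 : D (u + q * (z + n)) = 0 := by
        by_contra hne
        obtain ⟨w0, w1⟩ := h.range hq hne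
        rw [abs_of_nonneg w0] at hs
        linarith
      rw [hz1]
      obtain ⟨r, hr⟩ := hodd
      have hr' : (m : ℤ) = 2 * r + 1 := by exact_mod_cast hr
      have hn' := abs_lt.mp (show |2 * n| < m by rw [abs_mul, abs_two]; exact hn)
      have hcase : ∃ w : ℤ, 2 * |w| < m ∧ w < 0 ∧ ((z : ZMod m) + (n : ZMod m) = (w : ZMod m)) ∨
          2 * |w| < m ∧ w > N ∧ ((z : ZMod m) + (n : ZMod m) = (w : ZMod m)) := by
        rcases le_or_gt 0 (z + n) with hp | hp
        · rw [abs_of_nonneg hp] at hs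
          refine ⟨z + n - m, Or.inl ⟨?_, by linarith, by push_cast; simp⟩⟩
          rw [abs_of_neg (by linarith)]
          omega
        · rw [abs_of_neg hp] at hs
          exfalso
          omega
      obtain ⟨w, ⟨w1, w2, w3⟩ | ⟨w1, w2, w3⟩⟩ := hcase
      · rw [w3, h.eq w w1]
        by_contra hne
        linarith [(h.range hq hne).1]
      · rw [w3, h.eq w w1]
        by_contra hne
        linarith [(h.range hq hne).2]

theorem Rel.apply_eq_zero (h : Rel m N q u D F) (hq : 0 < q) (hodd : Odd m) {x : ZMod m}
    (hx : x ∉ (Finset.Icc (0 : ℤ) N).image (fun z : ℤ => (z : ZMod m))) : F x = 0 := by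
  by_contra hne
  rw [← ZMod.coe_valMinAbs x, h.eq _ (two_abs_valMinAbs_lt hodd x)] at hne
  exact hx (Finset.mem_image.mpr ⟨x.valMinAbs, Finset.mem_Icc.mpr (h.range hq hne),
    ZMod.coe_valMinAbs x⟩)

theorem intCast_injOn_Icc (hm : 2 * N < m) :
    Set.InjOn (fun z : ℤ => (z : ZMod m)) (Finset.Icc (0 : ℤ) N) := by
  intro x hx y hy h
  have hm' : 2 * (N : ℤ) < m := by exact_mod_cast hm
  simp only [Finset.coe_Icc, Set.mem_Icc] at hx hy
  have e : ∀ z : ℤ, 0 ≤ z ∧ z ≤ N → ((z : ZMod m)).valMinAbs = z := fun z hz =>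
    valMinAbs_intCast (by omega) (by rw [abs_of_nonneg hz.1]; linarith)
  rw [← e x hx, ← e y hy]
  exact congrArg _ h

theorem Rel.support_finite (h : Rel m N q u D F) : D.support.Finite := by
  refine ((Finset.Icc (0 : ℤ) N).image fun z => u + q * z).finite_toSet.subset fun x hx => ?_
  obtain ⟨z, h0, h1, rfl⟩ := h.supp x hx
  exact Finset.mem_coe.mpr (Finset.mem_image.mpr ⟨z, Finset.mem_Icc.mpr ⟨h0, h1⟩, rfl⟩)

theorem Rel.tsum_eq [NeZero m] (h : Rel m N q u D F) (hq : 0 < q) (hm : 2 * N < m)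
    (hodd : Odd m) : ∑' x, D x = ∑ x, F x := by
  have hm' : 2 * (N : ℤ) < m := by exact_mod_cast hm
  have hq' : (q : ℤ) ≠ 0 := by exact_mod_cast hq.ne'
  have e1 : ∑' x, D x = ∑ x ∈ (Finset.Icc (0 : ℤ) N).image (fun z => u + q * z), D x := by
    refine tsum_eq_sum fun x hx => ?_
    by_contra hne
    obtain ⟨z, h0, h1, rfl⟩ := h.supp x hne
    exact hx (Finset.mem_image.mpr ⟨z, Finset.mem_Icc.mpr ⟨h0, h1⟩, rfl⟩)
  have e2 : ∑ x, F x = ∑ x ∈ (Finset.Icc (0 : ℤ) N).image (fun z : ℤ => (z : ZMod m)), F x :=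
    (Finset.sum_subset (Finset.subset_univ _) fun x _ hx => h.apply_eq_zero hq hodd hx).symm
  rw [e1, e2, Finset.sum_image, Finset.sum_image (intCast_injOn_Icc hm)]
  · refine Finset.sum_congr rfl fun z hz => ?_
    rw [Finset.mem_Icc] at hz
    rw [h.eq z (by rw [abs_of_nonneg hz.1]; linarith)]
  · intro x _ y _ hxy
    exact mul_left_cancel₀ hq' (add_left_cancel hxy)

theorem Rel.iter (h : Rel m N q u D F) (hq : 0 < q) (hm : 2 * N < m) (hodd : Odd m)
    (l : List (ZMod m)) :
    Rel m N q u (iterDiff (l.map fun k => q * k.valMinAbs) D) (l.foldr gdiff F) := by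
  induction l with
  | nil => exact h
  | cons k l ih =>
    have := ih.diff hq hm hodd (two_abs_valMinAbs_lt hodd k)
    rw [ZMod.coe_valMinAbs] at this
    exact this

theorem ne_zero_of_iterDiff_ne_zero {l : List ℤ} {D : ℤ → ℂ} {x : ℤ} (hx : iterDiff l D x ≠ 0) :
    D x ≠ 0 := by
  induction l with
  | nil => exact hx
  | cons k l ih =>
    refine ih fun h0 => hx ?_
    change mulDiff k (iterDiff l D) x = 0
    simp [mulDiff, h0]

theorem Rel.shift_mem (h : Rel m N q u D F) {l : List ℤ} {x : ℤ} (hx : iterDiff l D x ≠ 0) :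
    ∀ k ∈ l, ∃ n : ℤ, |n| ≤ N ∧ k = q * n := by
  induction l with
  | nil => simp
  | cons k l ih =>
    have hx' : mulDiff k (iterDiff l D) x ≠ 0 := hx
    have h1 : iterDiff l D (x + k) ≠ 0 := fun h0 => hx' (by simp [mulDiff, h0])
    have h2 : iterDiff l D x ≠ 0 := fun h0 => hx' (by simp [mulDiff, h0])
    intro k' hk'
    rcases List.mem_cons.mp hk' with rfl | hmem
    · obtain ⟨z, z0, z1, hz⟩ := h.supp _ (ne_zero_of_iterDiff_ne_zero h1)
      obtain ⟨w, w0, w1, hw⟩ := h.supp _ (ne_zero_of_iterDiff_ne_zero h2)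
      refine ⟨z - w, abs_le.mpr ⟨by linarith, by linarith⟩, ?_⟩
      rw [mul_sub]; linarith
    · exact ih h2 k' hmem

/-- A nonzero term forces every shift to be `q n` with `|n| ≤ N`, so the minimal representatives in
`ℤ/mℤ` parametrise all contributing shifts without repetition. -/
theorem Rel.gowersSum_eq [NeZero m] (h : Rel m N q u D F) (hq : 0 < q) (hm : 2 * N < m)
    (hodd : Odd m) (s : ℕ) : gowersSum (s + 1) D = (gowersPow s F : ℂ) := by
  have hq' : (q : ℤ) ≠ 0 := by exact_mod_cast hq.ne'
  have hm' : 2 * (N : ℤ) < m := by exact_mod_cast hm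
  let j : (Fin (s + 1) → ZMod m) → (Fin (s + 1) → ℤ) := fun k i => q * (k i).valMinAbs
  have hj : Function.Injective j := by
    intro k k' hk
    funext i
    have := mul_left_cancel₀ hq' (congrFun hk i)
    rw [← ZMod.coe_valMinAbs (k i), ← ZMod.coe_valMinAbs (k' i), this]
  have hofFn : ∀ k, List.ofFn (j k) = (List.ofFn k).map fun k : ZMod m => (q : ℤ) * k.valMinAbs := by
    intro k
    rw [List.map_ofFn]; rfl
  have e1 : ∀ x, ∑' k : Fin (s + 1) → ℤ, iterDiff (List.ofFn k) D x =
      ∑ k : Fin (s + 1) → ZMod m,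
        iterDiff ((List.ofFn k).map fun k : ZMod m => (q : ℤ) * k.valMinAbs) D x := by
    intro x
    rw [← hj.tsum_eq (f := fun k => iterDiff (List.ofFn k) D x), tsum_fintype]
    · simp only [hofFn]
    · intro k hk
      have h1 := h.shift_mem (Function.mem_support.mp hk)
      have h2 : ∀ i, ∃ n : ℤ, |n| ≤ N ∧ k i = q * n := fun i =>
        h1 (k i) (List.mem_ofFn.mpr ⟨i, rfl⟩)
      choose n hn hkn using h2
      refine ⟨fun i => (n i : ZMod m), ?_⟩
      funext i
      simp only [j]
      rw [valMinAbs_intCast (by omega) (by linarith [hn i]), hkn i]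
  unfold gowersSum
  simp only [e1]
  rw [Summable.tsum_finsetSum, gowersPow_eq_sum]
  · exact Finset.sum_congr rfl fun k _ => (h.iter hq hm hodd _).tsum_eq hq hm hodd
  · exact fun k _ => summable_of_hasFiniteSupport (h.iter hq hm hodd _).support_finite

end Transfer

/-! ### The weighted sum as a finite sum over pairs -/

section BoxSum

theorem initSeg_eq_Icc {X : ℝ} (hX : 0 ≤ X) : initSeg X = Finset.Icc (1 : ℤ) ⌊X⌋₊ := by
  rw [initSeg, Int.natCast_floor_eq_floor hX]

theorem tsum_weight_mul (δ M : ℝ) (F : ℤ → ℂ) :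
    ∑' h, (weight δ M h : ℂ) * F h =
      ((δ ^ 2 * M)⁻¹ : ℝ) * ∑ p ∈ initSeg (δ * M) ×ˢ initSeg (δ * M), F (p.1 - p.2) := by
  set S := initSeg (δ * M) ×ˢ initSeg (δ * M) with hS
  have e : ∑ p ∈ S, F (p.1 - p.2) =
      ∑ h ∈ S.image (fun p => p.1 - p.2), ((S.filter fun p => p.1 - p.2 = h).card : ℂ) * F h := by
    rw [← Finset.sum_fiberwise_of_maps_to (g := fun p : ℤ × ℤ => p.1 - p.2)
      (fun p hp => Finset.mem_image_of_mem _ hp)]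
    refine Finset.sum_congr rfl fun h _ => ?_
    rw [Finset.sum_congr rfl fun p hp => by rw [(Finset.mem_filter.mp hp).2],
      Finset.sum_const, nsmul_eq_mul]
  rw [e, Finset.mul_sum, tsum_eq_sum (s := S.image fun p => p.1 - p.2)]
  · refine Finset.sum_congr rfl fun h _ => ?_
    rw [weight, ← hS, div_eq_inv_mul]
    push_cast
    ring
  · intro h hh
    have : S.filter (fun p => p.1 - p.2 = h) = ∅ := by
      refine Finset.filter_eq_empty_iff.mpr fun p hp hph => hh ?_
      exact Finset.mem_image.mpr ⟨p, hp, hph⟩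
    rw [weight, ← hS, this]
    simp

theorem boxSum_eq {f : ℤ → ℂ} (hf : f.support.Finite) (δ M : ℝ) (c₁ c₂ c₃ : ℤ) :
    boxSum δ M c₁ c₂ c₃ f = (((δ ^ 2 * M)⁻¹ ^ 3 : ℝ) : ℂ) *
      ∑ p ∈ initSeg (δ * M) ×ˢ initSeg (δ * M), ∑ q ∈ initSeg (δ * M) ×ˢ initSeg (δ * M),
      ∑ r ∈ initSeg (δ * M) ×ˢ initSeg (δ * M),
        ∑' x, iterDiff [c₁ * (p.1 - p.2), c₂ * (q.1 - q.2), c₃ * (r.1 - r.2)] f x := by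
  set S := initSeg (δ * M) ×ˢ initSeg (δ * M)
  have hsum : ∀ l, Summable (iterDiff l f) := fun l =>
    summable_of_hasFiniteSupport (hf.subset fun x hx => ne_zero_of_iterDiff_ne_zero hx)
  have e : ∀ x, (∑' (h₁ : ℤ) (h₂ : ℤ) (h₃ : ℤ),
      ((weight δ M h₁ * weight δ M h₂ * weight δ M h₃ : ℝ) : ℂ) *
        iterDiff [c₁ * h₁, c₂ * h₂, c₃ * h₃] f x) = (((δ ^ 2 * M)⁻¹ ^ 3 : ℝ) : ℂ) *
      ∑ p ∈ S, ∑ q ∈ S, ∑ r ∈ S,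
        iterDiff [c₁ * (p.1 - p.2), c₂ * (q.1 - q.2), c₃ * (r.1 - r.2)] f x := by
    intro x
    have a3 : ∀ h₁ h₂, (∑' h₃ : ℤ, ((weight δ M h₁ * weight δ M h₂ * weight δ M h₃ : ℝ) : ℂ) *
        iterDiff [c₁ * h₁, c₂ * h₂, c₃ * h₃] f x) = (weight δ M h₁ : ℂ) * ((weight δ M h₂ : ℂ) *
        (((δ ^ 2 * M)⁻¹ : ℝ) * ∑ r ∈ S, iterDiff [c₁ * h₁, c₂ * h₂, c₃ * (r.1 - r.2)] f x)) := by
      intro h₁ h₂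
      rw [← tsum_weight_mul δ M fun h => iterDiff [c₁ * h₁, c₂ * h₂, c₃ * h] f x,
        ← tsum_mul_left, ← tsum_mul_left]
      refine tsum_congr fun h => ?_
      push_cast
      ring
    simp only [a3, tsum_mul_left]
    have a2 : ∀ h₁, (∑' h₂ : ℤ, (weight δ M h₂ : ℂ) *
        (((δ ^ 2 * M)⁻¹ : ℝ) * ∑ r ∈ S, iterDiff [c₁ * h₁, c₂ * h₂, c₃ * (r.1 - r.2)] f x)) =
        ((δ ^ 2 * M)⁻¹ : ℝ) * ∑ q ∈ S, (((δ ^ 2 * M)⁻¹ : ℝ) *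
          ∑ r ∈ S, iterDiff [c₁ * h₁, c₂ * (q.1 - q.2), c₃ * (r.1 - r.2)] f x) := fun h₁ =>
      tsum_weight_mul δ M fun h => _
    simp only [a2]
    rw [tsum_weight_mul δ M fun h => ((δ ^ 2 * M)⁻¹ : ℝ) * ∑ q ∈ S, (((δ ^ 2 * M)⁻¹ : ℝ) *
          ∑ r ∈ S, iterDiff [c₁ * h, c₂ * (q.1 - q.2), c₃ * (r.1 - r.2)] f x)]
    simp only [← Finset.mul_sum]
    push_cast
    ring
  rw [boxSum, tsum_congr e, tsum_mul_left]
  congr 1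
  rw [Summable.tsum_finsetSum fun p _ => summable_sum fun q _ => summable_sum fun r _ => hsum _]
  refine Finset.sum_congr rfl fun p _ => ?_
  rw [Summable.tsum_finsetSum fun q _ => summable_sum fun r _ => hsum _]
  refine Finset.sum_congr rfl fun q _ => ?_
  rw [Summable.tsum_finsetSum fun r _ => hsum _]

end BoxSum

/-! ### Decomposition into residue classes -/

section Classes

theorem mem_resClass_add {u x k : ℤ} {q : ℕ} (hk : (q : ℤ) ∣ k) :
    x + k ∈ resClass u q ↔ x ∈ resClass u q := by
  obtain ⟨n, rfl⟩ := hk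
  constructor
  · rintro ⟨z, hz⟩
    exact ⟨z - n, by rw [mul_sub]; linarith⟩
  · rintro ⟨z, hz⟩
    exact ⟨z + n, by rw [mul_add]; linarith⟩

theorem iterDiff_indicator {u : ℤ} {q : ℕ} {l : List ℤ} (hl : ∀ k ∈ l, (q : ℤ) ∣ k) (f : ℤ → ℂ) :
    iterDiff l ((resClass u q).indicator f) = (resClass u q).indicator (iterDiff l f) := by
  induction l with
  | nil => rfl
  | cons k l ih =>
    have ih' := ih fun k' hk' => hl k' (List.mem_cons_of_mem _ hk')
    change mulDiff k (iterDiff l _) = (resClass u q).indicator (mulDiff k (iterDiff l f))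
    rw [ih']
    funext x
    have := mem_resClass_add (u := u) (x := x) (hl k List.mem_cons_self)
    by_cases hx : x ∈ resClass u q
    · simp [mulDiff, hx, this]
    · simp [mulDiff, hx]

theorem sum_indicator_resClass {q : ℕ} (hq : 0 < q) (g : ℤ → ℂ) (x : ℤ) :
    ∑ u ∈ Finset.Icc (1 : ℤ) q, (resClass u q).indicator g x = g x := by
  have hq' : (0 : ℤ) < q := by exact_mod_cast hq
  have h0 := Int.emod_nonneg (x - 1) hq'.ne'
  have h1 := Int.emod_lt_of_pos (x - 1) hq'
  have h2 := Int.mul_ediv_add_emod (x - 1) q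
  rw [Finset.sum_eq_single ((x - 1) % q + 1)]
  · exact Set.indicator_of_mem (show x ∈ resClass _ q from ⟨(x - 1) / q, by linarith⟩) _
  · intro u hu hne
    refine Set.indicator_of_notMem ?_ _
    rintro ⟨k, rfl⟩
    rw [Finset.mem_Icc] at hu
    apply hne
    have : u + q * k - 1 = (u - 1) + q * k := by ring
    rw [this, Int.add_mul_emod_self_left, Int.emod_eq_of_lt (by linarith) (by linarith)]
    ring
  · intro h
    exact absurd (Finset.mem_Icc.mpr ⟨by linarith, by linarith⟩) h

theorem tsum_iterDiff_eq_sum_classes {q : ℕ} (hq : 0 < q) {f : ℤ → ℂ} (hf : f.support.Finite)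
    {l : List ℤ} (hl : ∀ k ∈ l, (q : ℤ) ∣ k) :
    ∑' x, iterDiff l f x =
      ∑ u ∈ Finset.Icc (1 : ℤ) q, ∑' x, iterDiff l ((resClass u q).indicator f) x := by
  simp only [iterDiff_indicator hl]
  rw [← Summable.tsum_finsetSum]
  · simp only [sum_indicator_resClass hq]
  · intro u _
    refine summable_of_hasFiniteSupport (hf.subset fun x hx => ?_)
    have : (resClass u q).indicator (iterDiff l f) x ≠ 0 := hx
    exact ne_zero_of_iterDiff_ne_zero (Set.indicator_apply_ne_zero.mp this).2

/-- The restriction of `f` to `u + qℤ`, read on `ℤ/mℤ`. -/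
def classFun (f : ℤ → ℂ) (m q : ℕ) (u : ℤ) : ZMod m → ℂ := fun x => f (u + q * x.valMinAbs)

variable {f : ℤ → ℂ} {N q m : ℕ} {u : ℤ}

theorem rel_classFun (hm : 0 < m) (hf : ∀ x, f x ≠ 0 → x ∈ Finset.Icc (1 : ℤ) N)
    (hu : u ∈ Finset.Icc (1 : ℤ) q) :
    Rel m N q u ((resClass u q).indicator f) (classFun f m q u) := by
  rw [Finset.mem_Icc] at hu
  refine ⟨fun x hx => ?_, fun z hz => ?_⟩
  · obtain ⟨⟨k, rfl⟩, h⟩ := Set.indicator_apply_ne_zero.mp hx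
    have := Finset.mem_Icc.mp (hf _ h)
    refine ⟨k, ?_, ?_, rfl⟩
    · by_contra hk
      have : (q : ℤ) * k ≤ q * (-1) := mul_le_mul_of_nonneg_left (by omega) (by omega)
      linarith
    · by_contra hk
      have : (1 : ℤ) * k ≤ q * k := mul_le_mul_of_nonneg_right (by omega) (by omega)
      linarith
  · rw [classFun, valMinAbs_intCast hm hz, Set.indicator_of_mem (show u + q * z ∈ resClass u q from ⟨z, rfl⟩)]

/-- The class meets `[N]` in at most `⌊N/q⌋ + 1` points, so the mass is of order `N/q` although `m`
exceeds `2N`. This is why the estimates are stated in terms of `L` and not of the group order. -/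
theorem bdd_classFun (hq : 0 < q) (hb : ∀ x, ‖f x‖ ≤ 1)
    (hf : ∀ x, f x ≠ 0 → x ∈ Finset.Icc (1 : ℤ) N) (hu : u ∈ Finset.Icc (1 : ℤ) q) [NeZero m]
    {L : ℝ} (hL : (N : ℝ) / q + 1 ≤ L) : Bdd L (classFun f m q u) := by
  have hq' : (0 : ℤ) < q := by exact_mod_cast hq
  rw [Finset.mem_Icc] at hu
  refine ⟨fun x => hb _, le_trans ?_ hL⟩
  have key : ∀ x : ZMod m, ‖classFun f m q u x‖ ≤
      if x ∈ (Finset.range (N / q + 1)).image (fun z : ℕ => (z : ZMod m)) then 1 else 0 := by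
    intro x
    split_ifs with h
    · exact hb _
    · rw [norm_le_zero_iff]
      by_contra hne
      have h1 := Finset.mem_Icc.mp (hf _ hne)
      have h2 : 0 ≤ x.valMinAbs := by
        by_contra hk
        have : (q : ℤ) * x.valMinAbs ≤ q * (-1) := mul_le_mul_of_nonneg_left (by omega) (by omega)
        linarith
      obtain ⟨z, hz⟩ := Int.eq_ofNat_of_zero_le h2
      refine h (Finset.mem_image.mpr ⟨z, Finset.mem_range.mpr ?_, ?_⟩)
      · rw [Nat.lt_succ_iff, Nat.le_div_iff_mul_le hq]
        zify
        rw [hz] at h1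
        linarith
      · conv_rhs => rw [← ZMod.coe_valMinAbs x, hz]
        simp
  refine (Finset.sum_le_sum fun x _ => key x).trans ?_
  rw [Finset.sum_ite_mem, Finset.univ_inter, Finset.sum_const, nsmul_eq_mul, mul_one]
  calc ((((Finset.range (N / q + 1)).image fun z : ℕ => (z : ZMod m)).card : ℕ) : ℝ)
      ≤ ((N / q + 1 : ℕ) : ℝ) := by
        exact_mod_cast Finset.card_image_le.trans (Finset.card_range _).le
    _ ≤ N / q + 1 := by
        push_cast
        linarith [@Nat.cast_div_le ℝ _ _ _ N q]

theorem tsum_iterDiff_class [NeZero m] (hq : 0 < q) (hm : 2 * N < m) (hodd : Odd m)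
    {D : ℤ → ℂ} {F : ZMod m → ℂ} (h : Rel m N q u D F) {n₁ n₂ n₃ : ℤ} (h₁ : 2 * |n₁| < m)
    (h₂ : 2 * |n₂| < m) (h₃ : 2 * |n₃| < m) :
    ∑' x, iterDiff [q * n₁, q * n₂, q * n₃] D x =
      ∑ x, gdiff (n₁ : ZMod m) (gdiff (n₃ : ZMod m) (gdiff (n₂ : ZMod m) F)) x := by
  rw [gdiff_comm (n₃ : ZMod m)]
  exact (((h.diff hq hm hodd h₃).diff hq hm hodd h₂).diff hq hm hodd h₁).tsum_eq hq hm hodd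

theorem gowersNormOn_pow [NeZero m] (hq : 0 < q) (hm : 2 * N < m) (hodd : Odd m)
    {F : ZMod m → ℂ} (h : Rel m N q u ((resClass u q).indicator f) F) :
    gowersNormOn 5 (resClass u q) f ^ (2 ^ 5) = gowersPow 4 F := by
  rw [gowersNormOn, gowersNorm, h.gowersSum_eq hq hm hodd 4, Complex.ofReal_re,
    ← Real.rpow_natCast, ← Real.rpow_mul (gowersPow_nonneg _ _)]
  norm_num

end Classes

/-! ### The hypothesis as a sum over classes of box counts -/

section Average

theorem sum_comm_four {α β γ ε : Type*} (P : Finset α) (S : Finset β) (R : Finset γ) (U : Finset ε)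
    (F : α → β → γ → ε → ℂ) :
    ∑ p ∈ P, ∑ s ∈ S, ∑ r ∈ R, ∑ u ∈ U, F p s r u =
      ∑ u ∈ U, ∑ s ∈ S, ∑ p ∈ P, ∑ r ∈ R, F p s r u := by
  rw [Finset.sum_comm, Finset.sum_comm (s := U)]
  refine Finset.sum_congr rfl fun s _ => ?_
  rw [Finset.sum_comm (s := U)]
  exact Finset.sum_congr rfl fun p _ => Finset.sum_comm

theorem sum_comm_four' {α β γ ε : Type*} (P : Finset α) (S : Finset β) (U : Finset γ) (R : Finset ε)
    (F : α → β → γ → ε → ℂ) :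
    ∑ p ∈ P, ∑ s ∈ S, ∑ u ∈ U, ∑ r ∈ R, F p s u r =
      ∑ u ∈ U, ∑ s ∈ S, ∑ r ∈ R, ∑ p ∈ P, F p s u r := by
  rw [Finset.sum_comm, Finset.sum_comm (s := U)]
  refine Finset.sum_congr rfl fun s _ => ?_
  rw [Finset.sum_comm]
  exact Finset.sum_congr rfl fun p _ => Finset.sum_comm

/-- The sum over the cube of shifts with parameters `a, b ≤ A` and differences of `H`-boxes. -/
def boxCount {G : Type*} [AddCommGroup G] [Fintype G] (φ : ℤ →+ G) (A H : ℕ) (g : G → ℂ) : ℂ :=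
  ∑ b ∈ Finset.Icc (1 : ℤ) A, ∑ q ∈ Finset.Icc (1 : ℤ) H ×ˢ Finset.Icc (1 : ℤ) H,
    ∑ a ∈ Finset.Icc (1 : ℤ) A, ∑ p ∈ Finset.Icc (1 : ℤ) H ×ˢ Finset.Icc (1 : ℤ) H,
    ∑ r ∈ Finset.Icc (1 : ℤ) H ×ˢ Finset.Icc (1 : ℤ) H, ∑ y,
      gdiff (φ ((a + b) * (p.1 - p.2)))
        (gdiff (φ (a * (r.1 - r.2))) (gdiff (φ (b * (q.1 - q.2))) g)) y

theorem norm_boxCount_le {G : Type*} [AddCommGroup G] [Fintype G] (φ : ℤ →+ G) (A H : ℕ)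
    {L : ℝ} {g : G → ℂ} (hg : Bdd L g) : ‖boxCount φ A H g‖ ≤ (A : ℝ) ^ 2 * H ^ 6 * L := by
  have step : ∀ {ι : Type} (s : Finset ι) (F : ι → ℂ) (B : ℝ), (∀ i, ‖F i‖ ≤ B) →
      ‖∑ i ∈ s, F i‖ ≤ s.card * B := fun s F B h =>
    (norm_sum_le_of_le s fun i _ => h i).trans (by simp)
  have hS : (((Finset.Icc (1 : ℤ) H ×ˢ Finset.Icc (1 : ℤ) H).card : ℕ) : ℝ) = (H : ℝ) ^ 2 := by
    simp [Finset.card_product, sq]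
  have hA : (((Finset.Icc (1 : ℤ) A).card : ℕ) : ℝ) = A := by simp
  have := step (Finset.Icc (1 : ℤ) A) _ _ fun b => step
    (Finset.Icc (1 : ℤ) H ×ˢ Finset.Icc (1 : ℤ) H) _ _ fun q => step (Finset.Icc (1 : ℤ) A) _ _
    fun a => step (Finset.Icc (1 : ℤ) H ×ˢ Finset.Icc (1 : ℤ) H) _ _ fun p => step
    (Finset.Icc (1 : ℤ) H ×ˢ Finset.Icc (1 : ℤ) H) _ _ fun r =>
    (((hg.gdiff (φ (b * (q.1 - q.2)))).gdiff (φ (a * (r.1 - r.2)))).gdiff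
      (φ ((a + b) * (p.1 - p.2)))).norm_sum_le
  rw [hS, hA] at this
  calc ‖boxCount φ A H g‖ ≤ _ := this
    _ = _ := by ring

variable {f : ℤ → ℂ} {N q m : ℕ}

/-- `k ↦ 2k` as a map to `ℤ/mℤ`. -/
def twoMul (m : ℕ) : ℤ →+ ZMod m := (Int.castAddHom (ZMod m)).comp (AddMonoidHom.mulLeft 2)

theorem twoMul_apply (m : ℕ) (k : ℤ) : twoMul m k = ((2 * k : ℤ) : ZMod m) := rfl

theorem injUpTo_twoMul {X : ℤ} (h : 4 * X < m) : InjUpTo (twoMul m) X := by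
  intro k k' hk hk' e
  rw [twoMul_apply, twoMul_apply] at e
  have key : ∀ j : ℤ, |j| ≤ X → (((2 * j : ℤ) : ZMod m)).valMinAbs = 2 * j := fun j hj =>
    valMinAbs_intCast (by have := abs_nonneg j; omega) (by rw [abs_mul, abs_two]; linarith)
  have := congrArg ZMod.valMinAbs e
  rw [key k hk, key k' hk'] at this
  linarith

/-- The largest shift is `2(a + b)h` with modulus at most `4AH`, so `8AH < m` prevents wraparound.
The difference in `b` is moved innermost, because it is the one that gets frozen later. -/
theorem expect_boxSum_eq [NeZero m] (hq : 0 < q) (hf : ∀ x, f x ≠ 0 → x ∈ Finset.Icc (1 : ℤ) N)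
    {X δ M : ℝ} (hX : 0 ≤ X) (hδM : 0 ≤ δ * M) (hm : 2 * N < m) (hodd : Odd m)
    (hm' : 8 * (⌊X⌋₊ * ⌊δ * M⌋₊) < m) :
    (𝔼 a ∈ initSeg X, 𝔼 b ∈ initSeg X,
      boxSum δ M (2 * (q : ℤ) * (a + b)) (2 * (q : ℤ) * b) (2 * (q : ℤ) * a) f) =
    (((⌊X⌋₊ : ℝ)⁻¹ ^ 2 * (δ ^ 2 * M)⁻¹ ^ 3 : ℝ) : ℂ) *
      ∑ u ∈ Finset.Icc (1 : ℤ) q, boxCount (twoMul m) ⌊X⌋₊ ⌊δ * M⌋₊ (classFun f m q u) := by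
  have hfin : f.support.Finite := (Finset.Icc (1 : ℤ) N).finite_toSet.subset fun x hx => hf x hx
  rw [initSeg_eq_Icc hX]
  simp only [boxSum_eq hfin, initSeg_eq_Icc hδM, Finset.expect_eq_sum_div_card]
  set A := ⌊X⌋₊
  set H := ⌊δ * M⌋₊
  set S := Finset.Icc (1 : ℤ) H ×ˢ Finset.Icc (1 : ℤ) H with hS
  have habs : ∀ {p : ℤ × ℤ}, p ∈ S → |p.1 - p.2| ≤ H := by
    intro p hp
    obtain ⟨h1, h2⟩ := Finset.mem_product.mp hp
    rw [Finset.mem_Icc] at h1 h2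
    exact abs_le.mpr ⟨by linarith, by linarith⟩
  have hmZ : 8 * ((A : ℤ) * H) < m := by exact_mod_cast hm'
  have hsmall : ∀ {c : ℤ} {p : ℤ × ℤ}, 0 ≤ c → c ≤ 2 * A → p ∈ S →
      2 * |2 * (c * (p.1 - p.2))| < m := by
    intro c p hc hcA hp
    rw [abs_mul, abs_mul, abs_two, abs_of_nonneg hc]
    have := mul_le_mul hcA (habs hp) (abs_nonneg _) (by positivity)
    linarith
  have key : ∀ a ∈ Finset.Icc (1 : ℤ) A, ∀ b ∈ Finset.Icc (1 : ℤ) A,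
      (∑ p ∈ S, ∑ s ∈ S, ∑ r ∈ S, ∑' x, iterDiff [2 * (q : ℤ) * (a + b) * (p.1 - p.2),
        2 * (q : ℤ) * b * (s.1 - s.2), 2 * (q : ℤ) * a * (r.1 - r.2)] f x) =
      ∑ u ∈ Finset.Icc (1 : ℤ) q, ∑ s ∈ S, ∑ p ∈ S, ∑ r ∈ S, ∑ y,
        gdiff (twoMul m ((a + b) * (p.1 - p.2))) (gdiff (twoMul m (a * (r.1 - r.2)))
          (gdiff (twoMul m (b * (s.1 - s.2))) (classFun f m q u))) y := by
    intro a ha b hb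
    rw [Finset.mem_Icc] at ha hb
    have e : ∀ p ∈ S, ∀ s ∈ S, ∀ r ∈ S,
        ∑' x, iterDiff [2 * (q : ℤ) * (a + b) * (p.1 - p.2),
          2 * (q : ℤ) * b * (s.1 - s.2), 2 * (q : ℤ) * a * (r.1 - r.2)] f x =
        ∑ u ∈ Finset.Icc (1 : ℤ) q, ∑ y, gdiff (twoMul m ((a + b) * (p.1 - p.2)))
          (gdiff (twoMul m (a * (r.1 - r.2)))
            (gdiff (twoMul m (b * (s.1 - s.2))) (classFun f m q u))) y := by
      intro p hp s hs r hr
      have r1 : 2 * (q : ℤ) * (a + b) * (p.1 - p.2) = q * (2 * ((a + b) * (p.1 - p.2))) := by ring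
      have r2 : 2 * (q : ℤ) * b * (s.1 - s.2) = q * (2 * (b * (s.1 - s.2))) := by ring
      have r3 : 2 * (q : ℤ) * a * (r.1 - r.2) = q * (2 * (a * (r.1 - r.2))) := by ring
      rw [r1, r2, r3, tsum_iterDiff_eq_sum_classes hq hfin (by simp)]
      refine Finset.sum_congr rfl fun u hu => ?_
      simp only [twoMul_apply]
      exact tsum_iterDiff_class hq hm hodd (rel_classFun (by omega) hf hu)
        (hsmall (by linarith) (by linarith) hp) (hsmall (by linarith) (by linarith) hs)
        (hsmall (by linarith) (by linarith) hr)
    rw [Finset.sum_congr rfl fun p hp => Finset.sum_congr rfl fun s hs =>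
      Finset.sum_congr rfl fun r hr => e p hp s hs r hr]
    exact sum_comm_four S S S _ _
  rw [Finset.sum_congr rfl fun a ha => by
    rw [Finset.sum_congr rfl fun b hb => by rw [key a ha b hb]]]
  have hA : (((Finset.Icc (1 : ℤ) A).card : ℕ) : ℂ) = A := by simp
  simp only [boxCount, hA]
  rw [← sum_comm_four']
  simp only [← Finset.mul_sum, ← Finset.sum_div]
  push_cast
  ring

end Average

/-! ### Choice of parameters and averaging over classes -/

section Quantitative

/-- Pointwise, `g i` is at least the linear function `B/(2X) · (r i - δX/2)`: this is at most `B` by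
the upper bound on `r i`, and nonpositive at unpopular `i`. Summing needs no count of popular
indices. -/
theorem le_sum_of_popular {ι : Type*} (s : Finset ι) (r g : ι → ℝ) {X δ B : ℝ} (hX : 0 < X)
    (hB : 0 ≤ B) (hr : ∀ i ∈ s, r i ≤ 2 * X) (hsum : δ * s.card * X ≤ ∑ i ∈ s, r i)
    (hg : ∀ i ∈ s, 0 ≤ g i) (hpop : ∀ i ∈ s, δ * X / 2 ≤ r i → B ≤ g i) (hδ : 0 ≤ δ) :
    δ * s.card / 4 * B ≤ ∑ i ∈ s, g i := by
  have key : ∀ i ∈ s, B / (2 * X) * (r i - δ * X / 2) ≤ g i := by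
    intro i hi
    rcases le_or_gt (δ * X / 2) (r i) with h | h
    · refine le_trans ?_ (hpop i hi h)
      rw [div_mul_eq_mul_div, div_le_iff₀ (by positivity)]
      exact mul_le_mul_of_nonneg_left (by linarith [hr i hi, mul_nonneg hδ hX.le]) hB
    · exact (mul_nonpos_of_nonneg_of_nonpos (by positivity) (by linarith)).trans (hg i hi)
  refine le_trans ?_ (Finset.sum_le_sum key)
  rw [← Finset.mul_sum, Finset.sum_sub_distrib, Finset.sum_const, nsmul_eq_mul]
  calc δ * s.card / 4 * B = B / (2 * X) * (δ * s.card * X - s.card * (δ * X / 2)) := by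
        field_simp; ring
    _ ≤ _ := mul_le_mul_of_nonneg_left (by linarith) (by positivity)

theorem mul_pow_le_pow_mul {x y : ℝ} (hx : 0 < x) (hy : 0 < y) (hxy : x * y ^ 2 ≤ 1)
    (hxy' : x * y ≤ 1) (k : ℕ) {n : ℕ} (hn : 2 * k + 1 ≤ n) (hx1 : x ≤ 1) :
    (x * y) ^ n ≤ x ^ k * y := by
  calc (x * y) ^ n ≤ (x * y) ^ (2 * k + 1) := pow_le_pow_of_le_one (by positivity) hxy' hn
    _ = x ^ k * (x * y ^ 2) ^ k * (x * y) := by ring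
    _ ≤ x ^ k * 1 * (1 * y) := by
        gcongr
        exact pow_le_one₀ (by positivity) hxy
    _ = x ^ k * y := by ring

/-- What the smallness of `δ₂` provides: `δ₂ ≤ δ₁` gives `H ≤ A`, `δ₂ ≤ δ₃` lets `K` absorb `δ₃⁻¹`,
and `δ₂ ≤ 1/4` makes the products of `δ₂` with powers of `δ₃ ≤ 2` at most 1. -/
theorem parameter_bounds {δ₁ δ₂ δ₃ : ℝ} (h1 : 0 < δ₁) (h1' : δ₁ ≤ 1) (h3 : 0 < δ₃)
    (h3' : δ₃ ≤ 2) (h : δ₂ < 1 / 64 * δ₁ ^ 3 * δ₃ ^ 4) :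
    δ₂ ≤ δ₁ ∧ δ₂ ≤ δ₃ ∧ δ₂ ≤ 1 / 4 := by
  have e1 : δ₁ ^ 3 ≤ δ₁ := by simpa using pow_le_pow_of_le_one h1.le h1' (show 1 ≤ 3 by norm_num)
  have e3 : δ₃ ^ 3 ≤ 2 ^ 3 := pow_le_pow_left₀ h3.le h3' 3
  have e4 : δ₃ ^ 4 ≤ 2 ^ 4 := pow_le_pow_left₀ h3.le h3' 4
  have e5 : δ₃ ^ 4 ≤ 8 * δ₃ := by
    calc δ₃ ^ 4 = δ₃ ^ 3 * δ₃ := by ring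
      _ ≤ 2 ^ 3 * δ₃ := by gcongr
      _ = 8 * δ₃ := by norm_num
  have f1 : δ₁ ^ 3 * δ₃ ^ 4 ≤ δ₁ * 2 ^ 4 := by gcongr
  have f2 : δ₁ ^ 3 * δ₃ ^ 4 ≤ 1 * (8 * δ₃) := by
    gcongr; linarith
  have f3 : δ₁ ^ 3 * δ₃ ^ 4 ≤ 1 * 2 ^ 4 := by
    gcongr; linarith
  exact ⟨by linarith, by linarith, by linarith⟩

theorem const_mul_le {W Z Y x P y : ℝ} (hW : 0 < W) (hy : 0 ≤ y) (h : Z ≤ Y * x) :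
    1 / (4 * W) * Z * P ^ 6 * y ≤ x * y / 4 * (P ^ 6 * (Y / W)) := by
  calc 1 / (4 * W) * Z * P ^ 6 * y ≤ 1 / (4 * W) * (Y * x) * P ^ 6 * y := by gcongr
    _ = x * y / 4 * (P ^ 6 * (Y / W)) := by field_simp

set_option maxHeartbeats 1000000 in
/-- The theorem on `ℤ/mℤ`, class by class and before averaging. -/
theorem sum_gowersPow_ge {N q m : ℕ} [NeZero m] {f : ℤ → ℂ} {δ₁ δ₂ δ₃ M : ℝ} (hN : 0 < N)
    (hq : 0 < q) (hb : ∀ x, ‖f x‖ ≤ 1) (hf : ∀ x, f x ≠ 0 → x ∈ Finset.Icc (1 : ℤ) N)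
    (h1 : 0 < δ₁) (h1' : δ₁ ≤ 1) (h2 : 0 < δ₂) (h3 : 0 < δ₃) (hM : 0 < M)
    (hM2 : M ^ 2 = (N : ℝ) / q)
    (hm : 16 * (⌊δ₁ * M⌋₊ * ⌊δ₂ * M⌋₊) < m)
    (hyp : δ₃ * (N : ℝ) * M ^ 3 ≤ ((⌊δ₁ * M⌋₊ : ℝ)⁻¹ ^ 2 * (δ₂ ^ 2 * M)⁻¹ ^ 3) *
      ∑ u ∈ Finset.Icc (1 : ℤ) q,
        (boxCount (twoMul m) ⌊δ₁ * M⌋₊ ⌊δ₂ * M⌋₊ (classFun f m q u)).re)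
    (hδ : δ₂ < 1 / 64 * δ₁ ^ 3 * δ₃ ^ 4) :
    1 / (4 * 2001 ^ 2950) * (δ₂ * δ₃) ^ (2 ^ 25) * ((N : ℝ) / q) ^ 6 * q ≤
      ∑ u ∈ Finset.Icc (1 : ℤ) q, gowersPow 4 (classFun f m q u) := by
  have hA_le : (⌊δ₁ * M⌋₊ : ℝ) ≤ δ₁ * M := Nat.floor_le (by positivity)
  have hH_le : (⌊δ₂ * M⌋₊ : ℝ) ≤ δ₂ * M := Nat.floor_le (by positivity)
  have hH_lt : δ₂ * M < (⌊δ₂ * M⌋₊ : ℝ) + 1 := Nat.lt_floor_add_one _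
  have hAH : δ₂ ≤ δ₁ → ⌊δ₂ * M⌋₊ ≤ ⌊δ₁ * M⌋₊ := fun h =>
    Nat.floor_le_floor (mul_le_mul_of_nonneg_right h hM.le)
  generalize hA : ⌊δ₁ * M⌋₊ = A at *
  generalize hH : ⌊δ₂ * M⌋₊ = H at *
  set P : ℝ := (N : ℝ) / q with hP
  have hN' : (0 : ℝ) < N := by exact_mod_cast hN
  have hq' : (0 : ℝ) < q := by exact_mod_cast hq
  have hP0 : 0 < P := by positivity
  have hNP : (N : ℝ) = q * P := by rw [hP]; field_simp
  have hbdd : ∀ u ∈ Finset.Icc (1 : ℤ) q, ∀ L : ℝ, P + 1 ≤ L → Bdd L (classFun f m q u) :=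
    fun u hu L hL => bdd_classFun hq hb hf hu hL
  have hlhs : 0 < δ₃ * (N : ℝ) * M ^ 3 := by positivity
  -- An empty average is `0`, here through `0⁻¹ = 0`, which contradicts the positive lower bound;
  -- the empty box `H = 0` is excluded likewise.
  have hA0 : 0 < A := by
    refine Nat.pos_of_ne_zero fun h0 => ?_
    subst h0
    simp at hyp
    linarith
  have hH0 : 0 < H := by
    refine Nat.pos_of_ne_zero fun h0 => ?_
    subst h0
    have : ∀ u ∈ Finset.Icc (1 : ℤ) q, (boxCount (twoMul m) A 0 (classFun f m q u)).re = 0 := by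
      intro u hu
      have := norm_boxCount_le (twoMul m) A 0 (hbdd u hu _ le_rfl)
      rw [Nat.cast_zero, zero_pow (by norm_num), mul_zero, zero_mul, norm_le_zero_iff] at this
      rw [this, Complex.zero_re]
    rw [Finset.sum_eq_zero this, mul_zero] at hyp
    linarith
  have hA1 : (1 : ℝ) ≤ A := by exact_mod_cast hA0
  have hH1 : (1 : ℝ) ≤ H := by exact_mod_cast hH0
  have hAM : (A : ℝ) ≤ M := hA_le.trans (mul_le_of_le_one_left hM.le h1')
  have hP1 : 1 ≤ P := by
    rw [← hM2]
    exact one_le_pow₀ (hA1.trans hAM)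
  -- The normalising size of one class: clearing denominators in `hyp` gives exactly `δ₃ q X` on the
  -- left, because `M² = P`.
  set X : ℝ := (A : ℝ) ^ 2 * (δ₂ * M) ^ 6 * P with hX
  have hX0 : 0 < X := by positivity
  have hcard : ((Finset.Icc (1 : ℤ) q).card : ℝ) = q := by simp
  have hsum : δ₃ * ((Finset.Icc (1 : ℤ) q).card : ℝ) * X ≤ ∑ u ∈ Finset.Icc (1 : ℤ) q,
      (boxCount (twoMul m) A H (classFun f m q u)).re := by
    rw [hcard]
    rw [inv_pow, inv_pow, ← mul_inv, inv_mul_eq_div, le_div_iff₀ (by positivity)] at hyp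
    calc δ₃ * q * X = δ₃ * N * M ^ 3 * ((A : ℝ) ^ 2 * (δ₂ ^ 2 * M) ^ 3) := by
          rw [hX, hNP]; ring
      _ ≤ _ := hyp
  have hup : ∀ u ∈ Finset.Icc (1 : ℤ) q,
      (boxCount (twoMul m) A H (classFun f m q u)).re ≤ 2 * X := by
    intro u hu
    calc _ ≤ ‖boxCount (twoMul m) A H (classFun f m q u)‖ := Complex.re_le_norm _
      _ ≤ (A : ℝ) ^ 2 * H ^ 6 * (2 * P) :=
        norm_boxCount_le _ _ _ (hbdd u hu _ (by linarith))
      _ ≤ (A : ℝ) ^ 2 * (δ₂ * M) ^ 6 * (2 * P) := by gcongr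
      _ = 2 * X := by rw [hX]; ring
  -- The trivial upper bound `2X` per class limits `δ₃`; the factor 2 comes from `P + 1 ≤ 2P`.
  have h3' : δ₃ ≤ 2 := by
    have := hsum.trans (Finset.sum_le_card_nsmul _ _ _ hup)
    rw [nsmul_eq_mul, hcard] at this
    have : q * X * δ₃ ≤ q * X * 2 := by linarith
    exact le_of_mul_le_mul_left this (by positivity)
  obtain ⟨h21, h23, h24⟩ := parameter_bounds h1 h1' h3 h3' hδ
  have h22 : δ₂ ^ 2 ≤ 1 / 4 * δ₂ := by rw [sq]; gcongr
  -- One parameter meeting all requirements: `A ≤ KH`, `L ≤ KH²`, `K ≥ 2000` and `Kδ₃ ≥ 4`. The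
  -- first two need `δ₂ M ≤ 2H`, valid since `H ≥ 1`.
  set K : ℕ := ⌈2000 / δ₂ ^ 2⌉₊ with hK
  have hKge : 2000 / δ₂ ^ 2 ≤ K := Nat.le_ceil _
  have hKge' : 2000 ≤ K * δ₂ ^ 2 := (div_le_iff₀ (by positivity)).mp hKge
  have hKle : (K : ℝ) ≤ 2001 / δ₂ ^ 2 := by
    have := (Nat.ceil_lt_add_one (show 0 ≤ 2000 / δ₂ ^ 2 by positivity)).le
    refine this.trans ?_
    rw [div_add_one (by positivity)]
    gcongr
    nlinarith
  have hK2000 : 2000 ≤ K := by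
    have : (2000 : ℝ) ≤ K := by
      refine hKge'.trans (mul_le_of_le_one_right (by positivity) (by linarith))
    exact_mod_cast this
  have hHhalf : δ₂ * M ≤ 2 * H := by linarith
  have hAK : A ≤ K * H := by
    have : (A : ℝ) ≤ K * H := by
      have e : 2000 * M ≤ K * δ₂ ^ 2 * M := by gcongr
      have e' : (K : ℝ) * δ₂ * (δ₂ * M) ≤ K * (1 / 4) * (2 * H) := by gcongr
      nlinarith
    exact_mod_cast this
  have hLK : 2 * P ≤ K * (H : ℝ) ^ 2 := by
    have e : 2000 * M ^ 2 ≤ K * δ₂ ^ 2 * M ^ 2 := by gcongr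
    have e' : (K : ℝ) * (δ₂ * M) ^ 2 ≤ K * (2 * H) ^ 2 := by gcongr
    rw [← hM2]
    nlinarith
  have hKδ : 4 ≤ K * δ₃ := by
    have : (K : ℝ) * δ₂ ^ 2 ≤ K * δ₃ := by gcongr; linarith
    linarith
  have hcore : ∀ u ∈ Finset.Icc (1 : ℤ) q,
      δ₃ * X / 2 ≤ (boxCount (twoMul m) A H (classFun f m q u)).re →
      P ^ 6 * (δ₂ ^ 5900 / 2001 ^ 2950) ≤ gowersPow 4 (classFun f m q u) := by
    intro u hu hpop
    have hinj : InjUpTo (twoMul m) (4 * A * H) := by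
      refine injUpTo_twoMul ?_
      have : 16 * ((A : ℤ) * H) < m := by exact_mod_cast hm
      linarith
    have hbig : (A : ℝ) ^ 2 * H ^ 6 * (2 * P) ≤
        K * ‖boxCount (twoMul m) A H (classFun f m q u)‖ := by
      calc (A : ℝ) ^ 2 * H ^ 6 * (2 * P) ≤ (A : ℝ) ^ 2 * (δ₂ * M) ^ 6 * (2 * P) := by gcongr
        _ = 4 * (X / 2) := by rw [hX]; ring
        _ ≤ K * δ₃ * (X / 2) := by gcongr
        _ = K * (δ₃ * X / 2) := by ring
        _ ≤ _ := by gcongr; exact hpop.trans (Complex.re_le_norm _)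
    have := gowersPow_four_ge (twoMul m) hH0 (hAH h21) hAK hinj hK2000
      (by positivity : 0 < 2 * P) hLK (hbdd u hu _ (by linarith)) hbig
    have hg := gowersPow_nonneg 4 (classFun f m q u)
    have h6 : P ^ 6 ≤ (2001 / δ₂ ^ 2) ^ 2950 * gowersPow 4 (classFun f m q u) := by
      calc P ^ 6 ≤ (2 * P) ^ 6 := by gcongr; linarith
        _ ≤ _ := this
        _ ≤ _ := by gcongr
    have hpos : (0 : ℝ) < (2001 / δ₂ ^ 2) ^ 2950 := by positivity
    have hinv : δ₂ ^ 5900 / 2001 ^ 2950 = ((2001 / δ₂ ^ 2) ^ 2950)⁻¹ := by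
      rw [div_pow, inv_div, ← pow_mul]
    rw [hinv, ← div_eq_mul_inv, div_le_iff₀ hpos, mul_comm]
    exact h6
  have := le_sum_of_popular (Finset.Icc (1 : ℤ) q) _ (fun u => gowersPow 4 (classFun f m q u)) hX0
    (by positivity : 0 ≤ P ^ 6 * (δ₂ ^ 5900 / 2001 ^ 2950)) hup hsum
    (fun u _ => gowersPow_nonneg _ _) hcore h3.le
  refine le_trans ?_ this
  rw [hcard]
  -- The proof yields `δ₂^5900 δ₃` with `5900 = 2 · 2950`; any exponent from 11801 on would do in
  -- place of `2 ^ 25`.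
  have hpw : (δ₂ * δ₃) ^ (2 ^ 25) ≤ δ₂ ^ 5900 * δ₃ := by
    have hs : δ₃ ^ 2 ≤ 2 ^ 2 := by gcongr
    refine mul_pow_le_pow_mul h2 h3 ?_ ?_ 5900 (by norm_num) (by linarith)
    · calc δ₂ * δ₃ ^ 2 ≤ 1 / 4 * 2 ^ 2 := by gcongr
        _ = 1 := by norm_num
    · calc δ₂ * δ₃ ≤ 1 / 4 * 2 := by gcongr
        _ ≤ 1 := by norm_num
  exact const_mul_le (by positivity) hq'.le hpw

end Quantitative
end QuantConcat
end

/-! ### Conclusion -/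

open QuantConcat in
theorem theorem5p1 :
    ∃ C : ℝ, 0 < C ∧ ∃ c : ℝ, 0 < c ∧
      ∀ (N q : ℕ) (f : ℤ → ℂ) (δ₁ δ₂ δ₃ M : ℝ),
        0 < q →
        (∀ x, ‖f x‖ ≤ 1) →
        (∀ x, f x ≠ 0 → x ∈ initSeg (N : ℝ)) →
        0 < δ₁ → δ₁ ≤ 1 → 0 < δ₂ → 0 < δ₃ →
        M = ((N : ℝ) / (q : ℝ)) ^ ((1 : ℝ) / 2) →
        δ₃ * (N : ℝ) * M ^ 3 ≤
          (𝔼 a ∈ initSeg (δ₁ * M), 𝔼 b ∈ initSeg (δ₁ * M),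
            boxSum δ₂ M (2 * (q : ℤ) * (a + b)) (2 * (q : ℤ) * b) (2 * (q : ℤ) * a) f).re →
        δ₂ < C * δ₁ ^ 3 * δ₃ ^ 4 →
        c * (δ₂ * δ₃) ^ (2 ^ 25) * ((N : ℝ) / (q : ℝ)) ^ 6 ≤
          𝔼 u ∈ initSeg (q : ℝ), gowersNormOn 5 (resClass u q) f ^ (2 ^ 5) := by
  refine ⟨1 / 64, by norm_num, 1 / (4 * 2001 ^ 2950), by positivity, ?_⟩
  intro N q f δ₁ δ₂ δ₃ M hq hb hf h1 h1' h2 h3 hM hyp hδ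
  rcases Nat.eq_zero_or_pos N with rfl | hN
  · rw [Nat.cast_zero, zero_div, zero_pow (by norm_num), mul_zero]
    exact Finset.expect_nonneg fun u _ => Even.pow_nonneg ⟨2 ^ 4, by norm_num⟩ _
  have hseg : ∀ n : ℕ, initSeg (n : ℝ) = Finset.Icc (1 : ℤ) n := fun n => by
    rw [initSeg_eq_Icc n.cast_nonneg, Nat.floor_natCast]
  simp only [hseg] at hf ⊢
  have hq' : (0 : ℝ) < q := by exact_mod_cast hq
  have hNq : 0 < (N : ℝ) / q := div_pos (by exact_mod_cast hN) hq'
  have hM0 : 0 < M := hM ▸ Real.rpow_pos_of_pos hNq _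
  have hM2 : M ^ 2 = (N : ℝ) / q := by
    rw [hM, ← Real.sqrt_eq_rpow, Real.sq_sqrt hNq.le]
  -- Oddness makes minimal representatives symmetric, `2N < m` keeps the supports from wrapping, and
  -- `16AH < m` makes `k ↦ 2k` injective on `|k| ≤ 4AH`.
  obtain ⟨m, hodd, hm, hm'⟩ : ∃ m : ℕ, Odd m ∧ 2 * N < m ∧
      16 * (⌊δ₁ * M⌋₊ * ⌊δ₂ * M⌋₊) < m :=
    ⟨2 * (N + 8 * (⌊δ₁ * M⌋₊ * ⌊δ₂ * M⌋₊)) + 1, ⟨_, rfl⟩, by omega, by omega⟩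
  have : NeZero m := ⟨hodd.pos.ne'⟩
  rw [expect_boxSum_eq hq hf (by positivity) (by positivity) hm hodd (by omega),
    Complex.re_ofReal_mul, Complex.re_sum] at hyp
  have := sum_gowersPow_ge hN hq hb hf h1 h1' h2 h3 hM0 hM2 hm' hyp hδ
  rw [Finset.expect_eq_sum_div_card, Int.card_Icc, show ((q : ℤ) + 1 - 1).toNat = q by simp,
    le_div_iff₀ hq']
  rw [Finset.sum_congr rfl fun u hu =>
    gowersNormOn_pow hq hm hodd (rel_classFun hodd.pos hf hu)]
  exact this
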